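/- Let $A$, $B$ be (not necessarily unital) C*-algebras. An $A$–$B$ correspondence is a right Hilbert $B$-module $X$ with a *-homomorphism $\varphi_X$ from $A$ into the adjointable operators $\mathcal L(X)$ that is non-degenerate, i.e. $\overline{\operatorname{span}}\,\varphi_X(A)X=X$; an $A$–$A$ correspondence is called an $A$-correspondence. It is *full* if $\overline{\operatorname{span}}\{\langle\xi,\eta\rangle:\xi,\eta\in X\}=B$, and *regular* if $\varphi_X$ is injective and $\varphi_X(A)\subseteq\mathcal K(X)$, where $\mathcal K(X)$ is the closed linear span of the rank-one operators $\zeta\mapsto\xi\langle\eta,\zeta\rangle$. Write $\otimes$ for the interior tensor product over the middle algebra and $\cong$ for unitary isomorphism (a surjective bimodule map preserving inner products). Let $m\ge 1$, let $X$ be an $A$-correspondence and $Y$ a $B$-correspondence, and suppose that $X$ and $Y$ are strong shift equivalent with lag $m$: there are C*-algebras $A=C_0,C_1,\dots,C_m=B$, $C_{i-1}$–$C_i$ correspondences $R_i$ and $C_i$–$C_{i-1}$ correspondences $S_i$ $(1\le i\le m)$ such that $$X\cong R_1\otimes S_1,\qquad S_i\otimes R_i\cong R_{i+1}\otimes S_{i+1}\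 (1\le i\le m-1),\qquad S_m\otimes R_m\cong Y.$$ 1. If $X$ and $Y$ are regular, then there are C*-algebras $A=C_0',C_1',\dots,C_m'=B$ and $C_{i-1}'$–$C_i'$ correspondences $R_i'$ and $C_i'$–$C_{i-1}'$ correspondences $S_i'$ $(1\le i\le m)$ satisfying the same relations, with the same lag $m$, such that $S_i'\otimes R_i'$ and $R_{i+1}'\otimes S_{i+1}'$ are regular for every $i=1,\dots,m-1$. 2. If $X$ and $Y$ are regular and full, then there are such $C_i'$, $R_i'$, $S_i'$ for which $S_i'\otimes R_i'$ and $R_{i+1}'\otimes S_{i+1}'$ are regular and full for every $i=1,\dots,m-1$. -/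

import Mathlib

universe u v

namespace CStarCorr

open scoped TensorProduct

/-- A complex vector space `V` with a right action of the C*-algebra `B` and a `B`-valued
semi-inner product, conjugate linear in the first and linear in the second variable.
An element of `B` is positive when it is of the form `b* b`. -/
structure InnerModule (B : Type u) [NonUnitalCStarAlgebra B]
    (V : Type v) [AddCommGroup V] [Module ℂ V] where
  rsmul : V →ₗ[ℂ] B →ₗ[ℂ] V
  rsmul_mul : ∀ x b c, rsmul x (b * c) = rsmul (rsmul x b) c
  inner : V →ₗ⋆[ℂ] V →ₗ[ℂ] B
  inner_rsmul : ∀ x y b, inner x (rsmul y b) = inner x y * b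
  star_inner : ∀ x y, star (inner x y) = inner y x
  inner_self_nonneg : ∀ x, ∃ b, inner x x = star b * b

namespace InnerModule

section order

attribute [local instance] CStarAlgebra.spectralOrder CStarAlgebra.spectralOrderedRing

variable {A B : Type u} [NonUnitalCStarAlgebra A] [NonUnitalCStarAlgebra B]
  {V : Type v} [AddCommGroup V] [Module ℂ V]
  (M : InnerModule B V)

theorem nonneg (x : V) : 0 ≤ M.inner x x :=
  CStarAlgebra.nonneg_iff_eq_star_mul_self.mpr (M.inner_self_nonneg x)

theorem rsmul_inner (x y : V) (b : B) : M.inner (M.rsmul x b) y = star b * M.inner x y := by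
  rw [← M.star_inner, M.inner_rsmul, star_mul, M.star_inner]

theorem norm_inner_comm (x y : V) : ‖M.inner x y‖ = ‖M.inner y x‖ := by
  rw [← M.star_inner, norm_star]

/-- The Cauchy--Schwarz inequality. -/
theorem norm_inner_sq_le (x y : V) :
    ‖M.inner x y‖ ^ 2 ≤ ‖M.inner x x‖ * ‖M.inner y y‖ := by
  have key : ∀ t : ℝ, 0 < t → ‖M.inner x x‖ ≤ t → ‖M.inner x y‖ ^ 2 ≤ t * ‖M.inner y y‖ := by
    intro t ht hxt
    set a := M.inner x y with ha
    have h0 := M.nonneg (M.rsmul x a - (t : ℂ) • y)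
    have h1 : M.inner (M.rsmul x a - (t : ℂ) • y) (M.rsmul x a - (t : ℂ) • y)
        = star a * M.inner x x * a - t • (star a * a) - t • (star a * a)
          + t • (t • M.inner y y) := by
      have hyx : M.inner y x = star a := by rw [ha, M.star_inner]
      simp only [map_sub, LinearMap.sub_apply, M.inner_rsmul, M.rsmul_inner, map_smul,
        LinearMap.map_smulₛₗ, LinearMap.smul_apply, hyx, ← ha, Complex.conj_ofReal]
      simp only [Complex.coe_smul, smul_sub]
      abel
    have h2 : star a * M.inner x x * a ≤ t • (star a * a) := by
      refine (CStarAlgebra.star_left_conjugate_le_norm_smul (M.star_inner x x)).trans ?_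
      exact smul_le_smul_of_nonneg_right hxt (star_mul_self_nonneg a)
    have h3 : t • (star a * a) ≤ t • (t • M.inner y y) := by
      rw [h1] at h0
      rw [← sub_nonneg] at h2 ⊢
      refine (add_nonneg h0 h2).trans (le_of_eq ?_)
      abel
    have h4 : star a * a ≤ t • M.inner y y := (smul_le_smul_iff_of_pos_left ht).mp h3
    have h5 := CStarAlgebra.norm_le_norm_of_nonneg_of_le (star_mul_self_nonneg a) h4
    rw [CStarRing.norm_star_mul_self, norm_smul, Real.norm_of_nonneg ht.le] at h5
    rw [sq]; exact h5
  refine le_of_forall_pos_le_add fun ε hε => ?_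
  have hd : 0 < ‖M.inner y y‖ + 1 := by positivity
  have h := key (‖M.inner x x‖ + ε / (‖M.inner y y‖ + 1)) (by positivity)
    (by linarith [div_pos hε hd])
  refine h.trans ?_
  rw [add_mul]
  gcongr
  rw [div_mul_eq_mul_div, div_le_iff₀ hd]
  nlinarith [norm_nonneg (M.inner y y)]

theorem norm_inner_le (x y : V) :
    ‖M.inner x y‖ ≤ √‖M.inner x x‖ * √‖M.inner y y‖ := by
  rw [← Real.sqrt_mul (norm_nonneg _)]
  exact Real.le_sqrt_of_sq_le (M.norm_inner_sq_le x y)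

theorem norm_rsmul_le (x : V) (b : B) :
    √‖M.inner (M.rsmul x b) (M.rsmul x b)‖ ≤ √‖M.inner x x‖ * ‖b‖ := by
  rw [← Real.sqrt_sq (norm_nonneg b), ← Real.sqrt_mul (norm_nonneg _)]
  refine Real.sqrt_le_sqrt ?_
  rw [M.inner_rsmul, M.rsmul_inner]
  refine (norm_mul_le _ _).trans ?_
  refine (mul_le_mul_of_nonneg_right (norm_mul_le _ _) (norm_nonneg _)).trans (le_of_eq ?_)
  rw [norm_star]; ring

theorem norm_add_le (x y : V) : √‖M.inner (x + y) (x + y)‖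
    ≤ √‖M.inner x x‖ + √‖M.inner y y‖ := by
  refine Real.sqrt_le_left (by positivity) |>.mpr ?_
  have h1 := M.norm_inner_le x y
  have h2 := M.norm_inner_comm x y
  simp only [map_add, LinearMap.add_apply]
  calc _ ≤ ‖M.inner x x‖ + ‖M.inner y x‖ + (‖M.inner x y‖ + ‖M.inner y y‖) :=
        (_root_.norm_add_le _ _).trans
          (add_le_add (_root_.norm_add_le _ _) (_root_.norm_add_le _ _))
    _ ≤ _ := by
        rw [add_sq, Real.sq_sqrt (norm_nonneg _), Real.sq_sqrt (norm_nonneg _)]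
        linarith

/-- Left multiplication by `a` through a *-representation on a semi-inner product module is
bounded by `‖a‖`. -/
theorem norm_lsmul_le (L : A →ₙₐ[ℂ] Module.End ℂ V)
    (hL : ∀ a x y, M.inner (L a x) y = M.inner x (L (star a) y)) (a : A) (x : V) :
    √‖M.inner (L a x) (L a x)‖ ≤ ‖a‖ * √‖M.inner x x‖ := by
  obtain ⟨c, hc⟩ := CStarAlgebra.nonneg_iff_eq_star_mul_self.mp
    (sub_nonneg.mpr (CStarAlgebra.star_mul_le_algebraMap_norm_sq (a := (a : Unitization ℂ A))))
  rw [Unitization.norm_inr, sub_eq_iff_eq_add] at hc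
  have hf := congrArg (fun z => z.fst) hc
  have hs := congrArg (fun z => z.snd) hc
  set l := c.fst
  set b := c.snd
  have hf' : star l * l = ((‖a‖ ^ 2 : ℝ) : ℂ) := by
    simpa [Algebra.algebraMap_eq_smul_one] using hf.symm
  have hs' : star l • b + l • star b + star b * b = - (star a * a) := by
    rw [eq_neg_iff_add_eq_zero]
    simpa [Algebra.algebraMap_eq_smul_one] using hs.symm
  have h1 : M.inner (l • x + L b x) (l • x + L b x) =
      (‖a‖ ^ 2) • M.inner x x - M.inner (L a x) (L a x) := by
    have e1 : M.inner (l • x + L b x) (l • x + L b x) = (star l * l) • M.inner x x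
        + M.inner x (L (star l • b + l • star b + star b * b) x) := by
      simp only [map_add, map_smul, map_mul, LinearMap.add_apply, LinearMap.map_smulₛₗ, hL,
        LinearMap.smul_apply, Module.End.mul_apply, smul_add, starRingEnd_apply]
      rw [mul_comm (star l) l, mul_smul]
      abel
    rw [e1, hs', hf', hL, map_neg, map_mul, Complex.coe_smul]
    simp [sub_eq_add_neg]
  have h2 : M.inner (L a x) (L a x) ≤ (‖a‖ ^ 2) • M.inner x x := by
    rw [← sub_nonneg, ← h1]; exact M.nonneg _
  have h3 := CStarAlgebra.norm_le_norm_of_nonneg_of_le (M.nonneg _) h2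
  rw [norm_smul, Real.norm_of_nonneg (by positivity)] at h3
  refine (Real.sqrt_le_sqrt h3).trans (le_of_eq ?_)
  rw [Real.sqrt_mul (by positivity), Real.sqrt_sq (norm_nonneg _)]

/-- The negative part of a self-adjoint element of a C*-algebra. -/
theorem exists_neg_part {D : Type u} [NonUnitalCStarAlgebra D] {G : D} (hsa : IsSelfAdjoint G) :
    ∃ P Q : D, star P = P ∧ P = star Q * Q ∧ P * G = - (P * P) ∧
      (P = 0 → ∃ N, G = star N * N) := by
  have hP0 : 0 ≤ G⁻ := CFC.negPart_nonneg G
  obtain ⟨Q, hQ⟩ := CStarAlgebra.nonneg_iff_eq_star_mul_self.mp hP0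
  refine ⟨G⁻, Q, hP0.isSelfAdjoint, hQ, ?_, fun h => ?_⟩
  · have h := congrArg (G⁻ * ·) (CFC.posPart_sub_negPart G hsa)
    simp only [mul_sub, CFC.negPart_mul_posPart, zero_sub] at h
    exact h.symm
  · exact CStarAlgebra.nonneg_iff_eq_star_mul_self.mp ((CFC.negPart_eq_zero_iff G hsa).mp h)

/-- The Gram matrix of a finite family is positive, that is, of the form `N* N`. -/
theorem exists_gram {n : ℕ} (x : Fin n → V) :
    ∃ N : Fin n → Fin n → B, ∀ i j, M.inner (x i) (x j) = ∑ k, star (N k i) * N k j := by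
  let G : CStarMatrix (Fin n) (Fin n) B := CStarMatrix.ofMatrix fun i j => M.inner (x i) (x j)
  have hG : ∀ i j, G i j = M.inner (x i) (x j) := fun _ _ => rfl
  have hsa : IsSelfAdjoint G := by
    ext i j
    rw [CStarMatrix.star_apply, hG, hG, M.star_inner]
  obtain ⟨P, Q, hPs, hQ, h2, hN⟩ := exists_neg_part hsa
  have hP0 : P = 0 := by
    have h1 : P * G * P = - (star (Q * P) * (Q * P)) := by
      rw [h2, star_mul, hPs, mul_assoc P, ← mul_assoc (star Q), ← hQ, neg_mul, mul_assoc]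
    have h3 : ∀ k, (P * G * P) k k = M.inner (∑ i, M.rsmul (x i) (P i k))
        (∑ i, M.rsmul (x i) (P i k)) := by
      intro k
      simp only [CStarMatrix.mul_apply, map_sum, LinearMap.sum_apply, M.inner_rsmul,
        M.rsmul_inner, hG, Finset.sum_mul]
      refine Finset.sum_congr rfl fun j _ => Finset.sum_congr rfl fun i _ => ?_
      rw [← CStarMatrix.star_apply, hPs]
    have h4 : ∀ k, ∀ i, (Q * P) i k = 0 := by
      intro k
      have h5 : ∑ i, star ((Q * P) i k) * (Q * P) i k = 0 := by
        have h6 : 0 ≤ (P * G * P) k k := by rw [h3]; exact M.nonneg _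
        rw [h1, CStarMatrix.neg_apply, CStarMatrix.mul_apply] at h6
        simp only [CStarMatrix.star_apply] at h6
        exact le_antisymm (neg_nonneg.mp h6)
          (Finset.sum_nonneg fun i _ => star_mul_self_nonneg _)
      intro i
      have := (Finset.sum_eq_zero_iff_of_nonneg
        (fun i _ => star_mul_self_nonneg ((Q * P) i k))).mp h5 i (Finset.mem_univ i)
      exact (CStarRing.star_mul_self_eq_zero_iff _).mp this
    have h7 : Q * P = 0 := by ext i k; exact h4 k i
    have h8 : star P * P = 0 := by
      rw [hPs]; nth_rewrite 1 [hQ]; rw [mul_assoc, h7, mul_zero]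
    exact (CStarRing.star_mul_self_eq_zero_iff _).mp h8
  obtain ⟨N, hN⟩ := hN hP0
  refine ⟨fun k i => N k i, fun i j => ?_⟩
  rw [← hG, hN, CStarMatrix.mul_apply]
  simp only [CStarMatrix.star_apply]

end order
end InnerModule

namespace InnerModule

variable {B : Type u} [NonUnitalCStarAlgebra B] {V : Type v} [AddCommGroup V] [Module ℂ V]

/-- The space `V` with the seminorm `‖x‖ = ‖⟨x, x⟩‖ ^ (1/2)`. -/
def Pre (_M : InnerModule B V) : Type v := V

instance (M : InnerModule B V) : AddCommGroup M.Pre := inferInstanceAs (AddCommGroup V)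

instance (M : InnerModule B V) : Module ℂ M.Pre := inferInstanceAs (Module ℂ V)

/-- The linear bijection from `V` to `V` with its seminorm. -/
def toPre (M : InnerModule B V) : V ≃ₗ[ℂ] M.Pre := LinearEquiv.refl ℂ V

noncomputable instance (M : InnerModule B V) : Norm M.Pre where
  norm x := √‖M.inner (M.toPre.symm x) (M.toPre.symm x)‖

theorem norm_toPre (M : InnerModule B V) (x : V) : ‖M.toPre x‖ = √‖M.inner x x‖ := rfl

theorem preCore (M : InnerModule B V) : SeminormedSpace.Core ℂ M.Pre where
  norm_nonneg _ := Real.sqrt_nonneg _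
  norm_smul c x := by
    obtain ⟨x, rfl⟩ := M.toPre.surjective x
    rw [← map_smul, norm_toPre, norm_toPre]
    simp only [map_smul, LinearMap.map_smulₛₗ, LinearMap.smul_apply, norm_smul, RCLike.norm_conj]
    rw [← mul_assoc, Real.sqrt_mul (by positivity), Real.sqrt_mul_self (norm_nonneg _)]
  norm_triangle x y := M.norm_add_le x y

noncomputable instance (M : InnerModule B V) : SeminormedAddCommGroup M.Pre :=
  SeminormedAddCommGroup.ofCore M.preCore

instance (M : InnerModule B V) : NormedSpace ℂ M.Pre where
  norm_smul_le c x := (M.preCore.norm_smul c x).le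

/-- The separated completion of `V`. -/
abbrev Compl (M : InnerModule B V) : Type v := UniformSpace.Completion M.Pre

/-- The canonical map of `V` into its separated completion. -/
noncomputable def ι (M : InnerModule B V) : V →ₗ[ℂ] M.Compl :=
  (UniformSpace.Completion.toComplₗᵢ (𝕜 := ℂ) (E := M.Pre)).toLinearMap ∘ₗ M.toPre.toLinearMap

theorem norm_ι (M : InnerModule B V) (x : V) : ‖M.ι x‖ = √‖M.inner x x‖ :=
  (UniformSpace.Completion.norm_coe (M.toPre x)).trans (M.norm_toPre x)

theorem denseRange_ι (M : InnerModule B V) : DenseRange M.ι :=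
  (UniformSpace.Completion.denseRange_coe (α := M.Pre)).comp
    M.toPre.surjective.denseRange (UniformSpace.Completion.continuous_coe _)

section extend

variable (M : InnerModule B V)

/-- `⟨x, ·⟩` as a continuous map on the completion. -/
noncomputable def innerRight (x : V) : M.Compl →L[ℂ] B := (M.inner x).extendOfNorm M.ι

theorem innerRight_ι (x y : V) : M.innerRight x (M.ι y) = M.inner x y :=
  LinearMap.extendOfNorm_eq M.denseRange_ι
    ⟨√‖M.inner x x‖, fun y => by rw [M.norm_ι]; exact M.norm_inner_le x y⟩ y

theorem norm_innerRight_le (x : V) : ‖M.innerRight x‖ ≤ ‖M.ι x‖ :=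
  LinearMap.opNorm_extendOfNorm_le M.denseRange_ι (norm_nonneg _)
    fun y => by rw [M.norm_ι, M.norm_ι]; exact M.norm_inner_le x y

theorem clm_ext {F : Type*} [NormedAddCommGroup F] [NormedSpace ℂ F] {f g : M.Compl →L[ℂ] F}
    (h : ∀ x, f (M.ι x) = g (M.ι x)) : f = g :=
  DFunLike.coe_injective (M.denseRange_ι.equalizer f.continuous g.continuous (funext h))

/-- The semi-inner product as a map into the dual of the completion. -/
noncomputable def innerRightₗ : V →ₗ⋆[ℂ] M.Compl →L[ℂ] B where
  toFun := M.innerRight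
  map_add' x y := M.clm_ext fun z => by simp [innerRight_ι]
  map_smul' c x := M.clm_ext fun z => by simp [innerRight_ι]

/-- The inner product on the completion. -/
noncomputable def innerCompl : M.Compl →L⋆[ℂ] M.Compl →L[ℂ] B :=
  M.innerRightₗ.extendOfNorm M.ι

theorem innerCompl_ι (x y : V) : M.innerCompl (M.ι x) (M.ι y) = M.inner x y := by
  rw [innerCompl, LinearMap.extendOfNorm_eq M.denseRange_ι
    ⟨1, fun y => by rw [one_mul]; exact M.norm_innerRight_le y⟩]
  exact M.innerRight_ι x y

/-- Right multiplication of a vector of `V`, as a continuous map into the completion. -/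
noncomputable def rsmulPre (x : V) : B →L[ℂ] M.Compl :=
  LinearMap.mkContinuous (M.ι ∘ₗ M.rsmul x) ‖M.ι x‖ fun b => by
    simpa [M.norm_ι] using M.norm_rsmul_le x b

theorem norm_rsmulPre_le (x : V) : ‖M.rsmulPre x‖ ≤ ‖M.ι x‖ :=
  LinearMap.mkContinuous_norm_le _ (norm_nonneg _) _

/-- Right multiplication, with values in the completion. -/
noncomputable def rsmulPreₗ : V →ₗ[ℂ] B →L[ℂ] M.Compl where
  toFun := M.rsmulPre
  map_add' x y := by ext b; simp [rsmulPre]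
  map_smul' c x := by ext b; simp [rsmulPre]

/-- Right multiplication on the completion. -/
noncomputable def rsmulCompl : M.Compl →L[ℂ] B →L[ℂ] M.Compl :=
  M.rsmulPreₗ.extendOfNorm M.ι

theorem rsmulCompl_ι (x : V) (b : B) : M.rsmulCompl (M.ι x) b = M.ι (M.rsmul x b) := by
  rw [rsmulCompl, LinearMap.extendOfNorm_eq M.denseRange_ι
    ⟨1, fun y => by
      rw [one_mul]; exact M.norm_rsmulPre_le y⟩]
  rfl

section order

attribute [local instance] CStarAlgebra.spectralOrder CStarAlgebra.spectralOrderedRing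

theorem innerCompl_nonneg (z : M.Compl) : ∃ b, M.innerCompl z z = star b * b := by
  rw [← CStarAlgebra.nonneg_iff_eq_star_mul_self]
  have hc : Continuous fun z : M.Compl => M.innerCompl z z := by fun_prop
  refine M.denseRange_ι.induction_on z (CStarAlgebra.isClosed_nonneg.preimage hc) fun x => ?_
  rw [M.innerCompl_ι]
  exact M.nonneg x

end order

/-- The separated completion as a semi-inner product module (in fact a Hilbert module). -/
noncomputable def compl : InnerModule B M.Compl where
  rsmul := ContinuousLinearMap.coeLM ℂ ∘ₗ M.rsmulCompl.toLinearMap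
  rsmul_mul z b c := by
    refine M.denseRange_ι.induction_on z ?_ fun x => ?_
    · exact isClosed_eq (by simp; fun_prop) (by simp; fun_prop)
    · simp [rsmulCompl_ι, M.rsmul_mul]
  inner := (ContinuousLinearMap.coeLM ℂ).comp M.innerCompl.toLinearMap
  inner_rsmul z w b := by
    refine M.denseRange_ι.induction_on₂
      (p := fun z w => M.innerCompl z (M.rsmulCompl w b) = M.innerCompl z w * b) ?_ (fun x y => ?_) z w
    · exact isClosed_eq (by fun_prop) (by fun_prop)
    · simp [rsmulCompl_ι, innerCompl_ι, M.inner_rsmul]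
  star_inner z w := by
    refine M.denseRange_ι.induction_on₂
      (p := fun z w => star (M.innerCompl z w) = M.innerCompl w z) ?_ (fun x y => ?_) z w
    · exact isClosed_eq (by fun_prop) (by fun_prop)
    · simp [innerCompl_ι, M.star_inner]
  inner_self_nonneg z := M.innerCompl_nonneg z

theorem compl_norm_sq (z : M.Compl) : ‖z‖ ^ 2 = ‖M.compl.inner z z‖ := by
  change ‖z‖ ^ 2 = ‖M.innerCompl z z‖
  refine M.denseRange_ι.induction_on z (isClosed_eq (by fun_prop) (by fun_prop)) fun x => ?_
  rw [M.norm_ι, M.innerCompl_ι, Real.sq_sqrt (norm_nonneg _)]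

variable {A : Type u} [NonUnitalCStarAlgebra A] (L : A →ₙₐ[ℂ] Module.End ℂ V)

/-- The extension of a left action to the completion. -/
noncomputable def lsmulCompl (a : A) : M.Compl →L[ℂ] M.Compl := (M.ι ∘ₗ L a).extendOfNorm M.ι

theorem lsmulCompl_ι (hL : ∀ a x y, M.inner (L a x) y = M.inner x (L (star a) y)) (a : A) (x : V) : M.lsmulCompl L a (M.ι x) = M.ι (L a x) :=
  LinearMap.extendOfNorm_eq M.denseRange_ι
    ⟨‖a‖, fun y => by simpa [M.norm_ι] using M.norm_lsmul_le L hL a y⟩ x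

/-- The extension of a left action to the completion, as a homomorphism. -/
noncomputable def complLeft
    (hL : ∀ a x y, M.inner (L a x) y = M.inner x (L (star a) y)) : A →ₙₐ[ℂ] (M.Compl →L[ℂ] M.Compl) where
  toFun := M.lsmulCompl L
  map_smul' c a := M.clm_ext fun x => by simp [M.lsmulCompl_ι L hL]
  map_zero' := M.clm_ext fun x => by simp [M.lsmulCompl_ι L hL]
  map_add' a b := M.clm_ext fun x => by simp [M.lsmulCompl_ι L hL]
  map_mul' a b := M.clm_ext fun x => by simp [M.lsmulCompl_ι L hL]

theorem complLeft_ι (hL : ∀ a x y, M.inner (L a x) y = M.inner x (L (star a) y))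
    (a : A) (x : V) : M.complLeft L hL a (M.ι x) = M.ι (L a x) :=
  M.lsmulCompl_ι L hL a x

end extend

end InnerModule

/-- A C*-correspondence from `A` to `B`: a right Hilbert `B`-module with a non-degenerate
*-representation `φ` of `A` by adjointable operators, `φ (star a)` being the adjoint of `φ a`. -/
structure Correspondence (A B : Type u) [NonUnitalCStarAlgebra A] [NonUnitalCStarAlgebra B] where
  carrier : Type v
  [normedAddCommGroup : NormedAddCommGroup carrier]
  [normedSpace : NormedSpace ℂ carrier]
  [completeSpace : CompleteSpace carrier]
  mod : InnerModule B carrier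
  norm_sq_eq : ∀ x, ‖x‖ ^ 2 = ‖mod.inner x x‖
  φ : A →ₙₐ[ℂ] (carrier →L[ℂ] carrier)
  inner_φ : ∀ a x y, mod.inner (φ a x) y = mod.inner x (φ (star a) y)
  nondegenerate : (Submodule.span ℂ {z | ∃ a x, φ a x = z}).topologicalClosure = ⊤

namespace Correspondence

attribute [instance] normedAddCommGroup normedSpace completeSpace

variable {A B C : Type u} [NonUnitalCStarAlgebra A] [NonUnitalCStarAlgebra B]
  [NonUnitalCStarAlgebra C]

theorem norm_eq (X : Correspondence.{u, v} A B) (x : X.carrier) :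
    ‖x‖ = √‖X.mod.inner x x‖ := by
  rw [← X.norm_sq_eq, Real.sqrt_sq (norm_nonneg _)]

theorem norm_inner_le (X : Correspondence.{u, v} A B) (x y : X.carrier) :
    ‖X.mod.inner x y‖ ≤ ‖x‖ * ‖y‖ := by
  rw [X.norm_eq, X.norm_eq]; exact X.mod.norm_inner_le x y

theorem norm_rsmul_le (X : Correspondence.{u, v} A B) (x : X.carrier) (b : B) :
    ‖X.mod.rsmul x b‖ ≤ ‖x‖ * ‖b‖ := by
  rw [X.norm_eq, X.norm_eq]; exact X.mod.norm_rsmul_le x b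

theorem inner_φ_right (X : Correspondence.{u, v} A B) (a : A) (x y : X.carrier) :
    X.mod.inner x (X.φ a y) = X.mod.inner (X.φ (star a) x) y := by
  rw [X.inner_φ, star_star]

theorem norm_φ_le (X : Correspondence.{u, v} A B) (a : A) (x : X.carrier) :
    ‖X.φ a x‖ ≤ ‖a‖ * ‖x‖ := by
  rw [X.norm_eq, X.norm_eq]
  let L : A →ₙₐ[ℂ] Module.End ℂ X.carrier :=
    { toFun := fun a => (X.φ a).toLinearMap
      map_smul' := fun c a => by ext; simp
      map_zero' := by ext; simp
      map_add' := fun a b => by ext; simp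
      map_mul' := fun a b => by ext; simp }
  exact X.mod.norm_lsmul_le L X.inner_φ a x

/-- The rank-one operator `ζ ↦ ξ ⟨η, ζ⟩`. -/
noncomputable def theta (X : Correspondence.{u, v} A B) (ξ η : X.carrier) :
    X.carrier →L[ℂ] X.carrier :=
  LinearMap.mkContinuous (X.mod.rsmul ξ ∘ₗ X.mod.inner η) (‖ξ‖ * ‖η‖) fun ζ => by
    refine (X.norm_rsmul_le ξ _).trans ?_
    rw [mul_assoc]
    exact mul_le_mul_of_nonneg_left (X.norm_inner_le η ζ) (norm_nonneg _)

/-- The generalized compact operators: the closed linear span of the rank-one operators. -/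
noncomputable def compacts (X : Correspondence.{u, v} A B) :
    Submodule ℂ (X.carrier →L[ℂ] X.carrier) :=
  (Submodule.span ℂ {T | ∃ ξ η, X.theta ξ η = T}).topologicalClosure

/-- The left action is injective. -/
def IsInjective (X : Correspondence.{u, v} A B) : Prop := Function.Injective X.φ

/-- The left action is by generalized compact operators. -/
def IsProper (X : Correspondence.{u, v} A B) : Prop := ∀ a, X.φ a ∈ X.compacts

/-- Injective and proper. -/
def IsRegular (X : Correspondence.{u, v} A B) : Prop := X.IsInjective ∧ X.IsProper

/-- The inner products span a dense subspace of `B`. -/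
def IsFull (X : Correspondence.{u, v} A B) : Prop :=
  (Submodule.span ℂ {b | ∃ ξ η, X.mod.inner ξ η = b}).topologicalClosure = ⊤

/-- Unitary isomorphism: there is a surjective bimodule map preserving inner products
(which is then injective). -/
def Iso (X Y : Correspondence.{u, v} A B) : Prop :=
  ∃ U : X.carrier →ₗ[ℂ] Y.carrier, Function.Surjective U ∧
    (∀ a x, U (X.φ a x) = Y.φ a (U x)) ∧
    (∀ x b, U (X.mod.rsmul x b) = Y.mod.rsmul (U x) b) ∧
    ∀ x y, Y.mod.inner (U x) (U y) = X.mod.inner x y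

section tensor

variable (X : Correspondence.{u, v} A B) (Y : Correspondence.{u, v} B C)

/-- The functional `x' ⊗ y' ↦ ⟨y, ⟨x, x'⟩ y'⟩`. -/
noncomputable def tensorInnerRight (x : X.carrier) (y : Y.carrier) :
    X.carrier ⊗[ℂ] Y.carrier →ₗ[ℂ] C :=
  TensorProduct.lift (LinearMap.mk₂ ℂ (fun x' y' => Y.mod.inner y (Y.φ (X.mod.inner x x') y'))
    (by simp) (by simp) (by simp) (by simp))

@[simp]
theorem tensorInnerRight_tmul (x x' : X.carrier) (y y' : Y.carrier) :
    X.tensorInnerRight Y x y (x' ⊗ₜ y') = Y.mod.inner y (Y.φ (X.mod.inner x x') y') := rfl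

/-- The semi-inner product `⟨x ⊗ y, x' ⊗ y'⟩ = ⟨y, ⟨x, x'⟩ y'⟩`. -/
noncomputable def tensorInner :
    X.carrier ⊗[ℂ] Y.carrier →ₗ⋆[ℂ] X.carrier ⊗[ℂ] Y.carrier →ₗ[ℂ] C :=
  TensorProduct.lift (LinearMap.mk₂'ₛₗ _ _ (X.tensorInnerRight Y)
    (fun x₁ x₂ y => TensorProduct.ext' fun x' y' => by simp)
    (fun c x y => TensorProduct.ext' fun x' y' => by simp)
    (fun x y₁ y₂ => TensorProduct.ext' fun x' y' => by simp)
    (fun c x y => TensorProduct.ext' fun x' y' => by simp))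

@[simp]
theorem tensorInner_tmul (x x' : X.carrier) (y y' : Y.carrier) :
    X.tensorInner Y (x ⊗ₜ y) (x' ⊗ₜ y') = Y.mod.inner y (Y.φ (X.mod.inner x x') y') := rfl

/-- The right action `(x ⊗ y) c = x ⊗ y c`. -/
noncomputable def tensorRsmul :
    X.carrier ⊗[ℂ] Y.carrier →ₗ[ℂ] C →ₗ[ℂ] X.carrier ⊗[ℂ] Y.carrier :=
  (LinearMap.lTensorHom X.carrier ∘ₗ Y.mod.rsmul.flip).flip

@[simp]
theorem tensorRsmul_tmul (x : X.carrier) (y : Y.carrier) (c : C) :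
    X.tensorRsmul Y (x ⊗ₜ y) c = x ⊗ₜ Y.mod.rsmul y c := rfl

/-- The left action `a (x ⊗ y) = a x ⊗ y`. -/
noncomputable def tensorLsmul : A →ₙₐ[ℂ] Module.End ℂ (X.carrier ⊗[ℂ] Y.carrier) where
  toFun a := LinearMap.rTensor Y.carrier (X.φ a).toLinearMap
  map_smul' c a := TensorProduct.ext' fun x y => by simp [TensorProduct.smul_tmul']
  map_zero' := TensorProduct.ext' fun x y => by simp
  map_add' a b := TensorProduct.ext' fun x y => by simp
  map_mul' a b := TensorProduct.ext' fun x y => by simp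

@[simp]
theorem tensorLsmul_tmul (x : X.carrier) (y : Y.carrier) (a : A) :
    X.tensorLsmul Y a (x ⊗ₜ y) = X.φ a x ⊗ₜ y := rfl

section order

attribute [local instance] CStarAlgebra.spectralOrder CStarAlgebra.spectralOrderedRing

theorem tensorInner_nonneg (z : X.carrier ⊗[ℂ] Y.carrier) :
    ∃ c, X.tensorInner Y z z = star c * c := by
  rw [← CStarAlgebra.nonneg_iff_eq_star_mul_self]
  obtain ⟨n, x, y, rfl⟩ := TensorProduct.exists_sum_tmul_eq z
  obtain ⟨N, hN⟩ := X.mod.exists_gram x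
  have h : X.tensorInner Y (∑ j, x j ⊗ₜ y j) (∑ j, x j ⊗ₜ y j) =
      ∑ k, Y.mod.inner (∑ i, Y.φ (N k i) (y i)) (∑ i, Y.φ (N k i) (y i)) := by
    simp only [map_sum, LinearMap.sum_apply, tensorInner_tmul, hN, Y.inner_φ, map_mul,
      sum_apply, mul_apply_eq_comp]
    rw [Finset.sum_congr rfl fun i _ => Finset.sum_comm, Finset.sum_comm]
  rw [h]
  exact Finset.sum_nonneg fun k _ => Y.mod.nonneg _

end order

/-- The algebraic tensor product with its semi-inner product. Elements
`x b ⊗ y - x ⊗ b y` have length zero, so balancing over `B` happens in the separated completion. -/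
noncomputable def tensorPre : InnerModule C (X.carrier ⊗[ℂ] Y.carrier) where
  rsmul := X.tensorRsmul Y
  rsmul_mul z b c := by
    induction z with
    | zero => simp
    | tmul x y => simp [Y.mod.rsmul_mul]
    | add z w hz hw => simp [hz, hw]
  inner := X.tensorInner Y
  inner_rsmul z w c := by
    induction w with
    | zero => simp
    | add w w' hw hw' => simp [hw, hw', add_mul]
    | tmul x' y' =>
      induction z with
      | zero => simp
      | add z z' hz hz' => rw [map_add, LinearMap.add_apply, LinearMap.add_apply, hz, hz', add_mul]
      | tmul x y => simp [Y.inner_φ_right, Y.mod.inner_rsmul]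
  star_inner z w := by
    induction w with
    | zero => simp
    | add w w' hw hw' => simp [hw, hw']
    | tmul x' y' =>
      induction z with
      | zero => simp
      | add z z' hz hz' => simp [hz, hz']
      | tmul x y => simp [Y.mod.star_inner, Y.inner_φ, X.mod.star_inner]
  inner_self_nonneg := X.tensorInner_nonneg Y

theorem tensorLsmul_adjoint (a : A) (z w : X.carrier ⊗[ℂ] Y.carrier) :
    (X.tensorPre Y).inner (X.tensorLsmul Y a z) w
      = (X.tensorPre Y).inner z (X.tensorLsmul Y (star a) w) := by
  change X.tensorInner Y _ _ = X.tensorInner Y _ _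
  induction w with
  | zero => simp
  | add w w' hw hw' => simp [hw, hw']
  | tmul x' y' =>
    induction z with
    | zero => simp
    | add z z' hz hz' => simp [hz, hz']
    | tmul x y => simp [X.inner_φ]

theorem norm_ι_tmul_le (x : X.carrier) (y : Y.carrier) :
    ‖(X.tensorPre Y).ι (x ⊗ₜ y)‖ ≤ ‖y‖ * ‖x‖ := by
  rw [InnerModule.norm_ι]
  refine Real.sqrt_le_left (by positivity) |>.mpr ?_
  change ‖Y.mod.inner y (Y.φ (X.mod.inner x x) y)‖ ≤ _
  refine (Y.norm_inner_le _ _).trans ?_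
  have h := Y.norm_φ_le (X.mod.inner x x) y
  rw [← X.norm_sq_eq] at h
  nlinarith [norm_nonneg y]

/-- The interior tensor product `X ⊗ Y` over `B`. -/
noncomputable def tensor : Correspondence.{u, v} A C where
  carrier := (X.tensorPre Y).Compl
  mod := (X.tensorPre Y).compl
  norm_sq_eq := (X.tensorPre Y).compl_norm_sq
  φ := (X.tensorPre Y).complLeft (X.tensorLsmul Y) (X.tensorLsmul_adjoint Y)
  inner_φ a z w := by
    refine (X.tensorPre Y).denseRange_ι.induction_on₂
      (p := fun z w => (X.tensorPre Y).innerCompl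
        ((X.tensorPre Y).complLeft (X.tensorLsmul Y) (X.tensorLsmul_adjoint Y) a z) w
        = (X.tensorPre Y).innerCompl z
          ((X.tensorPre Y).complLeft (X.tensorLsmul Y) (X.tensorLsmul_adjoint Y) (star a) w))
      ?_ (fun z w => ?_) z w
    · exact isClosed_eq (by fun_prop) (by fun_prop)
    · simp only [InnerModule.complLeft_ι, InnerModule.innerCompl_ι]
      exact X.tensorLsmul_adjoint Y a z w
  nondegenerate := by
    set S := (Submodule.span ℂ {z | ∃ a x, (X.tensorPre Y).complLeft (X.tensorLsmul Y)
      (X.tensorLsmul_adjoint Y) a x = z}).topologicalClosure with hS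
    have hcl : IsClosed (S : Set (X.tensorPre Y).Compl) := Submodule.isClosed_topologicalClosure _
    have h1 : ∀ z, (X.tensorPre Y).ι z ∈ S := by
      intro z
      induction z with
      | zero => simp
      | add z w hz hw => rw [map_add]; exact S.add_mem hz hw
      | tmul x y =>
        let f : X.carrier →L[ℂ] (X.tensorPre Y).Compl :=
          LinearMap.mkContinuous
            ((X.tensorPre Y).ι ∘ₗ (TensorProduct.mk ℂ X.carrier Y.carrier).flip y) ‖y‖
            fun x => X.norm_ι_tmul_le Y x y
        have h2 : (Submodule.span ℂ {z | ∃ a x, X.φ a x = z}).topologicalClosure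
            ≤ S.comap f.toLinearMap := by
          refine Submodule.topologicalClosure_minimal _ (Submodule.span_le.mpr ?_)
            (hcl.preimage f.continuous)
          rintro _ ⟨a, x, rfl⟩
          refine Submodule.le_topologicalClosure _ (Submodule.subset_span
            ⟨a, (X.tensorPre Y).ι (x ⊗ₜ y), ?_⟩)
          rw [InnerModule.complLeft_ι]
          rfl
        rw [X.nondegenerate] at h2
        exact h2 (Submodule.mem_top (x := x))
    refine eq_top_iff.mpr fun z _ => ?_
    exact (X.tensorPre Y).denseRange_ι.induction_on z hcl h1

end tensor

end Correspondence

open Correspondence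

/-- The data of a chain of `m ≥ 1` elementary shifts from `A` to `B`: C*-algebras
`A = C₀, C₁, …, Cₘ = B`, correspondences `Rᵢ` from `Cᵢ₋₁` to `Cᵢ` and `Sᵢ` from `Cᵢ` to `Cᵢ₋₁`,
for `i = 1, …, m`. -/
inductive ShiftChain : (A B : Type u) → [NonUnitalCStarAlgebra A] → [NonUnitalCStarAlgebra B] →
    ℕ → Type (max (u + 1) (v + 1))
  | single {A B : Type u} [NonUnitalCStarAlgebra A] [NonUnitalCStarAlgebra B]
      (R : Correspondence.{u, v} A B) (S : Correspondence.{u, v} B A) : ShiftChain A B 1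
  | cons {A C B : Type u} [NonUnitalCStarAlgebra A] [NonUnitalCStarAlgebra C]
      [NonUnitalCStarAlgebra B] {m : ℕ} (R : Correspondence.{u, v} A C)
      (S : Correspondence.{u, v} C A) (p : ShiftChain C B m) : ShiftChain A B (m + 1)

namespace ShiftChain

/-- `R₁ ⊗ S₁` -/
noncomputable def first : {A B : Type u} → [NonUnitalCStarAlgebra A] →
    [NonUnitalCStarAlgebra B] → {m : ℕ} → ShiftChain.{u, v} A B m → Correspondence.{u, v} A A
  | _, _, _, _, _, single R S => R.tensor S
  | _, _, _, _, _, cons R S _ => R.tensor S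

/-- `Sₘ ⊗ Rₘ` -/
noncomputable def last : {A B : Type u} → [NonUnitalCStarAlgebra A] →
    [NonUnitalCStarAlgebra B] → {m : ℕ} → ShiftChain.{u, v} A B m → Correspondence.{u, v} B B
  | _, _, _, _, _, single R S => S.tensor R
  | _, _, _, _, _, cons _ _ p => p.last

/-- `Sᵢ ⊗ Rᵢ ≅ Rᵢ₊₁ ⊗ Sᵢ₊₁` for `i = 1, …, m - 1` -/
def Linked : {A B : Type u} → [NonUnitalCStarAlgebra A] →
    [NonUnitalCStarAlgebra B] → {m : ℕ} → ShiftChain.{u, v} A B m → Prop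
  | _, _, _, _, _, single _ _ => True
  | _, _, _, _, _, cons R S p => (S.tensor R).Iso p.first ∧ p.Linked

/-- The chain implements a strong shift equivalence with lag `m` between `X` and `Y`:
`X ≅ R₁ ⊗ S₁`, `Sᵢ ⊗ Rᵢ ≅ Rᵢ₊₁ ⊗ Sᵢ₊₁` for `i = 1, …, m - 1`, and `Sₘ ⊗ Rₘ ≅ Y`. -/
def Implements {A B : Type u} [NonUnitalCStarAlgebra A] [NonUnitalCStarAlgebra B] {m : ℕ}
    (p : ShiftChain.{u, v} A B m) (X : Correspondence.{u, v} A A)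
    (Y : Correspondence.{u, v} B B) : Prop :=
  X.Iso p.first ∧ p.Linked ∧ p.last.Iso Y

/-- `Sᵢ ⊗ Rᵢ` and `Rᵢ₊₁ ⊗ Sᵢ₊₁` have the property `P` for `i = 1, …, m - 1`. -/
def Intermediate
    (P : (C : Type u) → [NonUnitalCStarAlgebra C] → Correspondence.{u, v} C C → Prop) :
    {A B : Type u} → [NonUnitalCStarAlgebra A] → [NonUnitalCStarAlgebra B] → {m : ℕ} →
      ShiftChain.{u, v} A B m → Prop
  | _, _, _, _, _, single _ _ => True
  | _, _, _, _, _, cons (C := C) R S p => P C (S.tensor R) ∧ P C p.first ∧ p.Intermediate P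

end ShiftChain

end CStarCorr

/-! The intermediate correspondences are improved by replacing the intermediate C*-algebras with
quotients and then with ideals, chosen so that nothing changes at the two ends. A correspondence `X`
from `A` to `B` moves closed ideals in three ways. `pull` sends `J` to the elements `a` with `⟨X,
aX⟩ ⊆ J`. `cpull` also asks that `a` act compactly. `push` sends `I` to the closed span of `⟨X,
IX⟩`. Isomorphic correspondences move ideals in the same way, and interior tensor products become
compositions: always for `pull` and `push` (`pull_tensor`, `push_tensor`), and for `cpull` when the
second factor is faithful (`cpull_le_cpull_cpull`, `cpull_cpull_le`). Injective, proper and full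
mean `pull ⊥ = ⊥`, `cpull ⊤ = ⊤` and `push ⊤ = ⊤`.

There are three passes along the chain. To get injectivity, start with the zero ideal of `A`,
transport it by `J ↦ S.pull J`, and divide each algebra by its ideal. To get properness, start with
all of `A`, transport by `I ↦ S.cpull I`, and restrict to the ideals; the first pass supplies the
faithfulness this needs. To get fullness, start with all of `A`, transport by `I ↦ R.push I`, and
restrict again. In each pass the ideals at neighbouring algebras correspond under `R` and `S`, so
quotients or restrictions of both exist. Their tensor products are quotients or restrictions of the
old ones (`QTransfer.tensor`, `ITransfer.tensor`), and such a quotient or restriction is unique up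
to isomorphism (`QTransfer.unique`, `ITransfer.unique`). The links of the chain therefore survive.

It remains to see that the ideal arriving at `B` is again zero, respectively everything. Transport
alone does not give this, so an extremality property is carried along. The ideal is the least `K`
with `pull K ≤ K`, respectively the greatest with `K ≤ cpull K` or `K ≤ push K`, for the composite
at its vertex. Extremality passes from `R ⊗ S` to `S ⊗ R` (`pull_le_of_forall_le`,
`le_cpull_of_forall_le`, `le_push_of_forall_le`) and across the links. At `B` the hypothesis on `Y`
makes `⊥`, respectively `⊤`, a competitor, which forces the value. After the passes every `R` and
`S` has the desired property, and so have their tensor products. -/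

namespace CStarCorr

/-! ### Closed ideals and their approximate units -/

section ClosedIdeals

variable {A : Type u} [NonUnitalCStarAlgebra A]

/-- A closed two-sided self-adjoint ideal. -/
structure IsClosedIdeal (J : Submodule ℂ A) : Prop where
  isClosed : IsClosed (J : Set A)
  mul_left : ∀ a, ∀ j ∈ J, a * j ∈ J
  mul_right : ∀ a, ∀ j ∈ J, j * a ∈ J
  star_mem : ∀ j ∈ J, star j ∈ J

theorem isClosedIdeal_top : IsClosedIdeal (⊤ : Submodule ℂ A) :=
  ⟨isClosed_univ, by simp, by simp, by simp⟩

theorem isClosedIdeal_bot : IsClosedIdeal (⊥ : Submodule ℂ A) :=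
  ⟨by simp, by simp, by simp, by simp⟩

/-- A closed ideal as a *-subalgebra. -/
def IsClosedIdeal.toSubalgebra {J : Submodule ℂ A} (hJ : IsClosedIdeal J) :
    NonUnitalStarSubalgebra ℂ A where
  carrier := J
  add_mem' := J.add_mem
  zero_mem' := J.zero_mem
  mul_mem' _ hb := hJ.mul_left _ _ hb
  smul_mem' c _ ha := J.smul_mem c ha
  star_mem' := hJ.star_mem _

/-- A closed ideal is the range of an injective homomorphism of C*-algebras. -/
theorem IsClosedIdeal.exists_inclusion {J : Submodule ℂ A} (hJ : IsClosedIdeal J) :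
    ∃ (D : Type u) (_ : NonUnitalCStarAlgebra D) (i : D →⋆ₙₐ[ℂ] A),
      Function.Injective i ∧ ∀ a, a ∈ J ↔ ∃ d, i d = a := by
  have : IsClosed (hJ.toSubalgebra : Set A) := hJ.isClosed
  refine ⟨hJ.toSubalgebra, inferInstance, NonUnitalStarSubalgebraClass.subtype hJ.toSubalgebra,
    Subtype.val_injective, fun a => ⟨fun h => ⟨⟨a, h⟩, rfl⟩, ?_⟩⟩
  rintro ⟨d, rfl⟩
  exact d.2

section order

attribute [local instance] CStarAlgebra.spectralOrder CStarAlgebra.spectralOrderedRing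

/-- Positivity of the approximate unit is recorded by the shape `star c * c`, so the statement does
not mention the locally chosen spectral order and can be applied to an ideal and read in the ambient
algebra. -/
theorem exists_approx_unit_nonneg (a : A) {ε : ℝ} (hε : 0 < ε) :
    ∃ c : A, ‖star c * c‖ ≤ 1 ∧ ‖star c * c * a - a‖ < ε ∧ ‖a * (star c * c) - a‖ < ε := by
  have h := CStarAlgebra.increasingApproximateUnit A
  have h1 := (Metric.tendsto_nhds.mp (h.tendsto_mul_right a)) ε hε
  have h2 := (Metric.tendsto_nhds.mp (h.tendsto_mul_left a)) ε hε
  obtain ⟨e, ⟨h3, h4⟩, h5, h6⟩ :=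
    ((h1.and h2).and (h.eventually_nonneg.and h.eventually_norm)).exists
  obtain ⟨c, rfl⟩ := CStarAlgebra.nonneg_iff_eq_star_mul_self.mp h5
  exact ⟨c, h6, by simpa [dist_eq_norm] using h3, by simpa [dist_eq_norm] using h4⟩

/-- In the unitization `0 ≤ e ≤ 1`, hence also `0 ≤ 1 - e ≤ 1`. -/
theorem norm_one_sub_le {e : A} (he : 0 ≤ e) (he1 : ‖e‖ ≤ 1) :
    ‖(1 - e : Unitization ℂ A)‖ ≤ 1 := by
  have h1 : (e : Unitization ℂ A) ∈ Set.Icc 0 1 :=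
    CStarAlgebra.mem_Icc_iff_norm_le_one.mpr
      ⟨Unitization.inr_nonneg_iff.mpr he, by rwa [Unitization.norm_inr]⟩
  exact (CStarAlgebra.mem_Icc_iff_norm_le_one.mp (Set.sub_mem_Icc_zero_iff_right.mpr h1)).2

theorem norm_sub_mul_le {c : A} (hc : ‖star c * c‖ ≤ 1) (x : A) :
    ‖x - star c * c * x‖ ≤ ‖x‖ ∧ ‖x - x * (star c * c)‖ ≤ ‖x‖ := by
  have h := norm_one_sub_le (star_mul_self_nonneg c) hc
  generalize star c * c = e at h
  have h1 : ((x - e * x : A) : Unitization ℂ A) = (1 - e) * x := by simp [sub_mul]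
  have h2 : ((x - x * e : A) : Unitization ℂ A) = x * (1 - e) := by simp [mul_sub]
  constructor
  · rw [← Unitization.norm_inr (𝕜 := ℂ), h1]
    refine (norm_mul_le _ _).trans ?_
    rw [Unitization.norm_inr]
    nlinarith [norm_nonneg x]
  · rw [← Unitization.norm_inr (𝕜 := ℂ), h2]
    refine (norm_mul_le _ _).trans ?_
    rw [Unitization.norm_inr]
    nlinarith [norm_nonneg x]

/-- The last clause concerns every `x` in the ambient algebra. This contractivity of `1 - e` is what
the C*-identity of the quotient needs. -/
theorem IsClosedIdeal.exists_approx_unit {J : Submodule ℂ A} (hJ : IsClosedIdeal J) {a : A}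
    (ha : a ∈ J) {ε : ℝ} (hε : 0 < ε) :
    ∃ e ∈ J, star e = e ∧ ‖e‖ ≤ 1 ∧ ‖e * a - a‖ < ε ∧ ‖a * e - a‖ < ε ∧
      ∀ x, ‖x - e * x‖ ≤ ‖x‖ ∧ ‖x - x * e‖ ≤ ‖x‖ := by
  have : IsClosed (hJ.toSubalgebra : Set A) := hJ.isClosed
  obtain ⟨c, h1, h2, h3⟩ := exists_approx_unit_nonneg (⟨a, ha⟩ : hJ.toSubalgebra) hε
  exact ⟨star (c : A) * c, (star c * c).2, by simp, h1, h2, h3, norm_sub_mul_le h1⟩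

variable (A) in
/-- A C*-algebra has a bounded left approximate unit. -/
theorem exists_approx_unit_filter : ∃ l : Filter A, l.NeBot ∧ (∀ᶠ e in l, ‖e‖ ≤ 1) ∧
    ∀ a, Filter.Tendsto (· * a) l (nhds a) :=
  have h := CStarAlgebra.increasingApproximateUnit A
  ⟨_, h.neBot, h.eventually_norm, h.tendsto_mul_right⟩

/-- A closed ideal has a bounded left approximate unit. -/
theorem IsClosedIdeal.exists_approx_unit_filter {J : Submodule ℂ A} (hJ : IsClosedIdeal J) :
    ∃ l : Filter A, l.NeBot ∧ (∀ᶠ e in l, e ∈ J ∧ ‖e‖ ≤ 1) ∧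
      ∀ a ∈ J, Filter.Tendsto (· * a) l (nhds a) := by
  have : IsClosed (hJ.toSubalgebra : Set A) := hJ.isClosed
  obtain ⟨l, hne, h1, h2⟩ := CStarCorr.exists_approx_unit_filter hJ.toSubalgebra
  refine ⟨l.map Subtype.val, inferInstance, ?_, fun a ha => ?_⟩
  · rw [Filter.eventually_map]
    filter_upwards [h1] with e he using ⟨e.2, he⟩
  · rw [Filter.tendsto_map'_iff]
    exact (continuous_subtype_val.tendsto _).comp (h2 ⟨a, ha⟩)

end order

/-- Elements of a closed ideal are limits of products of three elements of the ideal. -/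
theorem IsClosedIdeal.mem_closure_mul {J : Submodule ℂ A} (hJ : IsClosedIdeal J) {a : A}
    (ha : a ∈ J) : a ∈ closure {x | ∃ e ∈ J, ∃ f ∈ J, e * a * f = x} := by
  rw [Metric.mem_closure_iff]
  intro ε hε
  obtain ⟨e, he, -, he1, h2, h3, -⟩ := hJ.exists_approx_unit ha (half_pos hε)
  refine ⟨_, ⟨e, he, e, he, rfl⟩, ?_⟩
  rw [dist_eq_norm, norm_sub_rev]
  have : e * a * e - a = e * (a * e - a) + (e * a - a) := by rw [mul_sub, mul_assoc]; abel
  rw [this]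
  refine (norm_add_le _ _).trans_lt ?_
  have := norm_mul_le e (a * e - a)
  nlinarith [norm_nonneg (a * e - a)]

/-! ### The quotient C*-algebra -/

/-- The quotient of a C*-algebra by a closed ideal. -/
def QuotientAlgebra (J : Submodule ℂ A) : Type u := A ⧸ J

namespace QuotientAlgebra

variable (J : Submodule ℂ A) [hJ : Fact (IsClosedIdeal J)]

instance : IsClosed (J : Set A) := hJ.out.isClosed

noncomputable instance : NormedAddCommGroup (QuotientAlgebra J) :=
  inferInstanceAs (NormedAddCommGroup (A ⧸ J))

noncomputable instance : NormedSpace ℂ (QuotientAlgebra J) :=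
  inferInstanceAs (NormedSpace ℂ (A ⧸ J))

instance : CompleteSpace (QuotientAlgebra J) :=
  inferInstanceAs (CompleteSpace (A ⧸ J))

/-- The quotient map. -/
def mk : A →ₗ[ℂ] QuotientAlgebra J := J.mkQ

theorem mk_surjective : Function.Surjective (mk J) := J.mkQ_surjective

theorem mk_eq_zero {a : A} : mk J a = 0 ↔ a ∈ J := Submodule.Quotient.mk_eq_zero J

theorem mk_eq_mk {a b : A} : mk J a = mk J b ↔ a - b ∈ J := Submodule.Quotient.eq J

theorem norm_mk_le (a : A) : ‖mk J a‖ ≤ ‖a‖ := Submodule.Quotient.norm_mk_le J a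

theorem exists_norm_lt (x : QuotientAlgebra J) {ε : ℝ} (hε : 0 < ε) :
    ∃ a, mk J a = x ∧ ‖a‖ < ‖x‖ + ε := Submodule.Quotient.norm_mk_lt (S := J) x hε

noncomputable instance : Mul (QuotientAlgebra J) where
  mul x y := mk J ((mk_surjective J x).choose * (mk_surjective J y).choose)

noncomputable instance : Star (QuotientAlgebra J) where
  star x := mk J (star (mk_surjective J x).choose)

theorem mk_mul (a b : A) : mk J (a * b) = mk J a * mk J b := by
  change _ = mk J ((mk_surjective J (mk J a)).choose * (mk_surjective J (mk J b)).choose)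
  have ha := (mk_eq_mk J).mp (mk_surjective J (mk J a)).choose_spec
  have hb := (mk_eq_mk J).mp (mk_surjective J (mk J b)).choose_spec
  generalize (mk_surjective J (mk J a)).choose = a' at *
  generalize (mk_surjective J (mk J b)).choose = b' at *
  rw [eq_comm, mk_eq_mk]
  have : a' * b' - a * b = (a' - a) * b' + a * (b' - b) := by
    rw [sub_mul, mul_sub]; abel
  rw [this]
  exact J.add_mem (hJ.out.mul_right _ _ ha) (hJ.out.mul_left _ _ hb)

theorem mk_star (a : A) : mk J (star a) = star (mk J a) := by
  change _ = mk J (star (mk_surjective J (mk J a)).choose)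
  have ha := (mk_eq_mk J).mp (mk_surjective J (mk J a)).choose_spec
  rw [eq_comm, mk_eq_mk, ← star_sub]
  exact hJ.out.star_mem _ ha

/-- Modulo `J`, `a` may be replaced by `a (1 - e)` with `e` an approximate unit of `J`, and `‖a (1 -
e)‖² = ‖(1 - e) a* a (1 - e)‖`. If `w = a* a + j` nearly attains the quotient norm, cutting down by
`1 - e` does not increase `‖w‖` and makes `j` small. -/
theorem norm_mk_sq_le (a : A) : ‖mk J a‖ * ‖mk J a‖ ≤ ‖mk J (star a * a)‖ := by
  refine le_of_forall_pos_le_add fun ε hε => ?_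
  -- Half of `ε` pays for the choice of `w`, the other half for the remainder of `j` after cutting
  -- down.
  obtain ⟨w, hw, hwn⟩ := exists_norm_lt J (mk J (star a * a)) (half_pos hε)
  rw [mk_eq_mk] at hw
  obtain ⟨e, heJ, hes, -, h1, h2, h3⟩ := hJ.out.exists_approx_unit hw (half_pos hε)
  set j := w - star a * a with hj
  have hwa : star a * a = w - j := by rw [hj]; abel
  have h4 : mk J a = mk J (a - a * e) := by
    rw [mk_eq_mk, sub_sub_cancel]; exact hJ.out.mul_left _ _ heJ
  have h5 : star (a - a * e) * (a - a * e) =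
      ((w - e * w) - (w - e * w) * e) - ((j - e * j) - (j - e * j) * e) := by
    have : star (a - a * e) * (a - a * e)
        = (star a * a - e * (star a * a)) - (star a * a - e * (star a * a)) * e := by
      simp only [star_sub, star_mul, hes, sub_mul, mul_sub, mul_assoc]
    rw [this, hwa]
    simp only [sub_mul, mul_sub]
    abel
  have h6 : ‖mk J a‖ * ‖mk J a‖ ≤ ‖a - a * e‖ * ‖a - a * e‖ := by
    rw [h4]
    exact mul_self_le_mul_self (norm_nonneg _) (norm_mk_le J _)
  rw [← CStarRing.norm_star_mul_self, h5] at h6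
  have h7 := norm_sub_le ((w - e * w) - (w - e * w) * e) ((j - e * j) - (j - e * j) * e)
  have h8 := (h3 (w - e * w)).2.trans (h3 w).1
  have h9 := (h3 (j - e * j)).2
  rw [norm_sub_rev j] at h9
  linarith

noncomputable instance : NonUnitalRing (QuotientAlgebra J) where
  left_distrib x y z := by
    obtain ⟨x, rfl⟩ := mk_surjective J x
    obtain ⟨y, rfl⟩ := mk_surjective J y
    obtain ⟨z, rfl⟩ := mk_surjective J z
    simp only [← mk_mul, ← map_add, mul_add]
  right_distrib x y z := by
    obtain ⟨x, rfl⟩ := mk_surjective J x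
    obtain ⟨y, rfl⟩ := mk_surjective J y
    obtain ⟨z, rfl⟩ := mk_surjective J z
    simp only [← mk_mul, ← map_add, add_mul]
  zero_mul x := by
    obtain ⟨x, rfl⟩ := mk_surjective J x
    rw [← map_zero (mk J), ← mk_mul, zero_mul]
  mul_zero x := by
    obtain ⟨x, rfl⟩ := mk_surjective J x
    rw [← map_zero (mk J), ← mk_mul, mul_zero]
  mul_assoc x y z := by
    obtain ⟨x, rfl⟩ := mk_surjective J x
    obtain ⟨y, rfl⟩ := mk_surjective J y
    obtain ⟨z, rfl⟩ := mk_surjective J z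
    simp only [← mk_mul, mul_assoc]

noncomputable instance : NonUnitalNormedRing (QuotientAlgebra J) where
  dist_eq x y := NormedAddCommGroup.dist_eq x y
  norm_mul_le x y := by
    refine le_of_forall_pos_le_add fun ε hε => ?_
    obtain ⟨δ, hδ, h⟩ : ∃ δ > 0, (‖x‖ + δ) * (‖y‖ + δ) < ‖x‖ * ‖y‖ + ε := by
      have hc : Filter.Tendsto (fun δ : ℝ => (‖x‖ + δ) * (‖y‖ + δ)) (nhdsWithin 0 (Set.Ioi 0))
          (nhds (‖x‖ * ‖y‖)) := by
        have : Continuous fun δ : ℝ => (‖x‖ + δ) * (‖y‖ + δ) := by fun_prop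
        simpa using (this.tendsto 0).mono_left nhdsWithin_le_nhds
      have := (hc.eventually_lt_const (lt_add_of_pos_right _ hε)).and self_mem_nhdsWithin
      obtain ⟨δ, h1, h2⟩ := this.exists
      exact ⟨δ, h2, h1⟩
    obtain ⟨a, rfl, ha⟩ := exists_norm_lt J x hδ
    obtain ⟨b, rfl, hb⟩ := exists_norm_lt J y hδ
    rw [← mk_mul]
    refine (norm_mk_le J _).trans ((norm_mul_le a b).trans ?_)
    exact (mul_le_mul ha.le hb.le (norm_nonneg _) (by positivity)).trans h.le

noncomputable instance : StarRing (QuotientAlgebra J) where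
  star_involutive x := by
    obtain ⟨x, rfl⟩ := mk_surjective J x
    simp only [← mk_star, star_star]
  star_mul x y := by
    obtain ⟨x, rfl⟩ := mk_surjective J x
    obtain ⟨y, rfl⟩ := mk_surjective J y
    simp only [← mk_star, ← mk_mul, star_mul]
  star_add x y := by
    obtain ⟨x, rfl⟩ := mk_surjective J x
    obtain ⟨y, rfl⟩ := mk_surjective J y
    simp only [← mk_star, ← map_add, star_add]

noncomputable instance : NonUnitalCStarAlgebra (QuotientAlgebra J) where
  norm_mul_self_le x := by
    obtain ⟨x, rfl⟩ := mk_surjective J x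
    rw [← mk_star, ← mk_mul]
    exact norm_mk_sq_le J x
  smul_assoc c x y := by
    obtain ⟨x, rfl⟩ := mk_surjective J x
    obtain ⟨y, rfl⟩ := mk_surjective J y
    simp only [smul_eq_mul, ← map_smul, ← mk_mul, smul_mul_assoc]
  smul_comm c x y := by
    obtain ⟨x, rfl⟩ := mk_surjective J x
    obtain ⟨y, rfl⟩ := mk_surjective J y
    simp only [smul_eq_mul, ← map_smul, ← mk_mul, mul_smul_comm]
  star_smul c x := by
    obtain ⟨x, rfl⟩ := mk_surjective J x
    simp only [← map_smul, ← mk_star, star_smul]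

/-- The quotient map as a *-homomorphism. -/
noncomputable def mkHom : A →⋆ₙₐ[ℂ] QuotientAlgebra J where
  toFun := mk J
  map_smul' := map_smul (mk J)
  map_zero' := map_zero (mk J)
  map_add' := map_add (mk J)
  map_mul' := mk_mul J
  map_star' := mk_star J

end QuotientAlgebra

/-- A closed ideal is the kernel of a surjective homomorphism of C*-algebras. -/
theorem IsClosedIdeal.exists_quotient {J : Submodule ℂ A} (hJ : IsClosedIdeal J) :
    ∃ (D : Type u) (_ : NonUnitalCStarAlgebra D) (q : A →⋆ₙₐ[ℂ] D),
      Function.Surjective q ∧ ∀ a, q a = 0 ↔ a ∈ J := by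
  have : Fact (IsClosedIdeal J) := ⟨hJ⟩
  exact ⟨QuotientAlgebra J, inferInstance, QuotientAlgebra.mkHom J,
    QuotientAlgebra.mk_surjective J, fun _ => QuotientAlgebra.mk_eq_zero J⟩

end ClosedIdeals
end CStarCorr

namespace CStarCorr
open scoped TensorProduct
open scoped CStarAlgebra

namespace Correspondence

/-! ### Continuity, extension from dense subspaces, and transfer between correspondences -/

section Basic

variable {A B C A' B' C' : Type u} [NonUnitalCStarAlgebra A'] [NonUnitalCStarAlgebra B']
  [NonUnitalCStarAlgebra C'] [NonUnitalCStarAlgebra A] [NonUnitalCStarAlgebra B]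
  [NonUnitalCStarAlgebra C]

/-- The inner product as a continuous sesquilinear map. -/
noncomputable def innerL (X : Correspondence.{u, v} A B) :
    X.carrier →L⋆[ℂ] X.carrier →L[ℂ] B :=
  LinearMap.mkContinuous₂ X.mod.inner 1 fun x y => by simpa using X.norm_inner_le x y

@[simp]
theorem innerL_apply (X : Correspondence.{u, v} A B) (x y : X.carrier) :
    X.innerL x y = X.mod.inner x y := rfl

/-- The right action as a continuous bilinear map. -/
noncomputable def rsmulL (X : Correspondence.{u, v} A B) :
    X.carrier →L[ℂ] B →L[ℂ] X.carrier :=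
  LinearMap.mkContinuous₂ X.mod.rsmul 1 fun x y => by simpa using X.norm_rsmul_le x y

@[simp]
theorem rsmulL_apply (X : Correspondence.{u, v} A B) (x : X.carrier) (b : B) :
    X.rsmulL x b = X.mod.rsmul x b := rfl

/-- The left action as a continuous bilinear map. -/
noncomputable def lsmulL (X : Correspondence.{u, v} A B) :
    A →L[ℂ] X.carrier →L[ℂ] X.carrier :=
  LinearMap.mkContinuous
    { toFun := X.φ, map_add' := map_add X.φ, map_smul' := map_smul X.φ } 1 fun a => by
      rw [one_mul]
      exact ContinuousLinearMap.opNorm_le_bound _ (norm_nonneg _) (X.norm_φ_le a)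

@[simp]
theorem lsmulL_apply (X : Correspondence.{u, v} A B) (a : A) : X.lsmulL a = X.φ a := rfl

theorem continuous_φ (X : Correspondence.{u, v} A B) : Continuous X.φ := X.lsmulL.continuous

theorem eq_zero_of_inner_self {X : Correspondence.{u, v} A B} {x : X.carrier}
    (h : X.mod.inner x x = 0) : x = 0 := by
  have := X.norm_sq_eq x
  rw [h, norm_zero] at this
  simpa using this

theorem ext_inner_of_dense {X : Correspondence.{u, v} A B} {V : Type*} {f : V → X.carrier}
    (hf : DenseRange f) {x y : X.carrier}
    (h : ∀ v, X.mod.inner (f v) x = X.mod.inner (f v) y) : x = y := by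
  have h1 : ∀ z, X.mod.inner z (x - y) = 0 := fun z => by
    refine hf.induction_on (p := fun z => X.innerL z (x - y) = 0) z ?_ fun v => ?_
    · exact isClosed_eq (by fun_prop) (by fun_prop)
    · simp [h]
  exact sub_eq_zero.mp (eq_zero_of_inner_self (h1 _))

theorem ext_inner {X : Correspondence.{u, v} A B} {x y : X.carrier}
    (h : ∀ z, X.mod.inner z x = X.mod.inner z y) : x = y :=
  ext_inner_of_dense (f := id) denseRange_id h

/-- Linearity over `B` is not part of the definition of a correspondence; it is automatic for
operators with an adjoint. -/
theorem φ_rsmul (X : Correspondence.{u, v} A B) (a : A) (x : X.carrier) (b : B) :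
    X.φ a (X.mod.rsmul x b) = X.mod.rsmul (X.φ a x) b :=
  ext_inner fun z => by
    rw [X.inner_φ_right, X.mod.inner_rsmul, X.mod.inner_rsmul, X.inner_φ_right]

/-- A closed submodule containing all `a x` is everything. -/
theorem mem_of_φ_mem (X : Correspondence.{u, v} A B) {S : Submodule ℂ X.carrier}
    (hS : IsClosed (S : Set X.carrier)) (h : ∀ a x, X.φ a x ∈ S) (x : X.carrier) : x ∈ S := by
  have h1 : (Submodule.span ℂ {z | ∃ a x, X.φ a x = z}).topologicalClosure ≤ S :=
    Submodule.topologicalClosure_minimal _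
      (Submodule.span_le.mpr (by rintro _ ⟨a, x, rfl⟩; exact h a x)) hS
  rw [X.nondegenerate] at h1
  exact h1 Submodule.mem_top

/-- A map on a dense subspace which preserves inner products up to a homomorphism extends. -/
theorem exists_extension {X : Correspondence.{u, v} A B} {X' : Correspondence.{u, v} A' B'}
    (r : B →⋆ₙₐ[ℂ] B') {V : Type*} [AddCommGroup V] [Module ℂ V]
    (f : V →ₗ[ℂ] X.carrier) (g : V →ₗ[ℂ] X'.carrier) (hf : DenseRange f)
    (hg : ∀ v w, X'.mod.inner (g v) (g w) = r (X.mod.inner (f v) (f w))) :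
    ∃ t : X.carrier →L[ℂ] X'.carrier, (∀ v, t (f v) = g v) ∧
      ∀ x y, X'.mod.inner (t x) (t y) = r (X.mod.inner x y) := by
  have hn : ∀ v, ‖g v‖ ≤ 1 * ‖f v‖ := fun v => by
    rw [one_mul, X.norm_eq, X'.norm_eq, hg]
    exact Real.sqrt_le_sqrt (NonUnitalStarAlgHom.norm_apply_le r _)
  have ht : ∀ v, g.extendOfNorm f (f v) = g v :=
    LinearMap.extendOfNorm_eq hf ⟨1, hn⟩
  refine ⟨g.extendOfNorm f, ht, fun x y => ?_⟩
  have hr : Continuous r := map_continuous r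
  refine hf.induction_on₂ (p := fun x y =>
    X'.innerL (g.extendOfNorm f x) (g.extendOfNorm f y) = r (X.innerL x y)) ?_ (fun v w => ?_) x y
  · exact isClosed_eq (by fun_prop) (by fun_prop)
  · simp [ht, hg]

/-- `X'` is the quotient of `X` along homomorphisms `p`, `r` of the coefficient algebras. -/
def QTransfer (p : A →⋆ₙₐ[ℂ] A') (r : B →⋆ₙₐ[ℂ] B') (X : Correspondence.{u, v} A B)
    (X' : Correspondence.{u, v} A' B') : Prop :=
  ∃ t : X.carrier →L[ℂ] X'.carrier, DenseRange t ∧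
    (∀ x y, X'.mod.inner (t x) (t y) = r (X.mod.inner x y)) ∧
    ∀ a x, t (X.φ a x) = X'.φ (p a) (t x)

/-- The inner products determine the extended map, and since `g` has dense range, intertwining of
the left actions can be tested on matrix coefficients. -/
theorem QTransfer.of_dense {p : A →⋆ₙₐ[ℂ] A'} {r : B →⋆ₙₐ[ℂ] B'} {X : Correspondence.{u, v} A B}
    {X' : Correspondence.{u, v} A' B'} {V : Type*} [AddCommGroup V] [Module ℂ V]
    (f : V →ₗ[ℂ] X.carrier) (g : V →ₗ[ℂ] X'.carrier) (hf : DenseRange f) (hg : DenseRange g)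
    (h : ∀ v w, X'.mod.inner (g v) (g w) = r (X.mod.inner (f v) (f w)))
    (hl : ∀ a v w, X'.mod.inner (g v) (X'.φ (p a) (g w)) = r (X.mod.inner (f v) (X.φ a (f w)))) :
    QTransfer p r X X' := by
  obtain ⟨t, ht, hi⟩ := exists_extension r f g hf h
  refine ⟨t, ?_, hi, fun a x => ?_⟩
  · refine hg.mono ?_
    rintro _ ⟨v, rfl⟩
    exact ⟨f v, ht v⟩
  · refine hf.induction_on (p := fun x => t (X.φ a x) = X'.φ (p a) (t x)) x ?_ fun w => ?_
    · exact isClosed_eq (by fun_prop) (by fun_prop)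
    · refine ext_inner_of_dense hg fun v => ?_
      rw [ht, hl, ← hi, ht]

/-- An isometry from a complete space has closed range, so dense range gives surjectivity; right
linearity follows from preservation of inner products. -/
theorem QTransfer.iso {X Y : Correspondence.{u, v} A B}
    (h : QTransfer (NonUnitalStarAlgHom.id ℂ A) (NonUnitalStarAlgHom.id ℂ B) X Y) :
    X.Iso Y := by
  obtain ⟨t, hd, hi, hl⟩ := h
  simp only [NonUnitalStarAlgHom.coe_id, id_eq] at hi hl
  have hn : ∀ x, ‖t x‖ = ‖x‖ := fun x => by rw [X.norm_eq, Y.norm_eq, hi]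
  have hiso : Isometry t := AddMonoidHomClass.isometry_of_norm t hn
  refine ⟨t.toLinearMap, fun y => ?_, hl, fun x b => ?_, hi⟩
  · have hc : IsClosed (Set.range t) := hiso.isClosedEmbedding.isClosed_range
    have := hd.closure_eq ▸ hc.closure_eq
    exact (this ▸ Set.mem_univ y : y ∈ Set.range t)
  · refine ext_inner_of_dense hd fun z => ?_
    change Y.mod.inner (t z) (t _) = Y.mod.inner (t z) (Y.mod.rsmul (t x) b)
    rw [Y.mod.inner_rsmul, hi, hi, X.mod.inner_rsmul]

/-- Two correspondences receiving maps with dense range and the same inner products are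
isomorphic. -/
theorem Iso.of_dense {X Y : Correspondence.{u, v} A B} {V : Type*} [AddCommGroup V] [Module ℂ V]
    (f : V →ₗ[ℂ] X.carrier) (g : V →ₗ[ℂ] Y.carrier) (hf : DenseRange f) (hg : DenseRange g)
    (h : ∀ v w, Y.mod.inner (g v) (g w) = X.mod.inner (f v) (f w))
    (hl : ∀ a v w, Y.mod.inner (g v) (Y.φ a (g w)) = X.mod.inner (f v) (X.φ a (f w))) :
    X.Iso Y :=
  (QTransfer.of_dense (p := NonUnitalStarAlgHom.id ℂ A) (r := NonUnitalStarAlgHom.id ℂ B)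
    f g hf hg h hl).iso

theorem Iso.trans {X Y Z : Correspondence.{u, v} A B} (h : X.Iso Y) (h' : Y.Iso Z) : X.Iso Z := by
  obtain ⟨U, hs, hl, hr, hi⟩ := h
  obtain ⟨U', hs', hl', hr', hi'⟩ := h'
  exact ⟨U' ∘ₗ U, hs'.comp hs, by simp [hl, hl'], by simp [hr, hr'], by simp [hi, hi']⟩

theorem Iso.symm {X Y : Correspondence.{u, v} A B} (h : X.Iso Y) : Y.Iso X := by
  obtain ⟨U, hs, hl, hr, hi⟩ := h
  refine Iso.of_dense U LinearMap.id hs.denseRange denseRange_id (by simp [hi]) fun a v w => ?_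
  simp [← hl, hi]

/-- `X` itself maps densely into both quotients, with the same inner products. Surjectivity of `p`
reduces the left action of `A'` to that of `A`. -/
theorem QTransfer.unique {p : A →⋆ₙₐ[ℂ] A'} {r : B →⋆ₙₐ[ℂ] B'} (hp : Function.Surjective p)
    {X Y : Correspondence.{u, v} A B} {X' Y' : Correspondence.{u, v} A' B'}
    (hX : QTransfer p r X X') (hY : QTransfer p r Y Y') (h : X.Iso Y) : X'.Iso Y' := by
  obtain ⟨t, hd, hi, hl⟩ := hX
  obtain ⟨t', hd', hi', hl'⟩ := hY
  obtain ⟨U, hs, hUl, hUr, hUi⟩ := h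
  refine Iso.of_dense t.toLinearMap (t'.toLinearMap ∘ₗ U) hd
    (hd'.comp hs.denseRange t'.continuous) (fun x y => ?_) fun a x y => ?_
  · simp [hi, hi', hUi]
  · obtain ⟨a, rfl⟩ := hp a
    simp [← hl, ← hl', hi, hi', ← hUl, hUi]

/-- `X'` is the restriction of `X` to ideals of the coefficient algebras, the ranges of
`i` and `j`. -/
def ITransfer (i : A' →⋆ₙₐ[ℂ] A) (j : B' →⋆ₙₐ[ℂ] B) (X' : Correspondence.{u, v} A' B')
    (X : Correspondence.{u, v} A B) : Prop :=
  ∃ s : X'.carrier →L[ℂ] X.carrier,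
    (∀ x y, X.mod.inner (s x) (s y) = j (X'.mod.inner x y)) ∧
    (∀ a x, s (X'.φ a x) = X.φ (i a) (s x)) ∧
    ∀ a x, X.φ (i a) x ∈ Set.range s

theorem norm_of_inner_eq {X' : Correspondence.{u, v} A' B'} {X : Correspondence.{u, v} A B}
    {j : B' →⋆ₙₐ[ℂ] B} (hj : Function.Injective j) {s : X'.carrier → X.carrier}
    (hi : ∀ x y, X.mod.inner (s x) (s y) = j (X'.mod.inner x y)) (x : X'.carrier) :
    ‖s x‖ = ‖x‖ := by
  rw [X.norm_eq, X'.norm_eq, hi, NonUnitalStarAlgHom.norm_map j hj]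

theorem isClosed_range_of_inner_eq {X' : Correspondence.{u, v} A' B'}
    {X : Correspondence.{u, v} A B} {j : B' →⋆ₙₐ[ℂ] B} (hj : Function.Injective j)
    {s : X'.carrier →L[ℂ] X.carrier}
    (hi : ∀ x y, X.mod.inner (s x) (s y) = j (X'.mod.inner x y)) : IsClosed (Set.range s) :=
  (AddMonoidHomClass.isometry_of_norm s (norm_of_inner_eq hj hi)).isClosedEmbedding.isClosed_range

/-- The three clauses of `ITransfer`, together with nondegeneracy of `X'` and completeness, identify
the range of `s` with the closed span of `i(A') X`. An isomorphism of the ambient correspondences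
matches these subspaces. -/
theorem ITransfer.unique {i : A' →⋆ₙₐ[ℂ] A} {j : B' →⋆ₙₐ[ℂ] B} (hj : Function.Injective j)
    {X Y : Correspondence.{u, v} A B} {X' Y' : Correspondence.{u, v} A' B'}
    (hX : ITransfer i j X' X) (hY : ITransfer i j Y' Y) (h : X.Iso Y) : X'.Iso Y' := by
  obtain ⟨s, hi, hl, hr⟩ := hX
  obtain ⟨s', hi', hl', hr'⟩ := hY
  obtain ⟨U, hs, hUl, hUr, hUi⟩ := h
  have hUn : ∀ x, ‖U x‖ = ‖x‖ := fun x => by rw [X.norm_eq, Y.norm_eq, hUi]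
  have hU : Continuous U := AddMonoidHomClass.continuous_of_bound U 1 (by simp [hUn])
  have hcl := isClosed_range_of_inner_eq hj hi'
  have hcl0 := isClosed_range_of_inner_eq hj hi
  -- the graph of the isomorphism, projecting onto both factors
  let V : Submodule ℂ (X'.carrier × Y'.carrier) :=
    LinearMap.ker ((U ∘ₗ s.toLinearMap) ∘ₗ LinearMap.fst ℂ _ _ -
      s'.toLinearMap ∘ₗ LinearMap.snd ℂ _ _)
  have hV : ∀ v : V, U (s v.1.1) = s' v.1.2 := fun v =>
    sub_eq_zero.mp (LinearMap.mem_ker.mp v.2)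
  -- By nondegeneracy it is enough to take vectors `a x`; their images have the form `i(a) u`, which
  -- lies in the range of `s'`.
  have hs1 : ∀ x : X'.carrier, ∃ y, s' y = U (s x) := fun x => by
    refine X'.mem_of_φ_mem (S := (LinearMap.range s'.toLinearMap).comap (U ∘ₗ s.toLinearMap))
      ?_ (fun a x => ?_) x
    · exact hcl.preimage (hU.comp s.continuous)
    · simpa [hl, hUl] using hr' a (U (s x))
  have hs2 : ∀ y : Y'.carrier, ∃ x, U (s x) = s' y := fun y => by
    refine Y'.mem_of_φ_mem
      (S := (LinearMap.range (U ∘ₗ s.toLinearMap)).comap s'.toLinearMap) ?_ (fun a y => ?_) y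
    · have : IsClosed (Set.range (U ∘ₗ s.toLinearMap)) :=
        (AddMonoidHomClass.isometry_of_norm (U ∘ₗ s.toLinearMap) (fun x => by
          simp [hUn, norm_of_inner_eq hj hi])).isClosedEmbedding.isClosed_range
      exact this.preimage s'.continuous
    · obtain ⟨w, hw⟩ := hs (s' y)
      obtain ⟨z, hz⟩ := hr a w
      exact ⟨z, by simp [hz, hUl, hw, hl']⟩
  refine Iso.of_dense (V := V) (LinearMap.fst ℂ _ _ ∘ₗ V.subtype) (LinearMap.snd ℂ _ _ ∘ₗ V.subtype)
    (Function.Surjective.denseRange fun x => ?_) (Function.Surjective.denseRange fun y => ?_)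
    (fun v w => hj ?_) (fun a v w => hj ?_)
  · obtain ⟨y, hy⟩ := hs1 x
    exact ⟨⟨(x, y), by simp [V, hy]⟩, rfl⟩
  · obtain ⟨x, hx⟩ := hs2 y
    exact ⟨⟨(x, y), by simp [V, hx]⟩, rfl⟩
  · simp [← hi, ← hi', ← hV, hUi]
  · simp [← hi, ← hi', hl, hl', ← hV, ← hUl, hUi]

theorem ITransfer.iso {X Y : Correspondence.{u, v} A B}
    (h : ITransfer (NonUnitalStarAlgHom.id ℂ A) (NonUnitalStarAlgHom.id ℂ B) X Y) :
    X.Iso Y := by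
  obtain ⟨s, hi, hl, hr⟩ := h
  refine QTransfer.iso ⟨s, ?_, hi, hl⟩
  have hcl := isClosed_range_of_inner_eq Function.injective_id hi
  refine Function.Surjective.denseRange fun y => ?_
  exact Y.mem_of_φ_mem (S := LinearMap.range s.toLinearMap) hcl hr y

end Basic

/-! ### Elementary tensors in the interior tensor product -/

section Tensor

variable {A B C : Type u} [NonUnitalCStarAlgebra A] [NonUnitalCStarAlgebra B]
  [NonUnitalCStarAlgebra C] (X : Correspondence.{u, v} A B) (Y : Correspondence.{u, v} B C)

/-- The canonical map from the algebraic to the interior tensor product. -/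
noncomputable def tensorι : X.carrier ⊗[ℂ] Y.carrier →ₗ[ℂ] (X.tensor Y).carrier :=
  (X.tensorPre Y).ι

theorem denseRange_tensorι : DenseRange (X.tensorι Y) := (X.tensorPre Y).denseRange_ι

/-- The canonical bilinear map into the interior tensor product. -/
noncomputable def tmulL : X.carrier →L[ℂ] Y.carrier →L[ℂ] (X.tensor Y).carrier :=
  LinearMap.mkContinuous₂ ((TensorProduct.mk ℂ X.carrier Y.carrier).compr₂ (X.tensorι Y)) 1
    fun x y => by
      rw [one_mul, mul_comm]
      exact X.norm_ι_tmul_le Y x y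

@[simp]
theorem tensorι_tmul (x : X.carrier) (y : Y.carrier) :
    X.tensorι Y (x ⊗ₜ y) = X.tmulL Y x y := rfl

@[simp]
theorem inner_tmulL (x x' : X.carrier) (y y' : Y.carrier) :
    (X.tensor Y).mod.inner (X.tmulL Y x y) (X.tmulL Y x' y')
      = Y.mod.inner y (Y.φ (X.mod.inner x x') y') :=
  (X.tensorPre Y).innerCompl_ι _ _

@[simp]
theorem φ_tmulL (a : A) (x : X.carrier) (y : Y.carrier) :
    (X.tensor Y).φ a (X.tmulL Y x y) = X.tmulL Y (X.φ a x) y :=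
  (X.tensorPre Y).complLeft_ι (X.tensorLsmul Y) (X.tensorLsmul_adjoint Y) a (x ⊗ₜ y)

@[simp]
theorem rsmul_tmulL (c : C) (x : X.carrier) (y : Y.carrier) :
    (X.tensor Y).mod.rsmul (X.tmulL Y x y) c = X.tmulL Y x (Y.mod.rsmul y c) :=
  (X.tensorPre Y).rsmulCompl_ι _ _

variable {X Y}

theorem tensor_mem {S : Submodule ℂ (X.tensor Y).carrier}
    (hS : IsClosed (S : Set (X.tensor Y).carrier)) (h : ∀ x y, X.tmulL Y x y ∈ S)
    (z : (X.tensor Y).carrier) : z ∈ S := by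
  refine (X.denseRange_tensorι Y).induction_on z hS fun z => ?_
  induction z with
  | zero => simp
  | add z w hz hw => rw [map_add]; exact S.add_mem hz hw
  | tmul x y => exact h x y

theorem tensor_clm_ext {F : Type*} [NormedAddCommGroup F] [NormedSpace ℂ F]
    {f g : (X.tensor Y).carrier →L[ℂ] F} (h : ∀ x y, f (X.tmulL Y x y) = g (X.tmulL Y x y)) :
    f = g := by
  ext z
  refine tensor_mem (S := LinearMap.eqLocus f.toLinearMap g.toLinearMap) ?_ h z
  exact isClosed_eq f.continuous g.continuous

theorem tensor_inner_mem {J : Submodule ℂ C} (hJ : IsClosed (J : Set C))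
    (T : (X.tensor Y).carrier →L[ℂ] (X.tensor Y).carrier)
    (h : ∀ x y x' y', (X.tensor Y).mod.inner (X.tmulL Y x y) (T (X.tmulL Y x' y')) ∈ J)
    (z w : (X.tensor Y).carrier) : (X.tensor Y).mod.inner z (T w) ∈ J := by
  refine tensor_mem (S := J.comap (((X.tensor Y).innerL z).comp T).toLinearMap) ?_
    (fun x' y' => ?_) w
  · exact hJ.preimage (((X.tensor Y).innerL z).comp T).continuous
  · refine tensor_mem (S := J.comap
      ((X.tensor Y).innerL.flip (T (X.tmulL Y x' y'))).toLinearMap) ?_ (fun x y => ?_) z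
    · exact hJ.preimage ((X.tensor Y).innerL.flip (T (X.tmulL Y x' y'))).continuous
    · exact h x y x' y'

theorem tmulL_rsmul (x : X.carrier) (b : B) (y : Y.carrier) :
    X.tmulL Y (X.mod.rsmul x b) y = X.tmulL Y x (Y.φ b y) := by
  rw [← sub_eq_zero]
  set d := X.tmulL Y (X.mod.rsmul x b) y - X.tmulL Y x (Y.φ b y) with hd
  -- The difference `d` is orthogonal to all elementary tensors, hence to everything.
  refine ext_inner fun z => ?_
  rw [map_zero]
  refine tensor_mem (S := LinearMap.ker ((X.tensor Y).innerL.flip d).toLinearMap)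
    (isClosed_singleton.preimage ((X.tensor Y).innerL.flip d).continuous) (fun x' y' => ?_) z
  change (X.tensor Y).mod.inner (X.tmulL Y x' y') d = 0
  rw [hd, map_sub, inner_tmulL, inner_tmulL, X.mod.inner_rsmul, map_mul]
  exact sub_self _

end Tensor

end Correspondence
end CStarCorr

namespace CStarCorr
open scoped TensorProduct
open scoped CStarAlgebra

/-! ### Transfer of tensor products; existence of restrictions and quotients -/

namespace Correspondence

variable {A B C A' B' C' : Type u} [NonUnitalCStarAlgebra A] [NonUnitalCStarAlgebra B]
  [NonUnitalCStarAlgebra C] [NonUnitalCStarAlgebra A'] [NonUnitalCStarAlgebra B']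
  [NonUnitalCStarAlgebra C']

theorem QTransfer.tensor {p : A →⋆ₙₐ[ℂ] A'} {q : B →⋆ₙₐ[ℂ] B'} {r : C →⋆ₙₐ[ℂ] C'}
    {X : Correspondence.{u, v} A B} {X' : Correspondence.{u, v} A' B'}
    {Y : Correspondence.{u, v} B C} {Y' : Correspondence.{u, v} B' C'}
    (hX : QTransfer p q X X') (hY : QTransfer q r Y Y') :
    QTransfer p r (X.tensor Y) (X'.tensor Y') := by
  obtain ⟨t, hd, hi, hl⟩ := hX
  obtain ⟨t', hd', hi', hl'⟩ := hY
  have key : ∀ a z w, (X'.tensor Y').mod.inner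
      (X'.tensorι Y' (TensorProduct.map t.toLinearMap t'.toLinearMap z))
      (X'.tensorι Y' (TensorProduct.map t.toLinearMap t'.toLinearMap w))
      = r ((X.tensor Y).mod.inner (X.tensorι Y z) (X.tensorι Y w)) ∧
      (X'.tensor Y').mod.inner
      (X'.tensorι Y' (TensorProduct.map t.toLinearMap t'.toLinearMap z))
      ((X'.tensor Y').φ (p a) (X'.tensorι Y' (TensorProduct.map t.toLinearMap t'.toLinearMap w)))
      = r ((X.tensor Y).mod.inner (X.tensorι Y z) ((X.tensor Y).φ a (X.tensorι Y w))) := by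
    intro a z w
    induction w with
    | zero => simp
    | add w w' hw hw' => simp [hw.1, hw.2, hw'.1, hw'.2]
    | tmul x' y' =>
      induction z with
      | zero => simp
      | add z z' hz hz' => simp only [map_add, LinearMap.add_apply, hz.1, hz.2, hz'.1, hz'.2,
          and_self]
      | tmul x y => simp [hi, hi', ← hl, ← hl']
  refine QTransfer.of_dense (X.tensorι Y)
    (X'.tensorι Y' ∘ₗ TensorProduct.map t.toLinearMap t'.toLinearMap) (X.denseRange_tensorι Y)
    (fun z => ?_) (fun v w => (key 0 v w).1) (fun a v w => (key a v w).2)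
  refine tensor_mem (S := (LinearMap.range (X'.tensorι Y' ∘ₗ
    TensorProduct.map t.toLinearMap t'.toLinearMap)).topologicalClosure)
    (Submodule.isClosed_topologicalClosure _) (fun x' y' => ?_) z
  have hc : IsClosed (((LinearMap.range (X'.tensorι Y' ∘ₗ
    TensorProduct.map t.toLinearMap t'.toLinearMap)).topologicalClosure :
      Set (X'.tensor Y').carrier)) := Submodule.isClosed_topologicalClosure _
  refine hd.induction_on x' (hc.preimage ((X'.tmulL Y').flip y').continuous) fun x => ?_
  refine hd'.induction_on y' (hc.preimage (X'.tmulL Y' (t x)).continuous) fun y => ?_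
  exact Submodule.le_topologicalClosure _ ⟨x ⊗ₜ y, rfl⟩

/-- A vector whose length lies in an ideal `J` is a limit of vectors `x e` with `e ∈ J`. -/
theorem mem_closure_rsmul (X : Correspondence.{u, v} A B) {J : Submodule ℂ B}
    (hJ : IsClosedIdeal J) {x : X.carrier} (hx : X.mod.inner x x ∈ J) :
    x ∈ closure {z | ∃ e ∈ J, X.mod.rsmul x e = z} := by
  rw [Metric.mem_closure_iff]
  intro ε hε
  -- With `h = ⟨x, x⟩ e - ⟨x, x⟩`, the length of `x - x e` is `e h - h`, of norm at most `2 ‖h‖`;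
  -- this must stay below `ε ^ 2`.
  obtain ⟨e, he, hes, he1, -, h2, -⟩ := hJ.exists_approx_unit hx (ε := ε ^ 2 / 2) (by positivity)
  refine ⟨_, ⟨e, he, rfl⟩, ?_⟩
  rw [dist_eq_norm]
  refine lt_of_pow_lt_pow_left₀ 2 hε.le ?_
  have h3 : X.mod.inner (x - X.mod.rsmul x e) (x - X.mod.rsmul x e) =
      e * (X.mod.inner x x * e - X.mod.inner x x) - (X.mod.inner x x * e - X.mod.inner x x) := by
    simp only [map_sub, LinearMap.sub_apply, X.mod.inner_rsmul, X.mod.rsmul_inner, hes, mul_sub,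
      mul_assoc]
    abel
  rw [X.norm_sq_eq, h3]
  refine (norm_sub_le _ _).trans_lt ?_
  have := norm_mul_le e (X.mod.inner x x * e - X.mod.inner x x)
  nlinarith [norm_nonneg (X.mod.inner x x * e - X.mod.inner x x)]

/-- A closed submodule containing all `x b` is everything. -/
theorem mem_of_rsmul_mem (X : Correspondence.{u, v} A B) {S : Submodule ℂ X.carrier}
    (hS : IsClosed (S : Set X.carrier)) (h : ∀ x b, X.mod.rsmul x b ∈ S) (x : X.carrier) :
    x ∈ S := by
  refine closure_minimal ?_ hS
    (X.mem_closure_rsmul isClosedIdeal_top (Submodule.mem_top (x := X.mod.inner x x)))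
  rintro _ ⟨e, -, rfl⟩
  exact h x e

theorem map_rsmul_of_inner_eq {j : B' →⋆ₙₐ[ℂ] B} {X' : Correspondence.{u, v} A' B'}
    {X : Correspondence.{u, v} A B} {s : X'.carrier →L[ℂ] X.carrier}
    (hi : ∀ x y, X.mod.inner (s x) (s y) = j (X'.mod.inner x y)) (x : X'.carrier) (b : B') :
    s (X'.mod.rsmul x b) = X.mod.rsmul (s x) (j b) := by
  rw [← sub_eq_zero]
  refine eq_zero_of_inner_self ?_
  simp only [map_sub, LinearMap.sub_apply, X.mod.inner_rsmul, X.mod.rsmul_inner, hi,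
    X'.mod.inner_rsmul, X'.mod.rsmul_inner, map_mul, map_star, sub_self, mul_assoc]

/-- The delicate point is that `i(a)(x ⊗ y)` lies in the range although `y` is arbitrary. Write
`i(a) x = s x₁` and approximate `x₁` by vectors `x₂ b`. Balancing turns `s(x₂ b) ⊗ y` into `s x₂ ⊗
j(b) y`, and `j(b) y` comes from `Y'`. -/
theorem ITransfer.tensor {i : A' →⋆ₙₐ[ℂ] A} {j : B' →⋆ₙₐ[ℂ] B} {k : C' →⋆ₙₐ[ℂ] C}
    (hk : Function.Injective k)
    {X : Correspondence.{u, v} A B} {X' : Correspondence.{u, v} A' B'}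
    {Y : Correspondence.{u, v} B C} {Y' : Correspondence.{u, v} B' C'}
    (hX : ITransfer i j X' X) (hY : ITransfer j k Y' Y) :
    ITransfer i k (X'.tensor Y') (X.tensor Y) := by
  obtain ⟨s, hi, hl, hr⟩ := hX
  obtain ⟨s', hi', hl', hr'⟩ := hY
  obtain ⟨S, hS, hSi⟩ := exists_extension (X := X'.tensor Y') (X' := X.tensor Y) k
    (X'.tensorι Y') (X.tensorι Y ∘ₗ TensorProduct.map s.toLinearMap s'.toLinearMap)
    (X'.denseRange_tensorι Y') (fun z w => by
      induction w with
      | zero => simp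
      | add w w' hw hw' => simp only [map_add, hw, hw']
      | tmul x' y' =>
        induction z with
        | zero => simp
        | add z z' hz hz' => simp only [map_add, LinearMap.add_apply, hz, hz']
        | tmul x y => simp [hi, ← hi', ← hl'])
  have hS' : ∀ x y, S (X'.tmulL Y' x y) = X.tmulL Y (s x) (s' y) := fun x y => hS (x ⊗ₜ y)
  refine ⟨S, hSi, fun a z => ?_, fun a z => ?_⟩
  · exact DFunLike.congr_fun (tensor_clm_ext (f := S.comp ((X'.tensor Y').φ a))
      (g := ((X.tensor Y).φ (i a)).comp S) fun x y => by simp [hS', hl]) z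
  · have hcl := isClosed_range_of_inner_eq hk hSi
    refine tensor_mem (S := (LinearMap.range S.toLinearMap).comap
      ((X.tensor Y).φ (i a)).toLinearMap) (hcl.preimage ((X.tensor Y).φ (i a)).continuous)
      (fun x y => ?_) z
    obtain ⟨x₁, hx₁⟩ := hr a x
    change (X.tensor Y).φ (i a) (X.tmulL Y x y) ∈ Set.range S
    rw [φ_tmulL, ← hx₁]
    refine X'.mem_of_rsmul_mem (S := (LinearMap.range S.toLinearMap).comap
      (((X.tmulL Y).flip y).comp s).toLinearMap)
      (hcl.preimage (((X.tmulL Y).flip y).comp s).continuous) (fun x₂ b => ?_) x₁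
    obtain ⟨y₁, hy₁⟩ := hr' b y
    refine ⟨X'.tmulL Y' x₂ y₁, ?_⟩
    change S _ = X.tmulL Y (s (X'.mod.rsmul x₂ b)) y
    rw [map_rsmul_of_inner_eq hi, tmulL_rsmul, hS', hy₁]

section order

attribute [local instance] CStarAlgebra.spectralOrder CStarAlgebra.spectralOrderedRing

/-- An injective homomorphism of C*-algebras reflects positivity. -/
theorem exists_eq_star_mul_self_of_map {j : B' →⋆ₙₐ[ℂ] B} (hj : Function.Injective j) {G : B'}
    (hG : ∃ b, j G = star b * b) : ∃ c, G = star c * c := by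
  obtain ⟨b, hb⟩ := hG
  have hsa : IsSelfAdjoint G := hj (by rw [map_star, hb, star_mul, star_star])
  obtain ⟨P, Q, hPs, hQ, h2, hN⟩ := InnerModule.exists_neg_part hsa
  refine hN ?_
  -- With `P` the negative part of `G`, the element `j(P) j(G) j(P)` is negative by this formula and
  -- positive by the next one, so it vanishes and `Q P = 0`.
  have h1 : j P * j G * j P = - (star (j (Q * P)) * j (Q * P)) := by
    rw [← map_mul, h2, ← map_star, star_mul, hPs, ← map_mul, ← map_mul, ← map_neg,
      mul_assoc P, ← mul_assoc (star Q), ← hQ, neg_mul, mul_assoc]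
  have h3 : j P * j G * j P = star (b * j P) * (b * j P) := by
    rw [hb, star_mul, ← map_star, hPs]
    simp only [mul_assoc]
  have h4 : star (j (Q * P)) * j (Q * P) = 0 := by
    refine le_antisymm ?_ (star_mul_self_nonneg _)
    rw [← neg_nonneg, ← h1, h3]
    exact star_mul_self_nonneg _
  have h5 : Q * P = 0 := hj (by rw [map_zero]; exact (CStarRing.star_mul_self_eq_zero_iff _).mp h4)
  refine (CStarRing.star_mul_self_eq_zero_iff P).mp ?_
  rw [hPs]
  nth_rewrite 1 [hQ]
  rw [mul_assoc, h5, mul_zero]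

end order

/-! ### Restriction of a correspondence to ideals -/

section Restrict

variable (i : A' →⋆ₙₐ[ℂ] A) (j : B' →⋆ₙₐ[ℂ] B) (X : Correspondence.{u, v} A B)

/-- The closed span of `i(A') X`. -/
noncomputable def restrictSubmodule : Submodule ℂ X.carrier :=
  (Submodule.span ℂ {z | ∃ a x, X.φ (i a) x = z}).topologicalClosure

variable {i X} in
theorem φ_mem_restrictSubmodule (a : A') (x : X.carrier) :
    X.φ (i a) x ∈ X.restrictSubmodule i :=
  Submodule.le_topologicalClosure _ (Submodule.subset_span ⟨a, x, rfl⟩)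

theorem isClosed_restrictSubmodule : IsClosed (X.restrictSubmodule i : Set X.carrier) :=
  Submodule.isClosed_topologicalClosure _

variable {i X} in
theorem restrictSubmodule_le {S : Submodule ℂ X.carrier} (hS : IsClosed (S : Set X.carrier))
    (h : ∀ a x, X.φ (i a) x ∈ S) : X.restrictSubmodule i ≤ S :=
  Submodule.topologicalClosure_minimal _
    (Submodule.span_le.mpr (by rintro _ ⟨a, x, rfl⟩; exact h a x)) hS

variable {i j X} in
-- An injective homomorphism is isometric, so its range is closed and the condition on generators
-- passes to the closed span.
theorem exists_inner_of_mem_restrict (hj : Function.Injective j)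
    (h : ∀ a x y, ∃ b, j b = X.mod.inner x (X.φ (i a) y)) (x : X.carrier) {y : X.carrier}
    (hy : y ∈ X.restrictSubmodule i) :
    ∃ b, j b = X.mod.inner x y := by
  have hcl : IsClosed (Set.range j) :=
    (NonUnitalStarAlgHom.isometry j hj).isClosedEmbedding.isClosed_range
  let jl : B' →ₗ[ℂ] B := { toFun := j, map_add' := map_add j, map_smul' := map_smul j }
  refine restrictSubmodule_le (S := (LinearMap.range jl).comap (X.innerL x).toLinearMap)
    (hcl.preimage (X.innerL x).continuous) (fun a y => ?_) hy
  exact h a x y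

/-- A correspondence can be restricted to subalgebras. -/
theorem exists_restrict (hj : Function.Injective j)
    (h : ∀ a x y, ∃ b, j b = X.mod.inner x (X.φ (i a) y)) :
    ∃ X' : Correspondence.{u, v} A' B', ITransfer i j X' X := by
  have hN := X.isClosed_restrictSubmodule i
  have hφ : ∀ (a : A') (x : X.carrier), X.φ (i a) x ∈ X.restrictSubmodule i :=
    φ_mem_restrictSubmodule
  have hin (x y : X.restrictSubmodule i) : ∃ b, j b = X.mod.inner x y :=
    exists_inner_of_mem_restrict hj h x y.2
  choose inn hinn using hin
  have hr (x : X.restrictSubmodule i) (b : B') :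
      X.mod.rsmul x.1 (j b) ∈ X.restrictSubmodule i := by
    refine restrictSubmodule_le
      (S := (X.restrictSubmodule i).comap (X.rsmulL.flip (j b)).toLinearMap)
      (hN.preimage (X.rsmulL.flip (j b)).continuous) (fun a y => ?_) x.2
    change X.mod.rsmul (X.φ (i a) y) (j b) ∈ X.restrictSubmodule i
    rw [← φ_rsmul]
    exact hφ _ _
  let M : InnerModule B' (X.restrictSubmodule i) :=
    { rsmul := LinearMap.mk₂ ℂ (fun x b => ⟨X.mod.rsmul x (j b), hr x b⟩)
        (fun _ _ _ => Subtype.ext (by simp)) (fun _ _ _ => Subtype.ext (by simp))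
        (fun _ _ _ => Subtype.ext (by simp)) (fun _ _ _ => Subtype.ext (by simp))
      rsmul_mul x b c := Subtype.ext (by simp [X.mod.rsmul_mul])
      inner := LinearMap.mk₂'ₛₗ _ _ inn
        (fun x y z => hj (by simp [hinn])) (fun c x y => hj (by simp [hinn]))
        (fun x y z => hj (by simp [hinn])) (fun c x y => hj (by simp [hinn]))
      inner_rsmul x y b := hj (by simp [hinn, X.mod.inner_rsmul])
      star_inner x y := hj (by simp [hinn, map_star, X.mod.star_inner])
      inner_self_nonneg x := exists_eq_star_mul_self_of_map hj (by
        simp only [LinearMap.mk₂'ₛₗ_apply, hinn]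
        exact X.mod.inner_self_nonneg x) }
  have hM : ∀ x y, j (M.inner x y) = X.mod.inner x y := hinn
  let Φ : A' →ₙₐ[ℂ] (X.restrictSubmodule i →L[ℂ] X.restrictSubmodule i) :=
    { toFun a := ((X.φ (i a)).comp (X.restrictSubmodule i).subtypeL).codRestrict
        (X.restrictSubmodule i) fun x => hφ a x
      map_smul' c a := by ext; simp; rfl
      map_zero' := by ext; simp
      map_add' a b := by ext; simp; rfl
      map_mul' a b := by ext; simp; rfl }
  have hΦ : ∀ a x, (Φ a x : X.carrier) = X.φ (i a) x := fun _ _ => rfl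
  refine ⟨⟨X.restrictSubmodule i, M, fun x => ?_, Φ, fun a x y => hj ?_, ?_⟩,
    (X.restrictSubmodule i).subtypeL, fun x y => (hM x y).symm, hΦ, fun a x => ⟨⟨_, hφ a x⟩, rfl⟩⟩
  · rw [← NonUnitalStarAlgHom.norm_map j hj, hM, ← X.norm_sq_eq]
    rfl
  · rw [hM, hM, hΦ, hΦ, X.inner_φ, map_star i]
  · set T := (Submodule.span ℂ {z | ∃ a x, Φ a x = z}).topologicalClosure with hT
    have hS : IsClosed (T.map (X.restrictSubmodule i).subtype : Set X.carrier) :=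
      hN.isClosedEmbedding_subtypeVal.isClosedMap _ (Submodule.isClosed_topologicalClosure _)
    have hle : X.restrictSubmodule i ≤ T.map (X.restrictSubmodule i).subtype := by
      refine restrictSubmodule_le hS fun a x => ?_
      have hi : Continuous i := map_continuous i
      have hc : Continuous fun a => X.φ (i a) x := by
        have := X.continuous_φ
        fun_prop
      have := isClosedIdeal_top.mem_closure_mul (Submodule.mem_top (x := a))
      refine closure_minimal ?_ (hS.preimage hc) this
      -- Nondegeneracy has to be witnessed inside the submodule: `(e a f) x` is `e` applied to `(a
      -- f) x`, which already lies there.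
      rintro _ ⟨e, -, f, -, rfl⟩
      refine ⟨Φ e ⟨_, hφ (a * f) x⟩,
        Submodule.le_topologicalClosure _ (Submodule.subset_span ⟨_, _, rfl⟩), ?_⟩
      change X.φ (i e) (X.φ (i (a * f)) x) = X.φ (i (e * a * f)) x
      rw [mul_assoc, map_mul i e, map_mul X.φ (i e)]
      rfl
    refine eq_top_iff.mpr fun x _ => ?_
    obtain ⟨y, hy, hyx⟩ := hle x.2
    rwa [← Subtype.ext hyx]

end Restrict

/-- The completion of a semi-inner product module with a left action. -/
theorem exists_completion {V : Type v} [AddCommGroup V] [Module ℂ V] (M : InnerModule B V)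
    (L : A →ₙₐ[ℂ] Module.End ℂ V)
    (hL : ∀ a x y, M.inner (L a x) y = M.inner x (L (star a) y))
    (hnd : ∀ S : Submodule ℂ M.Compl, IsClosed (S : Set M.Compl) →
      (∀ a x, M.ι (L a x) ∈ S) → ∀ x, M.ι x ∈ S) :
    ∃ (X : Correspondence.{u, v} A B) (t : V →ₗ[ℂ] X.carrier), DenseRange t ∧
      (∀ x y, X.mod.inner (t x) (t y) = M.inner x y) ∧ ∀ a x, t (L a x) = X.φ a (t x) := by
  refine ⟨⟨M.Compl, M.compl, M.compl_norm_sq, M.complLeft L hL, fun a z w => ?_, ?_⟩,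
    M.ι, M.denseRange_ι, M.innerCompl_ι, fun a x => (M.complLeft_ι L hL a x).symm⟩
  · refine M.denseRange_ι.induction_on₂ (p := fun z w => M.innerCompl (M.complLeft L hL a z) w
      = M.innerCompl z (M.complLeft L hL (star a) w)) ?_ (fun z w => ?_) z w
    · exact isClosed_eq (by fun_prop) (by fun_prop)
    · rw [M.complLeft_ι, M.complLeft_ι, M.innerCompl_ι, M.innerCompl_ι, hL]
  · refine eq_top_iff.mpr fun z _ => ?_
    have hS := Submodule.isClosed_topologicalClosure
      (Submodule.span ℂ {z | ∃ a x, M.complLeft L hL a x = z})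
    refine M.denseRange_ι.induction_on z hS (hnd _ hS fun a x => ?_)
    exact Submodule.le_topologicalClosure _
      (Submodule.subset_span ⟨a, M.ι x, M.complLeft_ι L hL a x⟩)

/-! ### Quotient of a correspondence -/

section Quotient

variable {p : A →⋆ₙₐ[ℂ] A'} {r : B →⋆ₙₐ[ℂ] B'} (X : Correspondence.{u, v} A B)

/-- The vectors whose inner products lie in the kernel of `r`. -/
def nullSubmodule (r : B →⋆ₙₐ[ℂ] B') : Submodule ℂ X.carrier where
  carrier := {x | ∀ y, r (X.mod.inner y x) = 0}
  add_mem' hx hy z := by simp [hx z, hy z]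
  zero_mem' := by simp
  smul_mem' c x hx z := by simp [hx z]

/-- A correspondence has a quotient along surjective homomorphisms of the coefficient algebras,
provided that the kernel of the first acts trivially on the quotient module. -/
theorem exists_quotient (hp : Function.Surjective p) (hr : Function.Surjective r)
    (h : ∀ a x y, p a = 0 → r (X.mod.inner x (X.φ a y)) = 0) :
    ∃ X' : Correspondence.{u, v} A' B', QTransfer p r X X' := by
  let N := X.nullSubmodule r
  have hN : ∀ {x}, x ∈ N ↔ ∀ y, r (X.mod.inner y x) = 0 := Iff.rfl
  -- `σ` and `τ` are mere set-theoretic sections; `hrs` and `hls` show that the actions do not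
  -- depend on them, which then gives linearity and multiplicativity.
  choose σ hσ using hr
  choose τ hτ using hp
  have hrs : ∀ x b b', r b = r b' → N.mkQ (X.mod.rsmul x b) = N.mkQ (X.mod.rsmul x b') := by
    intro x b b' hb
    rw [← sub_eq_zero, ← map_sub, ← map_sub, Submodule.mkQ_apply, Submodule.Quotient.mk_eq_zero]
    intro y
    rw [X.mod.inner_rsmul, map_mul, map_sub, hb, sub_self, mul_zero]
  have hls : ∀ x a a', p a = p a' → N.mkQ (X.φ a x) = N.mkQ (X.φ a' x) := by
    intro x a a' ha
    rw [← sub_eq_zero, ← map_sub, ← sub_apply, ← map_sub, Submodule.mkQ_apply,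
      Submodule.Quotient.mk_eq_zero]
    intro y
    exact h _ _ _ (by rw [map_sub, ha, sub_self])
  let R : (X.carrier ⧸ N) →ₗ[ℂ] B' →ₗ[ℂ] (X.carrier ⧸ N) := LinearMap.flip
    { toFun b := N.mapQ N (X.mod.rsmul.flip (σ b)) fun x hx y => by
        simp [X.mod.inner_rsmul, hN.mp hx]
      map_add' b b' := N.linearMap_qext <| LinearMap.ext fun x => by
        exact (hrs x _ (σ b + σ b') (by simp [hσ])).trans (by rw [map_add, map_add]; rfl)
      map_smul' c b := N.linearMap_qext <| LinearMap.ext fun x => by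
        exact (hrs x _ (c • σ b) (by simp [hσ])).trans (by rw [map_smul, map_smul]; rfl) }
  have hR : ∀ x b, R (N.mkQ x) (r b) = N.mkQ (X.mod.rsmul x b) := fun x b =>
    hrs x _ _ (hσ _)
  let rl : B →ₗ[ℂ] B' := { toFun := r, map_add' := map_add r, map_smul' := map_smul r }
  let I : (X.carrier ⧸ N) →ₗ⋆[ℂ] (X.carrier ⧸ N) →ₗ[ℂ] B' := N.liftQ
    { toFun x := N.liftQ (rl ∘ₗ X.mod.inner x) fun y hy => hN.mp hy x
      map_add' x y := N.linearMap_qext <| LinearMap.ext fun z => by simp; rfl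
      map_smul' c x := N.linearMap_qext <| LinearMap.ext fun z => by simp; rfl }
    fun x hx => N.linearMap_qext <| LinearMap.ext fun z => by
      change r (X.mod.inner x z) = 0
      rw [← X.mod.star_inner, map_star, hN.mp hx, star_zero]
  have hI : ∀ x y, I (N.mkQ x) (N.mkQ y) = r (X.mod.inner x y) := fun _ _ => rfl
  have hs := N.mkQ_surjective
  let M : InnerModule B' (X.carrier ⧸ N) :=
    { rsmul := R
      rsmul_mul x b c := by
        obtain ⟨x, rfl⟩ := hs x
        rw [← hσ b, ← hσ c, ← map_mul, hR, hR, hR, X.mod.rsmul_mul]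
      inner := I
      inner_rsmul x y b := by
        obtain ⟨x, rfl⟩ := hs x
        obtain ⟨y, rfl⟩ := hs y
        rw [← hσ b, hR, hI, hI, X.mod.inner_rsmul, map_mul]
      star_inner x y := by
        obtain ⟨x, rfl⟩ := hs x
        obtain ⟨y, rfl⟩ := hs y
        rw [hI, hI, ← map_star, X.mod.star_inner]
      inner_self_nonneg x := by
        obtain ⟨x, rfl⟩ := hs x
        obtain ⟨b, hb⟩ := X.mod.inner_self_nonneg x
        exact ⟨r b, by rw [hI, hb, map_mul, map_star]⟩ }
  let L : A' →ₙₐ[ℂ] Module.End ℂ (X.carrier ⧸ N) :=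
    { toFun a := N.mapQ N (X.φ (τ a)).toLinearMap fun x hx y => by
        change r (X.mod.inner y (X.φ (τ a) x)) = 0
        rw [X.inner_φ_right]
        exact hN.mp hx _
      map_smul' c a := N.linearMap_qext <| LinearMap.ext fun x => by
        exact (hls x _ (c • τ a) (by simp [hτ])).trans (by rw [map_smul, smul_apply, map_smul]; rfl)
      map_zero' := N.linearMap_qext <| LinearMap.ext fun x => by
        exact (hls x _ 0 (by simp [hτ])).trans (by rw [map_zero, zero_apply, map_zero]; rfl)
      map_add' a b := N.linearMap_qext <| LinearMap.ext fun x => by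
        exact (hls x _ (τ a + τ b) (by simp [hτ])).trans (by rw [map_add, add_apply, map_add]; rfl)
      map_mul' a b := N.linearMap_qext <| LinearMap.ext fun x => by
        exact (hls x _ (τ a * τ b) (by simp [hτ])).trans (by rw [map_mul]; rfl) }
  have hL : ∀ a x, L (p a) (N.mkQ x) = N.mkQ (X.φ a x) := fun a x => hls x _ _ (hτ _)
  have hLa : ∀ a x y, M.inner (L a x) y = M.inner x (L (star a) y) := by
    intro a x y
    obtain ⟨x, rfl⟩ := hs x
    obtain ⟨y, rfl⟩ := hs y
    rw [← hτ a, ← map_star, hL, hL]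
    change r _ = r _
    rw [X.inner_φ]
  -- Contractivity of `r` makes the quotient map continuous, which carries nondegeneracy over from
  -- `X`.
  have hn : ∀ x, ‖M.ι (N.mkQ x)‖ ≤ 1 * ‖x‖ := fun x => by
    rw [M.norm_ι, one_mul, X.norm_eq]
    exact Real.sqrt_le_sqrt (NonUnitalStarAlgHom.norm_apply_le r _)
  have hc : Continuous (M.ι ∘ₗ N.mkQ) := AddMonoidHomClass.continuous_of_bound _ 1 hn
  obtain ⟨X', t, hd, hi, hl⟩ := exists_completion M L hLa fun S hS h x => by
    obtain ⟨x, rfl⟩ := hs x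
    refine X.mem_of_φ_mem (S := S.comap (M.ι ∘ₗ N.mkQ)) (hS.preimage hc) (fun a x => ?_) x
    have := h (p a) (N.mkQ x)
    rwa [hL] at this
  refine ⟨X', QTransfer.of_dense LinearMap.id (t ∘ₗ N.mkQ) denseRange_id ?_
    (fun x y => hi _ _) (fun a x y => ?_)⟩
  · change Dense (Set.range (t ∘ N.mkQ))
    rw [hs.range_comp]
    exact hd
  · change X'.mod.inner (t (N.mkQ x)) (X'.φ (p a) (t (N.mkQ y))) = r (X.mod.inner x (X.φ a y))
    rw [← hl, hL, hi]
    rfl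

end Quotient

end Correspondence
end CStarCorr

namespace CStarCorr
open scoped TensorProduct
open scoped CStarAlgebra

namespace Correspondence

/-! ### Transport of ideals: `pull` and `push` -/

section IdealFunctors

variable {A B C : Type u} [NonUnitalCStarAlgebra A] [NonUnitalCStarAlgebra B]
  [NonUnitalCStarAlgebra C]

/-- The elements `a` with `⟨X, a X⟩ ⊆ J`. -/
def pull (X : Correspondence.{u, v} A B) (J : Submodule ℂ B) : Submodule ℂ A where
  carrier := {a | ∀ x y, X.mod.inner x (X.φ a y) ∈ J}
  add_mem' ha hb x y := by
    simp only [map_add, add_apply]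
    exact J.add_mem (ha x y) (hb x y)
  zero_mem' := by simp
  smul_mem' c a ha x y := by
    simp only [map_smul, smul_apply]
    exact J.smul_mem c (ha x y)

theorem mem_pull {X : Correspondence.{u, v} A B} {J : Submodule ℂ B} {a : A} :
    a ∈ X.pull J ↔ ∀ x y, X.mod.inner x (X.φ a y) ∈ J := Iff.rfl

theorem pull_mono (X : Correspondence.{u, v} A B) {J K : Submodule ℂ B} (h : J ≤ K) :
    X.pull J ≤ X.pull K := fun _ ha x y => h (ha x y)

theorem isClosedIdeal_pull (X : Correspondence.{u, v} A B) {J : Submodule ℂ B}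
    (hJ : IsClosedIdeal J) : IsClosedIdeal (X.pull J) where
  isClosed := by
    have : (X.pull J : Set A) = ⋂ x, ⋂ y, {a | X.mod.inner x (X.φ a y) ∈ J} := by
      ext; simp [mem_pull]
    rw [this]
    refine isClosed_iInter fun x => isClosed_iInter fun y => hJ.isClosed.preimage ?_
    exact ((X.innerL x).comp (X.lsmulL.flip y)).continuous
  mul_left a j hj x y := by
    rw [map_mul]
    change X.mod.inner x (X.φ a (X.φ j y)) ∈ J
    rw [X.inner_φ_right]
    exact hj _ _
  mul_right a j hj x y := by
    rw [map_mul]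
    exact hj _ _
  star_mem j hj x y := by
    rw [X.inner_φ_right, star_star, ← X.mod.star_inner]
    exact hJ.star_mem _ (hj _ _)

/-- Everything is in the formula `⟨x ⊗ y, a (x' ⊗ y')⟩ = ⟨y, ⟨x, a x'⟩ y'⟩`; elementary tensors
suffice because `J` is closed. -/
theorem pull_tensor (X : Correspondence.{u, v} A B) (Y : Correspondence.{u, v} B C)
    {J : Submodule ℂ C} (hJ : IsClosed (J : Set C)) :
    (X.tensor Y).pull J = X.pull (Y.pull J) := by
  ext a
  refine ⟨fun h x x' y y' => ?_, fun h => ?_⟩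
  · simpa using h (X.tmulL Y x y) (X.tmulL Y x' y')
  · refine tensor_inner_mem hJ _ fun x y x' y' => ?_
    simpa using h x x' y y'

theorem Iso.pull_eq {X Y : Correspondence.{u, v} A B} (h : X.Iso Y) (J : Submodule ℂ B) :
    X.pull J = Y.pull J := by
  obtain ⟨U, hs, hl, hr, hi⟩ := h
  ext a
  simp only [mem_pull, hs.forall, ← hl, hi]

theorem pull_bot {X : Correspondence.{u, v} A B} : X.pull ⊥ = ⊥ ↔ X.IsInjective := by
  rw [IsInjective, injective_iff_map_eq_zero, eq_bot_iff]
  refine ⟨fun h a ha => h fun x y => by simp [ha], fun h a ha => h a ?_⟩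
  ext y
  exact eq_zero_of_inner_self (ha _ _)

/-- If `p a` acts as zero on the quotient, the matrix coefficients of `a` lie in the kernel of `r`;
the hypothesis says that only elements of the kernel of `p` have this property. -/
theorem QTransfer.isInjective {A' B' : Type u} [NonUnitalCStarAlgebra A'] [NonUnitalCStarAlgebra B']
    {p : A →⋆ₙₐ[ℂ] A'} {r : B →⋆ₙₐ[ℂ] B'} (hp : Function.Surjective p)
    {X : Correspondence.{u, v} A B} {X' : Correspondence.{u, v} A' B'} (h : QTransfer p r X X')
    (hX : ∀ a, (∀ x y, r (X.mod.inner x (X.φ a y)) = 0) → p a = 0) : X'.IsInjective := by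
  obtain ⟨t, hd, hi, hl⟩ := h
  refine (injective_iff_map_eq_zero _).mpr fun a ha => ?_
  obtain ⟨a, rfl⟩ := hp a
  refine hX a fun x y => ?_
  rw [← hi, hl, ha]
  simp

/-- The closed span of `⟨X, I X⟩`. -/
noncomputable def push (X : Correspondence.{u, v} A B) (I : Submodule ℂ A) : Submodule ℂ B :=
  (Submodule.span ℂ {b | ∃ a ∈ I, ∃ x y, X.mod.inner x (X.φ a y) = b}).topologicalClosure

theorem inner_mem_push {X : Correspondence.{u, v} A B} {I : Submodule ℂ A} {a : A} (ha : a ∈ I)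
    (x y : X.carrier) : X.mod.inner x (X.φ a y) ∈ X.push I :=
  Submodule.le_topologicalClosure _ (Submodule.subset_span ⟨a, ha, x, y, rfl⟩)

theorem isClosed_push (X : Correspondence.{u, v} A B) (I : Submodule ℂ A) :
    IsClosed (X.push I : Set B) := Submodule.isClosed_topologicalClosure _

theorem push_le {X : Correspondence.{u, v} A B} {I : Submodule ℂ A} {J : Submodule ℂ B}
    (hJ : IsClosed (J : Set B)) (h : ∀ a ∈ I, ∀ x y, X.mod.inner x (X.φ a y) ∈ J) :
    X.push I ≤ J :=
  Submodule.topologicalClosure_minimal _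
    (Submodule.span_le.mpr (by rintro _ ⟨a, ha, x, y, rfl⟩; exact h a ha x y)) hJ

theorem push_mono (X : Correspondence.{u, v} A B) {I K : Submodule ℂ A} (h : I ≤ K) :
    X.push I ≤ X.push K :=
  push_le (X.isClosed_push K) fun _ ha => inner_mem_push (h ha)

/-- Multiplication by `b` on either side is absorbed into the vectors of `X`; only stability under
the adjoint uses that `I` is self-adjoint. -/
theorem isClosedIdeal_push (X : Correspondence.{u, v} A B) {I : Submodule ℂ A}
    (hI : IsClosedIdeal I) : IsClosedIdeal (X.push I) where
  isClosed := X.isClosed_push I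
  mul_left b j hj := by
    refine push_le (J := (X.push I).comap (LinearMap.mulLeft ℂ b))
      ((X.isClosed_push I).preimage (continuous_const_mul b)) (fun a ha x y => ?_) hj
    change b * X.mod.inner x (X.φ a y) ∈ X.push I
    rw [← star_star b, ← X.mod.rsmul_inner]
    exact inner_mem_push ha _ _
  mul_right b j hj := by
    refine push_le (J := (X.push I).comap (LinearMap.mulRight ℂ b))
      ((X.isClosed_push I).preimage (continuous_mul_const b)) (fun a ha x y => ?_) hj
    change X.mod.inner x (X.φ a y) * b ∈ X.push I
    rw [← X.mod.inner_rsmul, ← φ_rsmul]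
    exact inner_mem_push ha _ _
  star_mem j hj := by
    refine push_le (J := (X.push I).comap (starLinearEquiv ℂ (A := B)).toLinearMap)
      ((X.isClosed_push I).preimage continuous_star) (fun a ha x y => ?_) hj
    change star (X.mod.inner x (X.φ a y)) ∈ X.push I
    rw [X.mod.star_inner, X.inner_φ]
    exact inner_mem_push (hI.star_mem _ ha) _ _

/-- The same formula for matrix coefficients of elementary tensors as for `pull_tensor`, now read as
an equality of generating sets up to closure. -/
theorem push_tensor (X : Correspondence.{u, v} A B) (Y : Correspondence.{u, v} B C)
    (I : Submodule ℂ A) : (X.tensor Y).push I = Y.push (X.push I) := by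
  refine le_antisymm (push_le (Y.isClosed_push _) fun a ha => ?_)
    (push_le ((X.tensor Y).isClosed_push _) fun b hb y y' => ?_)
  · refine tensor_inner_mem (Y.isClosed_push _) _ fun x y x' y' => ?_
    rw [φ_tmulL, inner_tmulL]
    exact inner_mem_push (inner_mem_push ha _ _) _ _
  · have hc := ((Y.innerL y).comp (Y.lsmulL.flip y')).continuous
    refine push_le (J := ((X.tensor Y).push I).comap
      ((Y.innerL y).comp (Y.lsmulL.flip y')).toLinearMap)
      (((X.tensor Y).isClosed_push _).preimage hc) (fun a ha x x' => ?_) hb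
    have := inner_mem_push (X := X.tensor Y) ha (X.tmulL Y x y) (X.tmulL Y x' y')
    rwa [φ_tmulL, inner_tmulL] at this

theorem Iso.push_eq {X Y : Correspondence.{u, v} A B} (h : X.Iso Y) (I : Submodule ℂ A) :
    X.push I = Y.push I := by
  obtain ⟨U, hs, hl, hr, hi⟩ := h
  simp only [push, hs.exists, ← hl, hi]

theorem inner_mem_push_top (X : Correspondence.{u, v} A B) (x y : X.carrier) :
    X.mod.inner x y ∈ X.push ⊤ :=
  X.mem_of_φ_mem (S := (X.push ⊤).comap (X.innerL x).toLinearMap)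
    ((X.isClosed_push _).preimage (X.innerL x).continuous)
    (fun _ _ => inner_mem_push Submodule.mem_top _ _) y

theorem push_top {X : Correspondence.{u, v} A B} : X.push ⊤ = ⊤ ↔ X.IsFull := by
  suffices X.push ⊤ = (Submodule.span ℂ {b | ∃ ξ η, X.mod.inner ξ η = b}).topologicalClosure by
    rw [this, IsFull]
  refine le_antisymm (push_le (Submodule.isClosed_topologicalClosure _) fun a _ x y => ?_)
    (Submodule.topologicalClosure_minimal _ (Submodule.span_le.mpr ?_) (X.isClosed_push _))
  · exact Submodule.le_topologicalClosure _ (Submodule.subset_span ⟨_, _, rfl⟩)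
  · rintro _ ⟨x, y, rfl⟩
    exact X.inner_mem_push_top x y

/-- A closed submodule containing all `x ⟨y, z⟩` is everything. -/
theorem mem_of_rsmul_inner_mem (X : Correspondence.{u, v} A B) {S : Submodule ℂ X.carrier}
    (hS : IsClosed (S : Set X.carrier)) (h : ∀ x y z, X.mod.rsmul x (X.mod.inner y z) ∈ S)
    (x : X.carrier) : x ∈ S := by
  -- The ideal `X.push ⊤` contains `⟨x, x⟩`, so `x` is a limit of `x e` with `e` in it, and such `e`
  -- are limits of sums of inner products.
  refine closure_minimal ?_ hS (X.mem_closure_rsmul (X.isClosedIdeal_push isClosedIdeal_top)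
    (X.inner_mem_push_top x x))
  rintro _ ⟨e, he, rfl⟩
  exact push_le (J := S.comap (X.rsmulL x).toLinearMap) (hS.preimage (X.rsmulL x).continuous)
    (fun a _ y z => h x y _) he

end IdealFunctors

end Correspondence
end CStarCorr

namespace CStarCorr
open scoped TensorProduct
open scoped CStarAlgebra

namespace Correspondence

/-! ### The C*-algebra of adjointable operators and its ideal of compacts -/

section Adjointable

variable {A B : Type u} [NonUnitalCStarAlgebra A] [NonUnitalCStarAlgebra B]
  (X : Correspondence.{u, v} A B)

/-- `S` is an adjoint of `T`. -/
def IsAdj (T S : X.carrier →L[ℂ] X.carrier) : Prop :=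
  ∀ x y, X.mod.inner (T x) y = X.mod.inner x (S y)

variable {X}

theorem IsAdj.symm {T S : X.carrier →L[ℂ] X.carrier} (h : X.IsAdj T S) : X.IsAdj S T :=
  fun x y => by rw [← X.mod.star_inner, ← h, X.mod.star_inner]

theorem IsAdj.unique {T S S' : X.carrier →L[ℂ] X.carrier} (h : X.IsAdj T S) (h' : X.IsAdj T S') :
    S = S' := by
  ext y
  exact ext_inner fun x => by rw [← h, ← h']

theorem IsAdj.norm_sq_le {T S : X.carrier →L[ℂ] X.carrier} (h : X.IsAdj T S) :
    ‖T‖ * ‖T‖ ≤ ‖S * T‖ := by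
  have h1 : ‖T‖ ≤ √‖S * T‖ := by
    refine T.opNorm_le_bound (Real.sqrt_nonneg _) fun x => ?_
    refine le_of_sq_le_sq ?_ (by positivity)
    rw [X.norm_sq_eq, h, mul_pow, Real.sq_sqrt (norm_nonneg _), sq]
    refine (X.norm_inner_le _ _).trans ?_
    have := (S * T).le_opNorm x
    calc ‖x‖ * ‖S (T x)‖ ≤ ‖x‖ * (‖S * T‖ * ‖x‖) :=
          mul_le_mul_of_nonneg_left this (norm_nonneg _)
      _ = _ := by ring
  calc _ ≤ √‖S * T‖ * √‖S * T‖ := mul_self_le_mul_self (norm_nonneg _) h1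
    _ = _ := Real.mul_self_sqrt (norm_nonneg _)

theorem IsAdj.norm_le {T S : X.carrier →L[ℂ] X.carrier} (h : X.IsAdj T S) : ‖T‖ ≤ ‖S‖ := by
  by_contra! hlt
  have h1 := h.norm_sq_le.trans (norm_mul_le S T)
  nlinarith [norm_nonneg S]

theorem IsAdj.norm_eq {T S : X.carrier →L[ℂ] X.carrier} (h : X.IsAdj T S) : ‖T‖ = ‖S‖ :=
  le_antisymm h.norm_le h.symm.norm_le

theorem IsAdj.sub {T S T' S' : X.carrier →L[ℂ] X.carrier} (h : X.IsAdj T S) (h' : X.IsAdj T' S') :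
    X.IsAdj (T - T') (S - S') := fun x y => by simp [h x y, h' x y]

variable (X) in
/-- The adjointable operators. -/
def adjointables : Subalgebra ℂ (X.carrier →L[ℂ] X.carrier) where
  carrier := {T | ∃ S, X.IsAdj T S}
  mul_mem' := by
    rintro T T' ⟨S, h⟩ ⟨S', h'⟩
    exact ⟨S' * S, fun x y => (h _ _).trans (h' _ _)⟩
  add_mem' := by
    rintro T T' ⟨S, h⟩ ⟨S', h'⟩
    exact ⟨S + S', fun x y => by simp [h x y, h' x y]⟩
  algebraMap_mem' c := ⟨algebraMap ℂ _ (star c), fun x y => by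
    simp [Algebra.algebraMap_eq_smul_one]⟩

/-- Passing to adjoints is isometric, so the adjoints of a convergent sequence are Cauchy, and their
limit is an adjoint of the limit. -/
theorem isClosed_adjointables :
    IsClosed (X.adjointables : Set (X.carrier →L[ℂ] X.carrier)) := by
  refine isClosed_of_closure_subset fun T hT => ?_
  obtain ⟨u, hu, hlim⟩ := mem_closure_iff_seq_limit.mp hT
  choose w hw using hu
  have hc : CauchySeq w := by
    have := hlim.cauchySeq
    rw [Metric.cauchySeq_iff] at this ⊢
    intro ε hε
    obtain ⟨N, hN⟩ := this ε hε
    refine ⟨N, fun m hm n hn => ?_⟩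
    rw [dist_eq_norm, ← ((hw m).sub (hw n)).norm_eq, ← dist_eq_norm]
    exact hN m hm n hn
  obtain ⟨S, hS⟩ := cauchySeq_tendsto_of_complete hc
  refine ⟨S, fun x y => ?_⟩
  have e (z : X.carrier) : Continuous fun T : X.carrier →L[ℂ] X.carrier => T z := by fun_prop
  have h1 : Filter.Tendsto (fun n => X.innerL.flip y (u n x)) Filter.atTop
      (nhds (X.innerL.flip y (T x))) :=
    ((X.innerL.flip y).continuous.tendsto _).comp (((e x).tendsto _).comp hlim)
  have h2 : Filter.Tendsto (fun n => X.innerL x (w n y)) Filter.atTop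
      (nhds (X.innerL x (S y))) :=
    ((X.innerL x).continuous.tendsto _).comp (((e y).tendsto _).comp hS)
  exact tendsto_nhds_unique h1 (h2.congr fun n => (hw n x y).symm)

variable (X) in
/-- The C*-algebra of adjointable operators. -/
def Adj : Type v := X.adjointables

namespace Adj

noncomputable instance : NormedRing X.Adj := inferInstanceAs (NormedRing X.adjointables)

noncomputable instance : NormedAlgebra ℂ X.Adj :=
  inferInstanceAs (NormedAlgebra ℂ X.adjointables)

instance : CompleteSpace X.Adj := isClosed_adjointables.completeSpace_coe

/-- The underlying operator. -/
def op (T : X.Adj) : X.carrier →L[ℂ] X.carrier := T.1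

theorem op_injective : Function.Injective (op (X := X)) := Subtype.val_injective

theorem norm_op (T : X.Adj) : ‖T.op‖ = ‖T‖ := rfl

/-- An operator with a given adjoint, as an element of the algebra. -/
def mk {T S : X.carrier →L[ℂ] X.carrier} (h : X.IsAdj T S) : X.Adj := ⟨T, S, h⟩

@[simp] theorem op_mk {T S : X.carrier →L[ℂ] X.carrier} (h : X.IsAdj T S) : (mk h).op = T := rfl

noncomputable instance : Star X.Adj where
  star T := mk T.2.choose_spec.symm

theorem isAdj_star (T : X.Adj) : X.IsAdj T.op (star T).op := T.2.choose_spec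

theorem star_eq_of_isAdj {S T : X.Adj} (h : X.IsAdj T.op S.op) : star T = S :=
  op_injective (T.isAdj_star.unique h)

@[simp] theorem op_mul (S T : X.Adj) : (S * T).op = S.op * T.op := rfl
@[simp] theorem op_add (S T : X.Adj) : (S + T).op = S.op + T.op := rfl
@[simp] theorem op_sub (S T : X.Adj) : (S - T).op = S.op - T.op := rfl
@[simp] theorem op_smul (c : ℂ) (T : X.Adj) : (c • T).op = c • T.op := rfl
@[simp] theorem op_zero : (0 : X.Adj).op = 0 := rfl
@[simp] theorem op_one : (1 : X.Adj).op = 1 := rfl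

noncomputable instance : StarRing X.Adj where
  star_involutive T := star_eq_of_isAdj T.isAdj_star.symm
  star_mul S T := star_eq_of_isAdj fun x y => (S.isAdj_star _ _).trans (T.isAdj_star _ _)
  star_add S T := star_eq_of_isAdj fun x y => by simp [S.isAdj_star x y, T.isAdj_star x y]

noncomputable instance : CStarAlgebra X.Adj where
  norm_mul_self_le T := T.isAdj_star.norm_sq_le
  star_smul c T := star_eq_of_isAdj fun x y => by simp [T.isAdj_star x y]

/-- The left action as a *-homomorphism into the adjointable operators. -/
noncomputable def φ (X : Correspondence.{u, v} A B) : A →⋆ₙₐ[ℂ] X.Adj where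
  toFun a := mk (X.inner_φ a)
  map_smul' c a := op_injective (map_smul X.φ c a)
  map_zero' := op_injective (map_zero X.φ)
  map_add' a b := op_injective (map_add X.φ a b)
  map_mul' a b := op_injective (map_mul X.φ a b)
  map_star' a := (star_eq_of_isAdj (T := mk (X.inner_φ a)) (S := mk (X.inner_φ (star a)))
    (X.inner_φ a)).symm

@[simp] theorem op_φ (a : A) : (φ X a).op = X.φ a := rfl

end Adj

theorem isAdj_theta (x y : X.carrier) : X.IsAdj (X.theta x y) (X.theta y x) := fun z w => by
  change X.mod.inner (X.mod.rsmul x (X.mod.inner y z)) w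
    = X.mod.inner z (X.mod.rsmul y (X.mod.inner x w))
  rw [X.mod.rsmul_inner, X.mod.inner_rsmul, X.mod.star_inner]

theorem theta_apply (x y z : X.carrier) : X.theta x y z = X.mod.rsmul x (X.mod.inner y z) := rfl

namespace Adj

/-- The rank-one operators. -/
noncomputable def theta (x y : X.carrier) : X.Adj := mk (isAdj_theta x y)

@[simp] theorem op_theta (x y : X.carrier) : (theta x y).op = X.theta x y := rfl

theorem op_rsmul (T : X.Adj) (x : X.carrier) (b : B) :
    T.op (X.mod.rsmul x b) = X.mod.rsmul (T.op x) b :=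
  ext_inner fun z => by
    rw [← T.isAdj_star.symm, X.mod.inner_rsmul, X.mod.inner_rsmul, T.isAdj_star.symm]

theorem mul_theta (T : X.Adj) (x y : X.carrier) : T * theta x y = theta (T.op x) y :=
  op_injective (by ext z; simp [theta_apply, op_rsmul])

theorem star_theta (x y : X.carrier) : star (theta x y) = theta y x :=
  star_eq_of_isAdj (isAdj_theta x y)

theorem theta_mul (T : X.Adj) (x y : X.carrier) : theta x y * T = theta x ((star T).op y) := by
  rw [← star_star (theta x y * T), star_mul, star_theta, mul_theta, star_theta]

variable (X) in
/-- The compact operators inside the adjointable ones. -/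
noncomputable def compacts : Submodule ℂ X.Adj :=
  (Submodule.span ℂ {T | ∃ x y, theta x y = T}).topologicalClosure

theorem theta_mem (x y : X.carrier) : theta x y ∈ compacts X :=
  Submodule.le_topologicalClosure _ (Submodule.subset_span ⟨x, y, rfl⟩)

variable (X) in
theorem isClosed_compacts : IsClosed (compacts X : Set X.Adj) :=
  Submodule.isClosed_topologicalClosure _

theorem compacts_le {S : Submodule ℂ X.Adj} (hS : IsClosed (S : Set X.Adj))
    (h : ∀ x y, theta x y ∈ S) : compacts X ≤ S :=
  Submodule.topologicalClosure_minimal _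
    (Submodule.span_le.mpr (by rintro _ ⟨x, y, rfl⟩; exact h x y)) hS

variable (X) in
theorem isClosedIdeal_compacts : IsClosedIdeal (compacts X) where
  isClosed := isClosed_compacts X
  mul_left T j hj := by
    refine compacts_le (S := (compacts X).comap (LinearMap.mulLeft ℂ T))
      ((isClosed_compacts X).preimage (continuous_const_mul T)) (fun x y => ?_) hj
    change T * theta x y ∈ compacts X
    rw [mul_theta]
    exact theta_mem _ _
  mul_right T j hj := by
    refine compacts_le (S := (compacts X).comap (LinearMap.mulRight ℂ T))
      ((isClosed_compacts X).preimage (continuous_mul_const T)) (fun x y => ?_) hj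
    change theta x y * T ∈ compacts X
    rw [theta_mul]
    exact theta_mem _ _
  star_mem j hj := by
    refine compacts_le (S := (compacts X).comap (starLinearEquiv ℂ (A := X.Adj)).toLinearMap)
      ((isClosed_compacts X).preimage continuous_star) (fun x y => ?_) hj
    change star (theta x y) ∈ compacts X
    rw [star_theta]
    exact theta_mem _ _

/-- `op` as a linear isometry. -/
def opL (X : Correspondence.{u, v} A B) : X.Adj →ₗᵢ[ℂ] X.carrier →L[ℂ] X.carrier where
  toFun := op
  map_add' := op_add
  map_smul' := op_smul
  norm_map' := norm_op

/-- The closures are taken in different algebras, all bounded operators and the adjointable ones;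
they agree because `opL` is an isometry with complete domain. This makes approximate units of the
ideal of compacts available. -/
theorem op_mem_compacts {T : X.Adj} : T.op ∈ X.compacts ↔ T ∈ compacts X := by
  constructor
  · intro h
    have hS : IsClosed ((compacts X).map (opL X).toLinearMap : Set (X.carrier →L[ℂ] X.carrier)) :=
      (opL X).isometry.isClosedEmbedding.isClosedMap _ (isClosed_compacts X)
    have hle : X.compacts ≤ (compacts X).map (opL X).toLinearMap := by
      refine Submodule.topologicalClosure_minimal _ (Submodule.span_le.mpr ?_) hS
      rintro _ ⟨x, y, rfl⟩
      exact ⟨theta x y, theta_mem x y, rfl⟩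
    obtain ⟨T', hT', h'⟩ := hle h
    rwa [← op_injective h']
  · intro h
    have hcl : IsClosed (X.compacts : Set (X.carrier →L[ℂ] X.carrier)) :=
      Submodule.isClosed_topologicalClosure _
    refine compacts_le (S := X.compacts.comap (opL X).toLinearMap)
      (hcl.preimage (opL X).continuous) (fun x y => ?_) h
    exact Submodule.le_topologicalClosure _ (Submodule.subset_span ⟨x, y, rfl⟩)

theorem norm_φ (hX : X.IsInjective) (a : A) : ‖X.φ a‖ = ‖a‖ := by
  have hinj : Function.Injective (φ X) := fun a b h => hX (congrArg op h)
  rw [← NonUnitalStarAlgHom.norm_map (φ X) hinj a]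
  rfl

end Adj

end Adjointable

end Correspondence
end CStarCorr

namespace CStarCorr
open scoped TensorProduct
open scoped CStarAlgebra

namespace Correspondence

/-! ### Creation and annihilation operators, and the operators `T ⊗ 1` -/

section TensorOperators

variable {A B C : Type u} [NonUnitalCStarAlgebra A] [NonUnitalCStarAlgebra B]
  [NonUnitalCStarAlgebra C] (X : Correspondence.{u, v} A B) (Y : Correspondence.{u, v} B C)

/-- The adjoint of `y ↦ x ⊗ y` on the algebraic tensor product. -/
noncomputable def annihilatePre (x : X.carrier) : X.carrier ⊗[ℂ] Y.carrier →ₗ[ℂ] Y.carrier :=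
  TensorProduct.lift (LinearMap.mk₂ ℂ (fun x' y => Y.φ (X.mod.inner x x') y)
    (by simp) (by simp) (by simp) (by simp))

theorem inner_annihilatePre (x : X.carrier) (z : X.carrier ⊗[ℂ] Y.carrier) (y : Y.carrier) :
    Y.mod.inner (X.annihilatePre Y x z) y =
      (X.tensor Y).mod.inner (X.tensorι Y z) (X.tmulL Y x y) := by
  induction z with
  | zero => simp
  | add z w hz hw => simp only [map_add, LinearMap.add_apply, hz, hw]
  | tmul x' y' => simp [annihilatePre, Y.inner_φ, X.mod.star_inner]

theorem norm_tmulL_le (x : X.carrier) (y : Y.carrier) : ‖X.tmulL Y x y‖ ≤ ‖x‖ * ‖y‖ := by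
  rw [mul_comm]
  exact X.norm_ι_tmul_le Y x y

/-- For `w` the annihilated vector, the adjoint relation gives `⟨w, w⟩ = ⟨z, x ⊗ w⟩`; apply
Cauchy–Schwarz and cancel `‖w‖`. -/
theorem norm_annihilatePre_le (x : X.carrier) (z : X.carrier ⊗[ℂ] Y.carrier) :
    ‖X.annihilatePre Y x z‖ ≤ ‖x‖ * ‖X.tensorι Y z‖ := by
  set w := X.annihilatePre Y x z with hw
  by_contra! hlt
  have h1 : ‖w‖ ^ 2 ≤ ‖X.tensorι Y z‖ * (‖x‖ * ‖w‖) := by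
    rw [Y.norm_sq_eq]
    nth_rewrite 1 [hw]
    rw [inner_annihilatePre]
    exact ((X.tensor Y).norm_inner_le _ _).trans
      (mul_le_mul_of_nonneg_left (X.norm_tmulL_le Y x w) (norm_nonneg _))
  have h0 : 0 < ‖w‖ := lt_of_le_of_lt (by positivity) hlt
  nlinarith

/-- The adjoint of `y ↦ x ⊗ y`. -/
noncomputable def annihilate (x : X.carrier) : (X.tensor Y).carrier →L[ℂ] Y.carrier :=
  (X.annihilatePre Y x).extendOfNorm (X.tensorι Y)

theorem annihilate_tensorι (x : X.carrier) (z : X.carrier ⊗[ℂ] Y.carrier) :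
    X.annihilate Y x (X.tensorι Y z) = X.annihilatePre Y x z :=
  LinearMap.extendOfNorm_eq (X.denseRange_tensorι Y) ⟨‖x‖, X.norm_annihilatePre_le Y x⟩ z

@[simp]
theorem annihilate_tmulL (x x' : X.carrier) (y : Y.carrier) :
    X.annihilate Y x (X.tmulL Y x' y) = Y.φ (X.mod.inner x x') y :=
  X.annihilate_tensorι Y x (x' ⊗ₜ y)

theorem inner_annihilate (x : X.carrier) (z : (X.tensor Y).carrier) (y : Y.carrier) :
    Y.mod.inner (X.annihilate Y x z) y = (X.tensor Y).mod.inner z (X.tmulL Y x y) := by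
  refine (X.denseRange_tensorι Y).induction_on
    (p := fun z => Y.innerL (X.annihilate Y x z) y = (X.tensor Y).innerL z (X.tmulL Y x y)) z
    ?_ fun z => ?_
  · exact isClosed_eq (by fun_prop) (by fun_prop)
  · rw [annihilate_tensorι]
    exact X.inner_annihilatePre Y x z y

theorem inner_annihilate_right (x : X.carrier) (z : (X.tensor Y).carrier) (y : Y.carrier) :
    Y.mod.inner y (X.annihilate Y x z) = (X.tensor Y).mod.inner (X.tmulL Y x y) z := by
  rw [← Y.mod.star_inner, inner_annihilate, InnerModule.star_inner]

theorem annihilate_rsmul (x : X.carrier) (z : (X.tensor Y).carrier) (c : C) :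
    X.annihilate Y x ((X.tensor Y).mod.rsmul z c) = Y.mod.rsmul (X.annihilate Y x z) c :=
  ext_inner fun y => by
    rw [inner_annihilate_right, InnerModule.inner_rsmul, InnerModule.inner_rsmul,
      inner_annihilate_right]

/-- Together with its counterpart `annihilate_theta_tmulL`, this moves compactness back and forth
between `Y` and `X ⊗ Y`. -/
theorem tmulL_theta_annihilate (x x' : X.carrier) (y y' : Y.carrier) :
    (X.tmulL Y x).comp ((Y.theta y y').comp (X.annihilate Y x')) =
      (X.tensor Y).theta (X.tmulL Y x y) (X.tmulL Y x' y') := by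
  ext z
  simp [theta_apply, inner_annihilate_right]

theorem annihilate_theta_tmulL (x x' : X.carrier) (z w : (X.tensor Y).carrier) :
    (X.annihilate Y x).comp (((X.tensor Y).theta z w).comp (X.tmulL Y x')) =
      Y.theta (X.annihilate Y x z) (X.annihilate Y x' w) := by
  ext y
  simp [theta_apply, inner_annihilate, annihilate_rsmul]

section order

attribute [local instance] CStarAlgebra.spectralOrder CStarAlgebra.spectralOrderedRing

theorem inner_rTensor (T : X.Adj) (z w : X.carrier ⊗[ℂ] Y.carrier) :
    X.tensorInner Y (LinearMap.rTensor Y.carrier T.op.toLinearMap z) w =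
      X.tensorInner Y z (LinearMap.rTensor Y.carrier (star T).op.toLinearMap w) := by
  induction w with
  | zero => simp
  | add w w' hw hw' => simp only [map_add, hw, hw']
  | tmul x' y' =>
    induction z with
    | zero => simp
    | add z z' hz hz' => simp only [map_add, LinearMap.add_apply, hz, hz']
    | tmul x y => simp [T.isAdj_star x x']

/-- Write `‖T‖² - T* T = S* S` in the C*-algebra of adjointable operators. Then `‖T‖² ⟨z, z⟩ - ⟨(T ⊗
1) z, (T ⊗ 1) z⟩` is the length of `(S ⊗ 1) z`, hence positive. -/
theorem norm_rTensor_le (T : X.Adj) (z : X.carrier ⊗[ℂ] Y.carrier) :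
    ‖X.tensorι Y (LinearMap.rTensor Y.carrier T.op.toLinearMap z)‖ ≤ ‖T‖ * ‖X.tensorι Y z‖ := by
  obtain ⟨S, hS⟩ := CStarAlgebra.nonneg_iff_eq_star_mul_self.mp
    (sub_nonneg.mpr (CStarAlgebra.star_mul_le_algebraMap_norm_sq (a := T)))
  let ρ : X.Adj → X.carrier ⊗[ℂ] Y.carrier →ₗ[ℂ] X.carrier ⊗[ℂ] Y.carrier :=
    fun T => LinearMap.rTensor Y.carrier T.op.toLinearMap
  have h1 : X.tensorInner Y (ρ S z) (ρ S z) =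
      (‖T‖ ^ 2) • X.tensorInner Y z z - X.tensorInner Y (ρ T z) (ρ T z) := by
    have e : ∀ T : X.Adj, X.tensorInner Y (ρ T z) (ρ T z)
        = X.tensorInner Y z (ρ (star T * T) z) := fun T => by
      have : ρ (star T * T) z = ρ (star T) (ρ T z) := by
        simp only [ρ, ← LinearMap.comp_apply, ← LinearMap.rTensor_comp]
        rfl
      rw [this]
      exact X.inner_rTensor Y T z _
    rw [e, e, ← hS]
    have : ρ (algebraMap ℝ X.Adj (‖T‖ ^ 2) - star T * T) z
        = ((‖T‖ ^ 2 : ℝ) : ℂ) • z - ρ (star T * T) z := by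
      have h3 : (algebraMap ℝ X.Adj (‖T‖ ^ 2) - star T * T).op.toLinearMap
          = ((‖T‖ ^ 2 : ℝ) : ℂ) • LinearMap.id - (star T * T).op.toLinearMap := by
        rw [Algebra.algebraMap_eq_smul_one, ← Complex.coe_smul]
        ext x
        simp
      simp only [ρ, h3, LinearMap.rTensor_sub, LinearMap.rTensor_smul, LinearMap.rTensor_id,
        LinearMap.sub_apply, LinearMap.smul_apply, LinearMap.id_apply]
    rw [this, map_sub, map_smul, Complex.coe_smul]
  have h2 : X.tensorInner Y (ρ T z) (ρ T z) ≤ (‖T‖ ^ 2) • X.tensorInner Y z z := by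
    rw [← sub_nonneg, ← h1]
    exact (X.tensorPre Y).nonneg _
  have h3 := CStarAlgebra.norm_le_norm_of_nonneg_of_le ((X.tensorPre Y).nonneg (ρ T z)) h2
  rw [norm_smul, Real.norm_of_nonneg (by positivity)] at h3
  have hn : ∀ z, ‖X.tensorι Y z‖ = √‖X.tensorInner Y z z‖ := (X.tensorPre Y).norm_ι
  rw [hn, hn]
  refine (Real.sqrt_le_sqrt h3).trans (le_of_eq ?_)
  rw [Real.sqrt_mul (by positivity), Real.sqrt_sq (norm_nonneg _)]

end order

/-- The operator `T ⊗ 1`. -/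
noncomputable def tensorOp (T : X.Adj) : (X.tensor Y).carrier →L[ℂ] (X.tensor Y).carrier :=
  (X.tensorι Y ∘ₗ LinearMap.rTensor Y.carrier T.op.toLinearMap).extendOfNorm (X.tensorι Y)

@[simp]
theorem tensorOp_tmulL (T : X.Adj) (x : X.carrier) (y : Y.carrier) :
    X.tensorOp Y T (X.tmulL Y x y) = X.tmulL Y (T.op x) y :=
  LinearMap.extendOfNorm_eq (X.denseRange_tensorι Y) ⟨‖T‖, X.norm_rTensor_le Y T⟩ (x ⊗ₜ y)

theorem norm_tensorOp_le (T : X.Adj) : ‖X.tensorOp Y T‖ ≤ ‖T‖ :=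
  LinearMap.opNorm_extendOfNorm_le (X.denseRange_tensorι Y) (norm_nonneg _) (X.norm_rTensor_le Y T)

/-- The map `T ↦ T ⊗ 1`. -/
noncomputable def tensorOpL :
    X.Adj →L[ℂ] (X.tensor Y).carrier →L[ℂ] (X.tensor Y).carrier :=
  LinearMap.mkContinuous
    { toFun := X.tensorOp Y
      map_add' S T := tensor_clm_ext fun x y => by simp
      map_smul' c T := tensor_clm_ext fun x y => by simp } 1 fun T => by
    rw [one_mul]
    exact X.norm_tensorOp_le Y T

@[simp]
theorem tensorOpL_apply (T : X.Adj) : X.tensorOpL Y T = X.tensorOp Y T := rfl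

theorem tensorOp_mul (S T : X.Adj) : X.tensorOp Y (S * T) = X.tensorOp Y S * X.tensorOp Y T :=
  tensor_clm_ext fun x y => by simp

theorem tensorOp_φ (a : A) : X.tensorOp Y (Adj.φ X a) = (X.tensor Y).φ a :=
  tensor_clm_ext fun x y => by simp

theorem tensorOp_rsmul (T : X.Adj) (z : (X.tensor Y).carrier) (c : C) :
    X.tensorOp Y T ((X.tensor Y).mod.rsmul z c) = (X.tensor Y).mod.rsmul (X.tensorOp Y T z) c :=
  DFunLike.congr_fun (tensor_clm_ext (f := (X.tensorOp Y T).comp ((X.tensor Y).rsmulL.flip c))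
    (g := ((X.tensor Y).rsmulL.flip c).comp (X.tensorOp Y T)) fun x y => by simp) z

theorem norm_theta_le (z w : X.carrier) : ‖X.theta z w‖ ≤ ‖z‖ * ‖w‖ := by
  refine ContinuousLinearMap.opNorm_le_bound _ (by positivity) fun x => ?_
  rw [mul_assoc]
  exact (X.norm_rsmul_le z _).trans
    (mul_le_mul_of_nonneg_left (X.norm_inner_le w x) (norm_nonneg _))

/-- The rank-one operator `θ z w` as a function of `z`. -/
noncomputable def thetaL (w : X.carrier) : X.carrier →L[ℂ] X.carrier →L[ℂ] X.carrier :=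
  LinearMap.mkContinuous
    { toFun z := X.theta z w
      map_add' _ _ := by ext; simp [theta_apply]
      map_smul' _ _ := by ext; simp [theta_apply] } ‖w‖ fun z => by
    rw [mul_comm]
    exact X.norm_theta_le z w

/-- Tensoring with the identity of a faithful correspondence is isometric. -/
theorem norm_le_norm_tensorOp (hY : Y.IsInjective) (T : X.Adj) : ‖T‖ ≤ ‖X.tensorOp Y T‖ := by
  refine T.op.opNorm_le_bound (norm_nonneg _) fun x => ?_
  -- With `⟨T x, T x⟩ = c* c` one has `‖T x‖ = ‖c‖`, which is the norm of the action of `c` on `Y`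
  -- by faithfulness, while `‖c y‖ = ‖T x ⊗ y‖`.
  obtain ⟨c, hc⟩ := X.mod.inner_self_nonneg (T.op x)
  have h1 : ‖T.op x‖ = ‖c‖ := by
    rw [X.norm_eq, hc, CStarRing.norm_star_mul_self, Real.sqrt_mul_self (norm_nonneg _)]
  rw [h1, ← Adj.norm_φ hY]
  refine ContinuousLinearMap.opNorm_le_bound _ (by positivity) fun y => ?_
  have h2 : ‖Y.φ c y‖ = ‖X.tensorOp Y T (X.tmulL Y x y)‖ := by
    rw [Y.norm_eq, (X.tensor Y).norm_eq, tensorOp_tmulL, inner_tmulL, hc, map_mul, Y.inner_φ]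
    rfl
  rw [h2, mul_assoc]
  exact ((X.tensorOp Y T).le_opNorm _).trans
    (mul_le_mul_of_nonneg_left (X.norm_tmulL_le Y x y) (norm_nonneg _))

theorem isClosed_compacts (X : Correspondence.{u, v} A B) :
    IsClosed (X.compacts : Set (X.carrier →L[ℂ] X.carrier)) :=
  Submodule.isClosed_topologicalClosure _

theorem theta_mem_compacts (x y : X.carrier) : X.theta x y ∈ X.compacts :=
  Submodule.le_topologicalClosure _ (Submodule.subset_span ⟨x, y, rfl⟩)

variable {X Y} in
theorem compacts_le {S : Submodule ℂ (X.carrier →L[ℂ] X.carrier)}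
    (hS : IsClosed (S : Set (X.carrier →L[ℂ] X.carrier))) (h : ∀ x y, X.theta x y ∈ S) :
    X.compacts ≤ S :=
  Submodule.topologicalClosure_minimal _
    (Submodule.span_le.mpr (by rintro _ ⟨x, y, rfl⟩; exact h x y)) hS

variable {X Y} in
theorem tmulL_comp_annihilate_mem {K : Y.carrier →L[ℂ] Y.carrier} (hK : K ∈ Y.compacts)
    (x x' : X.carrier) :
    (X.tmulL Y x).comp (K.comp (X.annihilate Y x')) ∈ (X.tensor Y).compacts := by
  let F : (Y.carrier →L[ℂ] Y.carrier) →ₗ[ℂ] (X.tensor Y).carrier →L[ℂ] (X.tensor Y).carrier :=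
    { toFun K := (X.tmulL Y x).comp (K.comp (X.annihilate Y x'))
      map_add' _ _ := by ext; simp
      map_smul' _ _ := by ext; simp }
  have hF : Continuous F := by
    change Continuous fun K : Y.carrier →L[ℂ] Y.carrier =>
      (X.tmulL Y x).comp (K.comp (X.annihilate Y x'))
    fun_prop
  refine compacts_le (S := (X.tensor Y).compacts.comap F)
    ((X.tensor Y).isClosed_compacts.preimage hF) (fun y y' => ?_) hK
  change (X.tmulL Y x).comp ((Y.theta y y').comp (X.annihilate Y x')) ∈ (X.tensor Y).compacts
  rw [tmulL_theta_annihilate]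
  exact theta_mem_compacts _ _ _

variable {X Y} in
theorem annihilate_comp_tmulL_mem {K : (X.tensor Y).carrier →L[ℂ] (X.tensor Y).carrier}
    (hK : K ∈ (X.tensor Y).compacts) (x x' : X.carrier) :
    (X.annihilate Y x).comp (K.comp (X.tmulL Y x')) ∈ Y.compacts := by
  let F : ((X.tensor Y).carrier →L[ℂ] (X.tensor Y).carrier) →ₗ[ℂ] Y.carrier →L[ℂ] Y.carrier :=
    { toFun K := (X.annihilate Y x).comp (K.comp (X.tmulL Y x'))
      map_add' _ _ := by ext; simp
      map_smul' _ _ := by ext; simp }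
  have hF : Continuous F := by
    change Continuous fun K : (X.tensor Y).carrier →L[ℂ] (X.tensor Y).carrier =>
      (X.annihilate Y x).comp (K.comp (X.tmulL Y x'))
    fun_prop
  refine compacts_le (S := Y.compacts.comap F)
    (Y.isClosed_compacts.preimage hF) (fun z w => ?_) hK
  change (X.annihilate Y x).comp (((X.tensor Y).theta z w).comp (X.tmulL Y x')) ∈ Y.compacts
  rw [annihilate_theta_tmulL]
  exact theta_mem_compacts _ _ _

/-- For a bounded family of operators, strong convergence to the identity passes to limits. -/
theorem isClosed_setOf_tendsto {ι E : Type*} [NormedAddCommGroup E] [NormedSpace ℂ E]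
    {l : Filter ι} {F : ι → E →L[ℂ] E} (hF : ∀ᶠ i in l, ‖F i‖ ≤ 1) :
    IsClosed {z | Filter.Tendsto (fun i => F i z) l (nhds z)} := by
  refine isClosed_of_closure_subset fun z hz => ?_
  change Filter.Tendsto _ _ _
  rw [Metric.tendsto_nhds]
  intro ε hε
  obtain ⟨w, hw, hzw⟩ := Metric.mem_closure_iff.mp hz (ε / 3) (by positivity)
  filter_upwards [hF, Metric.tendsto_nhds.mp hw (ε / 3) (by positivity)] with i h1 h2
  rw [dist_eq_norm] at *
  have h3 : F i z - z = F i (z - w) + (F i w - w) + (w - z) := by rw [map_sub]; abel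
  have h4 : ‖F i (z - w)‖ ≤ ‖z - w‖ :=
    ((F i).le_opNorm _).trans (mul_le_of_le_one_left (norm_nonneg _) h1)
  rw [h3]
  refine (norm_add₃_le).trans_lt ?_
  rw [norm_sub_rev w z]
  linarith

/-- The vectors fixed in the limit by a bounded family of operators. -/
def limitFixed {ι E : Type*} [NormedAddCommGroup E] [NormedSpace ℂ E] (l : Filter ι)
    (F : ι → E →L[ℂ] E) : Submodule ℂ E where
  carrier := {z | Filter.Tendsto (fun i => F i z) l (nhds z)}
  add_mem' hx hy := by simpa using Filter.Tendsto.add hx hy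
  zero_mem' := by simpa using! tendsto_const_nhds
  smul_mem' c x hx := by simpa using Filter.Tendsto.const_smul hx c

/-- If `Y` is faithful and `T ⊗ 1` is compact, then `T` is compact. -/
theorem mem_compacts_of_tensorOp (hY : Y.IsInjective) {T : X.Adj}
    (hT : X.tensorOp Y T ∈ (X.tensor Y).compacts) : T ∈ Adj.compacts X := by
  -- An approximate unit `e` of the compacts of `X` tends strongly to the identity on `X`, hence `e
  -- ⊗ 1` does so on `X ⊗ Y`. Multiplied with a compact operator this becomes norm convergence, so
  -- `(e T) ⊗ 1 → T ⊗ 1`. Since `T ↦ T ⊗ 1` is isometric, `e T → T`, and each `e T` is compact.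
  obtain ⟨l, hne, hb, hl⟩ := (Adj.isClosedIdeal_compacts X).exists_approx_unit_filter
  have hb1 : ∀ᶠ e : X.Adj in l, ‖e.op‖ ≤ 1 := hb.mono fun e he => he.2
  have hb2 : ∀ᶠ e in l, ‖X.tensorOp Y e‖ ≤ 1 :=
    hb.mono fun e he => (X.norm_tensorOp_le Y e).trans he.2
  have h1 : ∀ x, Filter.Tendsto (fun e : X.Adj => e.op x) l (nhds x) := fun x => by
    refine X.mem_of_rsmul_inner_mem (S := limitFixed l Adj.op) (isClosed_setOf_tendsto hb1)
      (fun x y z => ?_) x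
    have hc : Continuous fun T : X.Adj => T.op z := by
      have := (Adj.opL X).continuous
      change Continuous fun T : X.Adj => Adj.opL X T z
      fun_prop
    exact (hc.tendsto _).comp (hl _ (Adj.theta_mem x y))
  have h2 : ∀ z, Filter.Tendsto (fun e => X.tensorOp Y e z) l (nhds z) := fun z => by
    refine tensor_mem (S := limitFixed l (X.tensorOp Y)) (isClosed_setOf_tendsto hb2)
      (fun x y => ?_) z
    change Filter.Tendsto (fun e => X.tensorOp Y e (X.tmulL Y x y)) l (nhds _)
    simp only [tensorOp_tmulL]
    exact (((X.tmulL Y).flip y).continuous.tendsto _).comp (h1 x)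
  let G : X.Adj → ((X.tensor Y).carrier →L[ℂ] (X.tensor Y).carrier) →L[ℂ]
      ((X.tensor Y).carrier →L[ℂ] (X.tensor Y).carrier) :=
    fun e => ContinuousLinearMap.mul ℂ _ (X.tensorOp Y e)
  have hG : ∀ᶠ e in l, ‖G e‖ ≤ 1 :=
    hb2.mono fun e he => (ContinuousLinearMap.opNorm_mul_apply_le ℂ _ _).trans he
  have h3 : Filter.Tendsto (fun e => G e (X.tensorOp Y T)) l (nhds (X.tensorOp Y T)) := by
    refine compacts_le (S := limitFixed l G) (isClosed_setOf_tendsto hG) (fun z w => ?_) hT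
    have h4 : ∀ e, G e ((X.tensor Y).theta z w) = (X.tensor Y).theta (X.tensorOp Y e z) w := by
      intro e
      ext y
      exact X.tensorOp_rsmul Y e z _
    change Filter.Tendsto (fun e => G e ((X.tensor Y).theta z w)) l (nhds _)
    simp only [h4]
    exact (((X.tensor Y).thetaL w).continuous.tendsto _).comp (h2 z)
  have h5 : Filter.Tendsto (fun e => e * T) l (nhds T) := by
    rw [tendsto_iff_norm_sub_tendsto_zero] at h3 ⊢
    refine squeeze_zero (fun _ => norm_nonneg _) (fun e => ?_) h3
    refine (X.norm_le_norm_tensorOp Y hY _).trans (le_of_eq ?_)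
    rw [← tensorOpL_apply, map_sub, tensorOpL_apply, tensorOp_mul]
    rfl
  refine (Adj.isClosed_compacts X).mem_of_tendsto h5 (hb.mono fun e he => ?_)
  exact (Adj.isClosedIdeal_compacts X).mul_right _ _ he.1

end TensorOperators

end Correspondence
end CStarCorr

namespace CStarCorr
open scoped TensorProduct
open scoped CStarAlgebra

namespace Correspondence

/-! ### The functor `cpull` -/

section CompactPull

variable {A B C : Type u} [NonUnitalCStarAlgebra A] [NonUnitalCStarAlgebra B]
  [NonUnitalCStarAlgebra C]

/-- The elements `a` acting by compact operators with `⟨X, a X⟩ ⊆ J`. -/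
noncomputable def cpull (X : Correspondence.{u, v} A B) (J : Submodule ℂ B) : Submodule ℂ A :=
  X.pull J ⊓ X.compacts.comap X.lsmulL.toLinearMap

theorem mem_cpull {X : Correspondence.{u, v} A B} {J : Submodule ℂ B} {a : A} :
    a ∈ X.cpull J ↔ a ∈ X.pull J ∧ X.φ a ∈ X.compacts := Iff.rfl

theorem cpull_mono (X : Correspondence.{u, v} A B) {J K : Submodule ℂ B} (h : J ≤ K) :
    X.cpull J ≤ X.cpull K := inf_le_inf_right _ (X.pull_mono h)

theorem φ_mem_compacts {X : Correspondence.{u, v} A B} {a : A} :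
    X.φ a ∈ X.compacts ↔ Adj.φ X a ∈ Adj.compacts X :=
  Adj.op_mem_compacts (T := Adj.φ X a)

theorem isClosedIdeal_cpull (X : Correspondence.{u, v} A B) {J : Submodule ℂ B}
    (hJ : IsClosedIdeal J) : IsClosedIdeal (X.cpull J) where
  isClosed := (X.isClosedIdeal_pull hJ).isClosed.inter
    (X.isClosed_compacts.preimage X.lsmulL.continuous)
  mul_left a j hj := by
    refine mem_cpull.mpr ⟨(X.isClosedIdeal_pull hJ).mul_left _ _ hj.1, ?_⟩
    rw [φ_mem_compacts, map_mul]
    exact (Adj.isClosedIdeal_compacts X).mul_left _ _ (φ_mem_compacts.mp hj.2)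
  mul_right a j hj := by
    refine mem_cpull.mpr ⟨(X.isClosedIdeal_pull hJ).mul_right _ _ hj.1, ?_⟩
    rw [φ_mem_compacts, map_mul]
    exact (Adj.isClosedIdeal_compacts X).mul_right _ _ (φ_mem_compacts.mp hj.2)
  star_mem j hj := by
    refine mem_cpull.mpr ⟨(X.isClosedIdeal_pull hJ).star_mem _ hj.1, ?_⟩
    rw [φ_mem_compacts, map_star]
    exact (Adj.isClosedIdeal_compacts X).star_mem _ (φ_mem_compacts.mp hj.2)

theorem cpull_top {X : Correspondence.{u, v} A B} : X.cpull ⊤ = ⊤ ↔ X.IsProper := by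
  rw [eq_top_iff]
  exact ⟨fun h a => (h (Submodule.mem_top (x := a))).2,
    fun h a _ => ⟨fun _ _ => Submodule.mem_top, h a⟩⟩

/-- Compressing the action of `a` by creation and annihilation operators gives the action of `⟨x, a
x'⟩` on `Y`, which is thus compact. Compactness on `X` itself comes from `mem_compacts_of_tensorOp`,
the only place where faithfulness of `Y` enters. -/
theorem cpull_le_cpull_cpull {X : Correspondence.{u, v} A B} {Y : Correspondence.{u, v} B C}
    (hY : Y.IsInjective) {J : Submodule ℂ C} (hJ : IsClosed (J : Set C)) :
    (X.tensor Y).cpull J ≤ X.cpull (Y.cpull J) := by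
  intro a ha
  rw [mem_cpull, pull_tensor _ _ hJ] at ha
  refine mem_cpull.mpr ⟨fun x x' => mem_cpull.mpr ⟨ha.1 x x', ?_⟩, ?_⟩
  · convert annihilate_comp_tmulL_mem ha.2 x x' using 1
    ext y
    simp
  · rw [φ_mem_compacts]
    refine mem_compacts_of_tensorOp X Y hY ?_
    rw [tensorOp_φ]
    exact ha.2

/-- Compactness of `a` on `X` does not suffice by itself, since `θ ⊗ 1` need not be compact.
Sandwiched between rank-one operators, however, `a` contributes only coefficients `⟨y, a x'⟩`, which
act compactly on `Y`. Elements of the ideal are limits of such sandwiches `e a f`. -/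
theorem cpull_cpull_le {X : Correspondence.{u, v} A B} {Y : Correspondence.{u, v} B C}
    {J : Submodule ℂ C} (hJ : IsClosedIdeal J) :
    X.cpull (Y.cpull J) ≤ (X.tensor Y).cpull J := by
  have hI := X.isClosedIdeal_cpull (Y.isClosedIdeal_cpull hJ)
  intro a ha
  refine mem_cpull.mpr ⟨?_, ?_⟩
  · rw [pull_tensor _ _ hJ.isClosed]
    exact fun x y => (ha.1 x y).1
  refine closure_minimal (t := (X.tensor Y).φ ⁻¹' (X.tensor Y).compacts) ?_
    ((X.tensor Y).isClosed_compacts.preimage (X.tensor Y).continuous_φ) (hI.mem_closure_mul ha)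
  rintro _ ⟨e, he, f, hf, rfl⟩
  -- `e` and `f` are approximated by finite rank operators
  have key : ∀ S ∈ Adj.compacts X, ∀ T ∈ Adj.compacts X,
      X.tensorOp Y (S * Adj.φ X a * T) ∈ (X.tensor Y).compacts := by
    intro S hS T hT
    have hc1 : Continuous fun S : X.Adj => X.tensorOpL Y (S * Adj.φ X a * T) := by fun_prop
    refine Adj.compacts_le (S := (X.tensor Y).compacts.comap
      ((X.tensorOpL Y).toLinearMap ∘ₗ LinearMap.mulRight ℂ T ∘ₗ LinearMap.mulRight ℂ (Adj.φ X a)))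
      ((X.tensor Y).isClosed_compacts.preimage hc1) (fun x y => ?_) hS
    have hc2 : Continuous fun T : X.Adj => X.tensorOpL Y (Adj.theta x y * Adj.φ X a * T) := by
      fun_prop
    refine Adj.compacts_le (S := (X.tensor Y).compacts.comap
      ((X.tensorOpL Y).toLinearMap ∘ₗ LinearMap.mulLeft ℂ (Adj.theta x y * Adj.φ X a)))
      ((X.tensor Y).isClosed_compacts.preimage hc2) (fun x' y' => ?_) hT
    change X.tensorOp Y (Adj.theta x y * Adj.φ X a * Adj.theta x' y') ∈ (X.tensor Y).compacts
    -- The operator `(θ x y) a (θ x' y') ⊗ 1` annihilates with `y'`, applies `⟨y, a x'⟩` on `Y`, and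
    -- creates with `x`.
    convert tmulL_comp_annihilate_mem (ha.1 y x').2 x y' using 1
    refine tensor_clm_ext fun u w => ?_
    simp [theta_apply, φ_rsmul, X.mod.inner_rsmul, X.mod.rsmul_mul, tmulL_rsmul]
  have := key _ (φ_mem_compacts.mp he.2) _ (φ_mem_compacts.mp hf.2)
  rw [← map_mul, ← map_mul, tensorOp_φ] at this
  exact this

theorem Iso.φ_mem_compacts {X Y : Correspondence.{u, v} A B} (h : X.Iso Y) {a : A}
    (ha : X.φ a ∈ X.compacts) : Y.φ a ∈ Y.compacts := by
  obtain ⟨U, hs, hl, hr, hi⟩ := h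
  have hn : ∀ x, ‖U x‖ = ‖x‖ := fun x => by rw [X.norm_eq, Y.norm_eq, hi]
  let V : X.carrier ≃ₗᵢ[ℂ] Y.carrier := LinearIsometryEquiv.ofSurjective ⟨U, hn⟩ hs
  have hV : ∀ x, V x = U x := fun _ => rfl
  let V₁ : X.carrier →L[ℂ] Y.carrier := V.toContinuousLinearEquiv
  let V₂ : Y.carrier →L[ℂ] X.carrier := V.symm.toContinuousLinearEquiv
  have h1 : ∀ x, V₂ (U x) = x := V.symm_apply_apply
  let F : (X.carrier →L[ℂ] X.carrier) →ₗ[ℂ] Y.carrier →L[ℂ] Y.carrier :=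
    { toFun K := V₁.comp (K.comp V₂)
      map_add' _ _ := by ext; simp
      map_smul' _ _ := by ext; simp }
  have hF : Continuous F := by
    change Continuous fun K : X.carrier →L[ℂ] X.carrier => V₁.comp (K.comp V₂)
    fun_prop
  have hF' : ∀ K x, F K (U x) = U (K x) := fun K x => by
    change U (K (V₂ (U x))) = _
    rw [h1]
  have : F (X.φ a) ∈ Y.compacts := by
    refine compacts_le (S := Y.compacts.comap F) (Y.isClosed_compacts.preimage hF)
      (fun x y => ?_) ha
    have : F (X.theta x y) = Y.theta (U x) (U y) := by
      ext z
      obtain ⟨z, rfl⟩ := hs z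
      rw [hF', theta_apply, theta_apply, hr, hi]
    change F (X.theta x y) ∈ Y.compacts
    rw [this]
    exact theta_mem_compacts _ _ _
  convert this using 1
  ext z
  obtain ⟨z, rfl⟩ := hs z
  rw [hF', hl]

theorem Iso.cpull_eq {X Y : Correspondence.{u, v} A B} (h : X.Iso Y) (J : Submodule ℂ B) :
    X.cpull J = Y.cpull J := by
  ext a
  rw [mem_cpull, mem_cpull, h.pull_eq]
  exact and_congr_right fun _ => ⟨h.φ_mem_compacts, h.symm.φ_mem_compacts⟩

end CompactPull

/-! ### Injectivity, properness and fullness of restrictions -/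

section Restriction

variable {A B A' B' : Type u} [NonUnitalCStarAlgebra A] [NonUnitalCStarAlgebra B]
  [NonUnitalCStarAlgebra A'] [NonUnitalCStarAlgebra B'] {i : A' →⋆ₙₐ[ℂ] A} {j : B' →⋆ₙₐ[ℂ] B}
  {X' : Correspondence.{u, v} A' B'} {X : Correspondence.{u, v} A B}

/-- Since `i(a*) X` lies in the image of `X'`, an element `a` killing `X'` makes `i(a a*)` kill `X`,
so `a a* = 0`. -/
theorem ITransfer.isInjective (hi : Function.Injective i) (h : ITransfer i j X' X)
    (hX : X.IsInjective) : X'.IsInjective := by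
  obtain ⟨s, hs, hl, hr⟩ := h
  refine (injective_iff_map_eq_zero _).mpr fun a ha => ?_
  have h1 : X.φ (i (a * star a)) = 0 := by
    ext x
    obtain ⟨y, hy⟩ := hr (star a) x
    rw [map_mul, map_mul]
    change X.φ (i a) (X.φ (i (star a)) x) = 0
    rw [← hy, ← hl, ha]
    simp
  have h2 : a * star a = 0 := hi (hX (by rw [h1]; simp))
  exact (CStarRing.mul_star_self_eq_zero_iff a).mp h2

/-- For a rank-one operator on `X`, `i(e) (θ x y) i(f)` is `θ` of `i(e) x` and `i(f*) y`, both in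
the image of `X'`. So `e a f` acts compactly on `X'`, and such products are dense. -/
theorem ITransfer.isProper (hj : Function.Injective j) (h : ITransfer i j X' X)
    (hX : ∀ a, X.φ (i a) ∈ X.compacts) : X'.IsProper := by
  obtain ⟨s, hs, hl, hr⟩ := h
  have hn := norm_of_inner_eq hj hs
  have hinj : Function.Injective s := (AddMonoidHomClass.isometry_of_norm s hn).injective
  -- Composition with the isometry `s` allows operators on `X'` and cut-down operators on `X` to be
  -- compared in one space, where the compacts of `X'` have closed image.
  let Ψ : (X'.carrier →L[ℂ] X'.carrier) →ₗᵢ[ℂ] X'.carrier →L[ℂ] X.carrier :=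
    { toFun K := s.comp K
      map_add' _ _ := by ext; simp
      map_smul' _ _ := by ext; simp
      norm_map' K := by
        refine le_antisymm (ContinuousLinearMap.opNorm_le_bound _ (norm_nonneg _) fun x => ?_)
          (ContinuousLinearMap.opNorm_le_bound _ (norm_nonneg _) fun x => ?_)
        · change ‖s (K x)‖ ≤ _
          rw [hn]
          exact K.le_opNorm x
        · rw [← hn]
          exact (s.comp K).le_opNorm x }
  intro a
  refine closure_minimal (t := X'.φ ⁻¹' X'.compacts) ?_
    (X'.isClosed_compacts.preimage X'.continuous_φ)
    (isClosedIdeal_top.mem_closure_mul (Submodule.mem_top (x := a)))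
  rintro _ ⟨e, -, f, -, rfl⟩
  let F : (X.carrier →L[ℂ] X.carrier) →ₗ[ℂ] X'.carrier →L[ℂ] X.carrier :=
    { toFun K := (X.φ (i e)).comp (K.comp ((X.φ (i f)).comp s))
      map_add' _ _ := by ext; simp
      map_smul' _ _ := by ext; simp }
  have hF : Continuous F := by
    change Continuous fun K : X.carrier →L[ℂ] X.carrier =>
      (X.φ (i e)).comp (K.comp ((X.φ (i f)).comp s))
    fun_prop
  have hcl : IsClosed (X'.compacts.map Ψ.toLinearMap : Set (X'.carrier →L[ℂ] X.carrier)) :=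
    Ψ.isometry.isClosedEmbedding.isClosedMap _ X'.isClosed_compacts
  obtain ⟨K, hK, hKe⟩ := compacts_le (S := (X'.compacts.map Ψ.toLinearMap).comap F)
    (hcl.preimage hF) (fun x y => by
      obtain ⟨u, hu⟩ := hr e x
      obtain ⟨w, hw⟩ := hr (star f) y
      refine ⟨X'.theta u w, theta_mem_compacts _ _ _, ?_⟩
      ext z
      change s (X'.mod.rsmul u (X'.mod.inner w z))
        = X.φ (i e) (X.mod.rsmul x (X.mod.inner y (X.φ (i f) (s z))))
      rw [map_rsmul_of_inner_eq hs, ← hs, φ_rsmul, hu, hw, X.inner_φ, map_star i, star_star])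
    (hX a)
  change X'.φ (e * a * f) ∈ X'.compacts
  have hK' : K = X'.φ (e * a * f) := by
    ext x
    refine hinj ?_
    have := DFunLike.congr_fun hKe x
    change s (K x) = X.φ (i e) (X.φ (i a) (X.φ (i f) (s x))) at this
    rw [this, hl]
    simp
  exact hK' ▸ hK

/-- A coefficient `⟨x, i(e a f) y⟩` is the inner product of `i(e*) x` and `i(a f) y`, both in the
image of `X'`. -/
theorem ITransfer.isFull (hj : Function.Injective j) (h : ITransfer i j X' X)
    {I : Submodule ℂ A} (hI : ∀ a, a ∈ I ↔ ∃ d, i d = a)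
    (hX : ∀ b, j b ∈ X.push I) : X'.IsFull := by
  obtain ⟨s, hs, hl, hr⟩ := h
  let jl : B' →ₗ[ℂ] B := { toFun := j, map_add' := map_add j, map_smul' := map_smul j }
  set T := (Submodule.span ℂ {b | ∃ ξ η, X'.mod.inner ξ η = b}).topologicalClosure
  have hT : IsClosed (T.map jl : Set B) :=
    (NonUnitalStarAlgHom.isometry j hj).isClosedEmbedding.isClosedMap _
      (Submodule.isClosed_topologicalClosure _)
  have hle : X.push I ≤ T.map jl := by
    refine push_le hT fun a ha x y => ?_
    obtain ⟨a, rfl⟩ := (hI a).mp ha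
    have hi : Continuous i := map_continuous i
    have hc : Continuous fun a => X.mod.inner x (X.φ (i a) y) :=
      ((X.innerL x).comp (X.lsmulL.flip y)).continuous.comp hi
    refine closure_minimal (t := (fun a => X.mod.inner x (X.φ (i a) y)) ⁻¹' (T.map jl)) ?_
      (hT.preimage hc) (isClosedIdeal_top.mem_closure_mul (Submodule.mem_top (x := a)))
    rintro _ ⟨e, -, f, -, rfl⟩
    obtain ⟨u, hu⟩ := hr (star e) x
    obtain ⟨w, hw⟩ := hr (a * f) y
    refine ⟨X'.mod.inner u w,
      Submodule.le_topologicalClosure _ (Submodule.subset_span ⟨_, _, rfl⟩), ?_⟩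
    change j _ = X.mod.inner x (X.φ (i (e * a * f)) y)
    rw [← hs, hu, hw, X.inner_φ, map_star i, star_star, mul_assoc, map_mul i e, map_mul X.φ (i e)]
    rfl
  refine eq_top_iff.mpr fun b _ => ?_
  obtain ⟨b', hb', h⟩ := hle (hX b)
  rwa [← hj h]

end Restriction

end Correspondence
end CStarCorr

namespace CStarCorr
open scoped TensorProduct
open scoped CStarAlgebra
open Correspondence

/-! ### One elementary shift: compatible ideals and the passage of extremality -/

section Pairs

variable {A C A' C' : Type u} [NonUnitalCStarAlgebra A] [NonUnitalCStarAlgebra C]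
  [NonUnitalCStarAlgebra A'] [NonUnitalCStarAlgebra C']
  {R : Correspondence.{u, v} A C} {S : Correspondence.{u, v} C A}

/-- A pair of correspondences passes to compatible quotients of the coefficient algebras. -/
theorem exists_quotient_pair {q : A →⋆ₙₐ[ℂ] A'} {c : C →⋆ₙₐ[ℂ] C'} (hq : Function.Surjective q)
    (hc : Function.Surjective c) {J : Submodule ℂ A} (hqJ : ∀ a, q a = 0 ↔ a ∈ J)
    (hcJ : ∀ a, c a = 0 ↔ a ∈ S.pull J) (hR : R.pull (S.pull J) = J) :
    ∃ (R' : Correspondence.{u, v} A' C') (S' : Correspondence.{u, v} C' A'),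
      QTransfer q c R R' ∧ QTransfer c q S S' ∧ R'.IsInjective ∧ S'.IsInjective := by
  -- In `hR`, the inclusion of `J` makes the left action on the quotient of `R` well defined; the
  -- reverse inclusion makes it injective. For `S` both are the definition of `S.pull J`.
  obtain ⟨R', hR'⟩ := R.exists_quotient hq hc fun a x y ha => by
    rw [hqJ, ← hR] at ha
    exact (hcJ _).mpr (ha x y)
  obtain ⟨S', hS'⟩ := S.exists_quotient hc hq fun a x y ha => by
    rw [hcJ] at ha
    exact (hqJ _).mpr (ha x y)
  refine ⟨R', S', hR', hS', hR'.isInjective hq fun a ha => ?_, hS'.isInjective hc fun a ha => ?_⟩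
  · rw [hqJ, ← hR]
    exact fun x y => (hcJ _).mp (ha x y)
  · rw [hcJ]
    exact fun x y => (hqJ _).mp (ha x y)

/-- If `K` satisfies `S.pull (R.pull K) ≤ K`, applying `R.pull` shows that `R.pull K` is a
competitor for `R ⊗ S`. Hence `J ≤ R.pull K`, and `S.pull` brings this back to `K`. -/
theorem pull_le_of_forall_le {J : Submodule ℂ A}
    (hN : ∀ K, IsClosedIdeal K → (R.tensor S).pull K ≤ K → J ≤ K) (K : Submodule ℂ C)
    (hK : IsClosedIdeal K) (h : (S.tensor R).pull K ≤ K) : S.pull J ≤ K := by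
  rw [pull_tensor _ _ hK.isClosed] at h
  have hK' := R.isClosedIdeal_pull hK
  refine (S.pull_mono (hN _ hK' ?_)).trans h
  rw [pull_tensor _ _ hK'.isClosed]
  exact R.pull_mono h

/-- A pair of correspondences restricts to compatible ideals of the coefficient algebras. -/
theorem exists_restrict_pair {i : A' →⋆ₙₐ[ℂ] A} {k : C' →⋆ₙₐ[ℂ] C} (hi : Function.Injective i)
    (hk : Function.Injective k) {I : Submodule ℂ A} {K : Submodule ℂ C}
    (hI : ∀ a, a ∈ I ↔ ∃ d, i d = a) (hK : ∀ a, a ∈ K ↔ ∃ d, k d = a)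
    (hR : I ≤ R.pull K) (hS : K ≤ S.pull I) :
    ∃ (R' : Correspondence.{u, v} A' C') (S' : Correspondence.{u, v} C' A'),
      ITransfer i k R' R ∧ ITransfer k i S' S := by
  obtain ⟨R', hR'⟩ := exists_restrict i k R hk fun a x y =>
    (hK _).mp (hR ((hI _).mpr ⟨a, rfl⟩) x y)
  obtain ⟨S', hS'⟩ := exists_restrict k i S hi fun a x y =>
    (hI _).mp (hS ((hK _).mpr ⟨a, rfl⟩) x y)
  exact ⟨R', S', hR', hS'⟩

/-- The order-dual of `pull_le_of_forall_le`. Faithfulness of `R` splits the `cpull` of `S ⊗ R`;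
reassembling that of `R ⊗ S` needs no faithfulness. -/
theorem le_cpull_of_forall_le (hRi : R.IsInjective) {I : Submodule ℂ A}
    (hN : ∀ K, IsClosedIdeal K → K ≤ (R.tensor S).cpull K → K ≤ I) (K : Submodule ℂ C)
    (hK : IsClosedIdeal K) (h : K ≤ (S.tensor R).cpull K) : K ≤ S.cpull I := by
  have h1 := h.trans (cpull_le_cpull_cpull hRi hK.isClosed)
  have hK' := R.isClosedIdeal_cpull hK
  refine h1.trans (S.cpull_mono (hN _ hK' ?_))
  exact (R.cpull_mono h1).trans (cpull_cpull_le hK')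

/-- As `push` is covariant, `R` now carries the ideal forward and `S` produces the competitor. -/
theorem le_push_of_forall_le {I : Submodule ℂ A}
    (hN : ∀ K, IsClosedIdeal K → K ≤ (R.tensor S).push K → K ≤ I) (K : Submodule ℂ C)
    (hK : IsClosedIdeal K) (h : K ≤ (S.tensor R).push K) : K ≤ R.push I := by
  rw [push_tensor] at h
  refine h.trans (R.push_mono (hN _ (S.isClosedIdeal_push hK) ?_))
  rw [push_tensor]
  exact S.push_mono h

end Pairs

/-! ### The three passes along the chain -/

namespace ShiftChain

/-- All correspondences of the chain have the property `P`. -/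
def Forall (P : (A B : Type u) → [NonUnitalCStarAlgebra A] → [NonUnitalCStarAlgebra B] →
      Correspondence.{u, v} A B → Prop) :
    {A B : Type u} → [NonUnitalCStarAlgebra A] → [NonUnitalCStarAlgebra B] → {m : ℕ} →
      ShiftChain.{u, v} A B m → Prop
  | _, _, _, _, _, single R S => P _ _ R ∧ P _ _ S
  | _, _, _, _, _, cons R S p => P _ _ R ∧ P _ _ S ∧ p.Forall P

section

variable {P : (A B : Type u) → [NonUnitalCStarAlgebra A] → [NonUnitalCStarAlgebra B] →
      Correspondence.{u, v} A B → Prop}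

theorem Forall.first {A B : Type u} [NonUnitalCStarAlgebra A] [NonUnitalCStarAlgebra B] {m : ℕ}
    {p : ShiftChain.{u, v} A B m} (h : p.Forall P)
    (hP : ∀ {A B C : Type u} [NonUnitalCStarAlgebra A] [NonUnitalCStarAlgebra B]
      [NonUnitalCStarAlgebra C] {X : Correspondence.{u, v} A B} {Y : Correspondence.{u, v} B C},
      P A B X → P B C Y → P A C (X.tensor Y)) :
    P A A p.first := by
  cases p with
  | single R S => exact hP h.1 h.2
  | cons R S p => exact hP h.1 h.2.1

theorem Forall.intermediate {A B : Type u} [NonUnitalCStarAlgebra A] [NonUnitalCStarAlgebra B]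
    {m : ℕ} {p : ShiftChain.{u, v} A B m} (h : p.Forall P)
    (hP : ∀ {A B C : Type u} [NonUnitalCStarAlgebra A] [NonUnitalCStarAlgebra B]
      [NonUnitalCStarAlgebra C] {X : Correspondence.{u, v} A B} {Y : Correspondence.{u, v} B C},
      P A B X → P B C Y → P A C (X.tensor Y)) :
    p.Intermediate fun C _ Z => P C C Z := by
  induction p with
  | single R S => trivial
  | cons R S p ih => exact ⟨hP h.2.1 h.1, h.2.2.first hP, ih h.2.2⟩

end

/-- Passing to quotients of the intermediate algebras makes all correspondences of a chain
faithful. -/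
theorem exists_injective {A B A' : Type u} [NonUnitalCStarAlgebra A] [NonUnitalCStarAlgebra B]
    [NonUnitalCStarAlgebra A'] {m : ℕ} (p : ShiftChain.{u, v} A B m) (hlink : p.Linked)
    (hlast : p.last.IsInjective) {q : A →⋆ₙₐ[ℂ] A'} (hq : Function.Surjective q)
    {J : Submodule ℂ A} (hJ : IsClosedIdeal J) (hqJ : ∀ a, q a = 0 ↔ a ∈ J)
    (hinv : p.first.pull J = J) (hN : ∀ K, IsClosedIdeal K → p.first.pull K ≤ K → J ≤ K) :
    ∃ p' : ShiftChain.{u, v} A' B m, p'.Linked ∧ QTransfer q q p.first p'.first ∧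
      p.last.Iso p'.last ∧ p'.Forall fun _ _ _ _ X => X.IsInjective := by
  -- When the tail is treated its left algebra has already been divided, so the quotient there must
  -- be arbitrary; only the right-hand algebra stays fixed.
  induction p generalizing A' with
  | @single A B _ _ R S =>
    -- The end of the chain: faithfulness of `S ⊗ R` makes `⊥` a competitor, so leastness forces the
    -- transported ideal to vanish and `B` is not divided.
    have h0 : S.pull J = ⊥ := eq_bot_iff.mpr
      (pull_le_of_forall_le hN ⊥ isClosedIdeal_bot (pull_bot.mpr hlast).le)
    rw [first, pull_tensor _ _ hJ.isClosed] at hinv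
    obtain ⟨R', S', hR', hS', hRi, hSi⟩ := exists_quotient_pair
      (c := NonUnitalStarAlgHom.id ℂ B) hq Function.surjective_id hqJ (by simp [h0]) hinv
    exact ⟨single R' S', trivial, hR'.tensor hS', (hS'.tensor hR').iso, hRi, hSi⟩
  | cons R S p ih =>
    have hJ' := S.isClosedIdeal_pull hJ
    rw [first, pull_tensor _ _ hJ.isClosed] at hinv
    obtain ⟨C', _, c, hc, hcJ⟩ := hJ'.exists_quotient
    obtain ⟨R', S', hR', hS', hRi, hSi⟩ := exists_quotient_pair hq hc hqJ hcJ hinv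
    obtain ⟨p', h1, h2, h3, h4⟩ := ih hlink.2 hlast hc hJ' hcJ
      (by rw [← hlink.1.pull_eq, pull_tensor _ _ hJ'.isClosed, hinv])
      (fun K hK h => pull_le_of_forall_le hN K hK (by rwa [hlink.1.pull_eq]))
    -- The new link compares quotients of two isomorphic correspondences along the same map `c`.
    exact ⟨cons R' S' p', ⟨(hS'.tensor hR').unique hc h2 hlink.1, h1⟩, hR'.tensor hS', h3,
      hRi, hSi, h4⟩

/-- Restricting a chain of faithful correspondences to ideals of the intermediate algebras makes
all of them regular. -/
theorem exists_regular {A B A' : Type u} [NonUnitalCStarAlgebra A] [NonUnitalCStarAlgebra B]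
    [NonUnitalCStarAlgebra A'] {m : ℕ} (p : ShiftChain.{u, v} A B m) (hlink : p.Linked)
    (hlast : p.last.IsProper) (hp : p.Forall fun _ _ _ _ X => X.IsInjective)
    {i : A' →⋆ₙₐ[ℂ] A} (hi : Function.Injective i)
    {I : Submodule ℂ A} (hI : IsClosedIdeal I) (hiI : ∀ a, a ∈ I ↔ ∃ d, i d = a)
    (hinv : I ≤ p.first.cpull I) (hN : ∀ K, IsClosedIdeal K → K ≤ p.first.cpull K → K ≤ I) :
    ∃ p' : ShiftChain.{u, v} A' B m, p'.Linked ∧ ITransfer i i p'.first p.first ∧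
      p'.last.Iso p.last ∧ p'.Forall fun _ _ _ _ X => X.IsRegular := by
  induction p generalizing A' with
  | @single A B _ _ R S =>
    -- Properness of the last composite makes `⊤` a competitor, so the algebra `B` is kept whole.
    have h0 : S.cpull I = ⊤ := eq_top_iff.mpr
      (le_cpull_of_forall_le hp.1 hN ⊤ isClosedIdeal_top (cpull_top.mpr hlast).ge)
    have hR := hinv.trans (cpull_le_cpull_cpull hp.2 hI.isClosed)
    have hj : Function.Injective (NonUnitalStarAlgHom.id ℂ B) := Function.injective_id
    obtain ⟨R', S', hR', hS'⟩ := exists_restrict_pair (k := NonUnitalStarAlgHom.id ℂ B)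
      hi hj hiI (by simp [h0]) (hR.trans inf_le_left) (inf_le_left (a := S.pull I))
    refine ⟨single R' S', trivial, hR'.tensor hi hS', (hS'.tensor hj hR').iso,
      ⟨hR'.isInjective hi hp.1, hR'.isProper hj fun a => (hR ((hiI _).mpr ⟨a, rfl⟩)).2⟩,
      ⟨hS'.isInjective hj hp.2, hS'.isProper hi fun a => ?_⟩⟩
    exact (h0.ge (Submodule.mem_top (x := a))).2
  | cons R S p ih =>
    have hI' := S.isClosedIdeal_cpull hI
    -- The inclusion `I ≤ R.cpull (S.cpull I)` serves three purposes: `R` restricts to the two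
    -- ideals, `I` acts compactly on `R`, and the next ideal is again invariant.
    have hR := hinv.trans (cpull_le_cpull_cpull hp.2.1 hI.isClosed)
    obtain ⟨C', _, c, hc, hcI⟩ := hI'.exists_inclusion
    obtain ⟨R', S', hR', hS'⟩ := exists_restrict_pair hi hc hiI hcI (hR.trans inf_le_left)
      (inf_le_left (a := S.pull I))
    obtain ⟨p', h1, h2, h3, h4⟩ := ih hlink.2 hlast hp.2.2 hc hI' hcI
      (by
        rw [← hlink.1.cpull_eq]
        exact (S.cpull_mono hR).trans (cpull_cpull_le hI'))
      (fun K hK h => le_cpull_of_forall_le hp.1 hN K hK (by rwa [hlink.1.cpull_eq]))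
    exact ⟨cons R' S' p', ⟨(hS'.tensor hc hR').unique hc h2 hlink.1, h1⟩, hR'.tensor hi hS', h3,
      ⟨hR'.isInjective hi hp.1, hR'.isProper hc fun a => (hR ((hiI _).mpr ⟨a, rfl⟩)).2⟩,
      ⟨hS'.isInjective hc hp.2.1, hS'.isProper hi fun a => ((hcI _).mpr ⟨a, rfl⟩).2⟩, h4⟩

/-- Restricting a chain of regular correspondences to ideals of the intermediate algebras makes
all of them full. -/
theorem exists_regular_full {A B A' : Type u} [NonUnitalCStarAlgebra A] [NonUnitalCStarAlgebra B]
    [NonUnitalCStarAlgebra A'] {m : ℕ} (p : ShiftChain.{u, v} A B m) (hlink : p.Linked)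
    (hlast : p.last.IsFull) (hp : p.Forall fun _ _ _ _ X => X.IsRegular)
    {i : A' →⋆ₙₐ[ℂ] A} (hi : Function.Injective i)
    {I : Submodule ℂ A} (hI : IsClosedIdeal I) (hiI : ∀ a, a ∈ I ↔ ∃ d, i d = a)
    (hinv : p.first.push I = I) (hN : ∀ K, IsClosedIdeal K → K ≤ p.first.push K → K ≤ I) :
    ∃ p' : ShiftChain.{u, v} A' B m, p'.Linked ∧ ITransfer i i p'.first p.first ∧
      p'.last.Iso p.last ∧ p'.Forall fun _ _ _ _ X => X.IsRegular ∧ X.IsFull := by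
  induction p generalizing A' with
  | @single A B _ _ R S =>
    -- Fullness of the last composite makes `⊤` a competitor, so again nothing is lost at `B`.
    have h0 : R.push I = ⊤ := eq_top_iff.mpr
      (le_push_of_forall_le hN ⊤ isClosedIdeal_top (push_top.mpr hlast).ge)
    have hj : Function.Injective (NonUnitalStarAlgHom.id ℂ B) := Function.injective_id
    rw [first, push_tensor] at hinv
    have hjI : ∀ b, b ∈ R.push I ↔ ∃ d, NonUnitalStarAlgHom.id ℂ B d = b := by simp [h0]
    obtain ⟨R', S', hR', hS'⟩ := exists_restrict_pair hi hj hiI hjI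
      (fun a ha => inner_mem_push ha) (fun c hc x y => hinv ▸ inner_mem_push hc x y)
    exact ⟨single R' S', trivial, hR'.tensor hi hS', (hS'.tensor hj hR').iso,
      ⟨⟨hR'.isInjective hi hp.1.1, hR'.isProper hj fun a => hp.1.2 _⟩,
        hR'.isFull hj hiI fun b => (hjI _).mpr ⟨b, rfl⟩⟩,
      ⟨⟨hS'.isInjective hj hp.2.1, hS'.isProper hi fun a => hp.2.2 _⟩,
        hS'.isFull hi hjI fun a => by rw [hinv]; exact (hiI _).mpr ⟨a, rfl⟩⟩⟩
  | cons R S p ih =>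
    have hI' := R.isClosedIdeal_push hI
    rw [first, push_tensor] at hinv
    obtain ⟨C', _, c, hc, hcI⟩ := hI'.exists_inclusion
    -- `R` maps `I` onto the next ideal by definition, and `S` maps that one back onto `I` by
    -- `hinv`; these equalities also give fullness of both restrictions.
    obtain ⟨R', S', hR', hS'⟩ := exists_restrict_pair hi hc hiI hcI
      (fun a ha => inner_mem_push ha) (fun c hc x y => hinv ▸ inner_mem_push hc x y)
    obtain ⟨p', h1, h2, h3, h4⟩ := ih hlink.2 hlast hp.2.2 hc hI' hcI
      (by rw [← hlink.1.push_eq, push_tensor, hinv])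
      (fun K hK h => le_push_of_forall_le hN K hK (by rwa [hlink.1.push_eq]))
    exact ⟨cons R' S' p', ⟨(hS'.tensor hc hR').unique hc h2 hlink.1, h1⟩, hR'.tensor hi hS', h3,
      ⟨⟨hR'.isInjective hi hp.1.1, hR'.isProper hc fun a => hp.1.2 _⟩,
        hR'.isFull hc hiI fun b => (hcI _).mpr ⟨b, rfl⟩⟩,
      ⟨⟨hS'.isInjective hc hp.2.1.1, hS'.isProper hi fun a => hp.2.1.2 _⟩,
        hS'.isFull hi hcI fun a => by rw [hinv]; exact (hiI _).mpr ⟨a, rfl⟩⟩, h4⟩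

end ShiftChain

/-! ### Stability under tensor products and isomorphism -/

namespace Correspondence

variable {A B C : Type u} [NonUnitalCStarAlgebra A] [NonUnitalCStarAlgebra B]
  [NonUnitalCStarAlgebra C] {X : Correspondence.{u, v} A B} {Y : Correspondence.{u, v} B C}

theorem IsRegular.tensor (hX : X.IsRegular) (hY : Y.IsRegular) : (X.tensor Y).IsRegular := by
  refine ⟨pull_bot.mp ?_, cpull_top.mp (eq_top_iff.mpr ?_)⟩
  · rw [pull_tensor _ _ isClosedIdeal_bot.isClosed, pull_bot.mpr hY.1, pull_bot.mpr hX.1]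
  · refine le_trans (le_of_eq ?_) (cpull_cpull_le isClosedIdeal_top)
    rw [cpull_top.mpr hY.2, cpull_top.mpr hX.2]

theorem IsFull.tensor (hX : X.IsFull) (hY : Y.IsFull) : (X.tensor Y).IsFull := by
  rw [← push_top, push_tensor, push_top.mpr hX, push_top.mpr hY]

theorem Iso.isRegular {X Y : Correspondence.{u, v} A B} (h : X.Iso Y) (hX : X.IsRegular) :
    Y.IsRegular :=
  ⟨pull_bot.mp (by rw [← h.pull_eq, pull_bot.mpr hX.1]),
    cpull_top.mp (by rw [← h.cpull_eq, cpull_top.mpr hX.2])⟩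

theorem Iso.isFull {X Y : Correspondence.{u, v} A B} (h : X.Iso Y) (hX : X.IsFull) : Y.IsFull :=
  push_top.mp (by rw [← h.push_eq, push_top.mpr hX])

end Correspondence

/-! ### Assembly of the passes -/

namespace ShiftChain

variable {A B : Type u} [NonUnitalCStarAlgebra A] [NonUnitalCStarAlgebra B]
  {X : Correspondence.{u, v} A A} {Y : Correspondence.{u, v} B B} {m : ℕ}

/-- A strong shift equivalence of regular correspondences can be implemented by regular ones. -/
theorem Implements.exists_regular {p : ShiftChain.{u, v} A B m} (h : p.Implements X Y)
    (hX : X.IsRegular) (hY : Y.IsRegular) :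
    ∃ p' : ShiftChain.{u, v} A B m, p'.Implements X Y ∧ p'.Forall fun _ _ _ _ Z => Z.IsRegular := by
  obtain ⟨hf, hlink, hl⟩ := h
  -- The pass starts with the zero ideal of `A`, trivially least and invariant because `X` is
  -- faithful; with the identity as quotient map, the first composite changes only by an
  -- isomorphism.
  obtain ⟨p₁, h1, h2, h3, h4⟩ := p.exists_injective hlink (hl.symm.isRegular hY).1
    (q := NonUnitalStarAlgHom.id ℂ A) Function.surjective_id isClosedIdeal_bot (by simp)
    (pull_bot.mpr (hf.isRegular hX).1) (fun _ _ _ => bot_le)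
  have hf₁ := hf.trans h2.iso
  have hl₁ := h3.symm.trans hl
  -- Here the starting ideal is all of `A`, trivially greatest and invariant because `X` is proper.
  obtain ⟨p₂, k1, k2, k3, k4⟩ := p₁.exists_regular h1 (hl₁.symm.isRegular hY).2 h4
    (i := NonUnitalStarAlgHom.id ℂ A) Function.injective_id isClosedIdeal_top (by simp)
    (cpull_top.mpr (hf₁.isRegular hX).2).ge (fun _ _ _ => le_top)
  exact ⟨p₂, ⟨hf₁.trans k2.iso.symm, k1, k3.trans hl₁⟩, k4⟩

/-- A strong shift equivalence of full regular correspondences can be implemented by full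
regular ones. -/
theorem Implements.exists_regular_full {p : ShiftChain.{u, v} A B m} (h : p.Implements X Y)
    (hX : X.IsRegular ∧ X.IsFull) (hY : Y.IsRegular ∧ Y.IsFull) :
    ∃ p' : ShiftChain.{u, v} A B m, p'.Implements X Y ∧
      p'.Forall fun _ _ _ _ Z => Z.IsRegular ∧ Z.IsFull := by
  obtain ⟨p₁, ⟨hf, hlink, hl⟩, hp⟩ := h.exists_regular hX.1 hY.1
  obtain ⟨p₂, k1, k2, k3, k4⟩ := p₁.exists_regular_full hlink (hl.symm.isFull hY.2) hp
    (i := NonUnitalStarAlgHom.id ℂ A) Function.injective_id isClosedIdeal_top (by simp)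
    (push_top.mpr (hf.isFull hX.2)) (fun _ _ _ => le_top)
  exact ⟨p₂, ⟨hf.trans k2.iso.symm, k1, k3.trans hl⟩, k4⟩

end ShiftChain

end CStarCorr

theorem theoremB {A B : Type u} [NonUnitalCStarAlgebra A] [NonUnitalCStarAlgebra B]
    (X : CStarCorr.Correspondence.{u, v} A A) (Y : CStarCorr.Correspondence.{u, v} B B)
    (m : ℕ) (h : ∃ p : CStarCorr.ShiftChain.{u, v} A B m, p.Implements X Y) :
    (X.IsRegular → Y.IsRegular →
      ∃ p : CStarCorr.ShiftChain.{u, v} A B m, p.Implements X Y ∧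
        p.Intermediate fun _ _ Z => Z.IsRegular) ∧
    (X.IsRegular ∧ X.IsFull → Y.IsRegular ∧ Y.IsFull →
      ∃ p : CStarCorr.ShiftChain.{u, v} A B m, p.Implements X Y ∧
        p.Intermediate fun _ _ Z => Z.IsRegular ∧ Z.IsFull) := by
  obtain ⟨p, hp⟩ := h
  refine ⟨fun hX hY => ?_, fun hX hY => ?_⟩
  · obtain ⟨p', h1, h2⟩ := hp.exists_regular hX hY
    exact ⟨p', h1, h2.intermediate fun h h' => h.tensor h'⟩
  · obtain ⟨p', h1, h2⟩ := hp.exists_regular_full hX hY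
    exact ⟨p', h1, h2.intermediate fun h h' => ⟨h.1.tensor h'.1, h.2.tensor h'.2⟩⟩
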